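/- **Setting.** A job set consists of $n$ jobs; job $k$ has an arrival time $a_k$, a deadline $b_k$ with $0\le a_k\le b_k\le 1$, and a workload $R_k\ge 0$. A schedule is a pair of functions $(s(t),job(t))$ with finitely many discontinuities, giving the processor speed and the job executed (or "idle") at time $t$. At time $t$, job $k$ is *waiting* if $a_k\le t<b_k$ and the work done on it before $t$ is less than $R_k$. For a constant $s>0$, an *$s$-schedule* is a schedule that at every time executes, at speed $s$, a waiting job of earliest deadline, and is idle (speed $0$) exactly when no job is waiting; so a job is given up once its deadline has passed. (It is unique up to the treatment of equal deadlines.) A schedule is output as a list of $O(n)$ pieces "run job $k$ during $[x,y)$" with pairwise disjoint nonempty intervals in $[0,1]$. The rank of $x$ in a finite set $A$ of reals is the number of elements of $A$ that are $\le x$. **Algorithm.** Fix $\epsilon>0$, let $T=\{a_1,\dots,a_n,1,1+\epsilon\}$ (a set), $m=|T|$, and let $t_1<\dots<t_m$ be its elements. For $1\le i<m$ keep a number $e_i$, initially $t_i$; the *canonical intervals* are $[e_i,t_{i+1})$. Keep a partition of $\{1,\dots,m-1\}$ into sets, initially singletons, each named by its largest element. Process the jobs in order of nondecreasing deadline. For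 job $k$, with $t_i=a_k$ and $r=R_k$, repeat while $r>0$: by a find of $i$, determine the earliest nonempty canonical interval $[e_p,t_{p+1})$ with $e_p\ge a_k$ ($p$ is the name of the set containing $i$); if $e_p\ge b_k$, stop processing job $k$; otherwise let $u=\min\{b_k,t_{p+1}\}$, run job $k$ during $[e_p,v)$ with $v=\min\{u,e_p+r/s\}$, decrease $r$ by $s(v-e_p)$ and set $e_p$ to $v$; if now $e_p=t_{p+1}$, unite the set named $p$ with the set containing $p+1$, found by one more find; if $v=b_k$, stop processing job $k$. **Theorem 1.** (a) For every job set, every $s>0$, every $\epsilon>0$ and every ordering of the jobs by nondecreasing deadline, the algorithm terminates, every search by a find does return the earliest nonempty canonical interval beginning at or after $a_k$, the pieces that are run form an $s$-schedule, and there are at most $m-2$ unions and at most $2(m-2)+n$ finds. (b) Suppose that, for each $k$, the rank of $a_k$ in $\{a_1,\dots,a_n\}$ and the rank of $b_k$ in $\{b_1,\dots,b_n\}$ are given with the input. Then an $s$-schedule can be computed in $O(n)$ time in the unit-cost RAM model with word size $\Theta(\log n)$: there are a RAM program and constants $c,C$ such that for every $n$, every set of $n$ jobs, every $s>0$ and every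 word size $w\ge c(\lfloor\log_2 n\rfloor+1)$ (for $n=0$: $w\ge c$), the program halts after at most $C(n+1)$ steps, and its output is an $s$-schedule, namely the list of pieces that the algorithm produces for some ordering of the jobs by nondecreasing deadline and every $\epsilon>0$. Here the RAM has word registers and arrays (integers in $[0,2^w)$, with the usual arithmetic and bitwise operations modulo $2^w$) and real registers and arrays for times and workloads (arithmetic operations and comparisons, integer constants, no conversion between reals and words). -/

import Mathlib

open Set Filter Topology MeasureTheory

noncomputable section

/-! ## Jobs, schedules and `s`-schedules -/

/-- A set of `n` jobs over `[0,1]`: job `k` has arrival time `a k`, deadline `b k` and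
workload `R k`. -/
structure JobSet (n : ℕ) where
  a : Fin n → ℝ
  b : Fin n → ℝ
  R : Fin n → ℝ
  zero_le_a : ∀ k, 0 ≤ a k
  a_le_b : ∀ k, a k ≤ b k
  b_le_one : ∀ k, b k ≤ 1
  zero_le_R : ∀ k, 0 ≤ R k

/-- A schedule: the processor speed and the job executed at each time (`none` when idle), with
finitely many discontinuities. Times are real numbers; only those in `[0,1]` matter. -/
structure Schedule (n : ℕ) where
  speed : ℝ → ℝ
  job : ℝ → Option (Fin n)
  piecewise : ∃ D : Finset ℝ, ∀ t ∉ D, ContinuousAt speed t ∧ ∀ᶠ u in 𝓝 t, job u = job t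

/-- The amount of work done on job `k` during `[0, t)`. -/
def Schedule.work {n : ℕ} (S : Schedule n) (k : Fin n) (t : ℝ) : ℝ :=
  ∫ τ in Ico 0 t ∩ {τ | S.job τ = some k}, S.speed τ

/-- Job `k` is waiting to be executed at time `t`: it has arrived, its deadline has not passed,
and it is not finished. -/
def Schedule.Waiting {n : ℕ} (S : Schedule n) (J : JobSet n) (t : ℝ) (k : Fin n) : Prop :=
  J.a k ≤ t ∧ t < J.b k ∧ S.work k t < J.R k

/-- `S` is an `s`-schedule for `J`: at every time it executes, at speed `s`, a waiting job with
the earliest deadline among the waiting jobs, and it is idle exactly when no job is waiting.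
(If deadlines coincide there may be several `s`-schedules.) -/
def IsSSchedule {n : ℕ} (J : JobSet n) (s : ℝ) (S : Schedule n) : Prop :=
  (∀ t k, S.job t = some k →
    S.speed t = s ∧ S.Waiting J t k ∧ ∀ l, S.Waiting J t l → J.b k ≤ J.b l) ∧
  (∀ t, S.job t = none → S.speed t = 0 ∧ ∀ l, ¬ S.Waiting J t l)

/-- The instruction "run job `job` during `[start, finish)`". -/
structure Piece (n : ℕ) where
  job : Fin n
  start : ℝ
  finish : ℝ

/-- A list of pieces describes the job function of the schedule `S`: the pieces are nonempty,
pairwise disjoint subintervals of `[0,1]`, and job `k` runs exactly on the pieces labelled `k`. -/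
def Represents {n : ℕ} (L : List (Piece n)) (S : Schedule n) : Prop :=
  (∀ p ∈ L, 0 ≤ p.start ∧ p.start < p.finish ∧ p.finish ≤ 1) ∧
  L.Pairwise (fun p q => Disjoint (Ico p.start p.finish) (Ico q.start q.finish)) ∧
  ∀ t k, S.job t = some k ↔ ∃ p ∈ L, p.job = k ∧ t ∈ Ico p.start p.finish

/-- The rank (counted from `1`) of `x` in the finite set `A`: the number of elements of `A`, equal
values being counted once, that are at most `x`. -/
def rankIn (A : Finset ℝ) (x : ℝ) : ℕ := (A.filter (fun y => y ≤ x)).card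

/-! ## The offline algorithm over an interval union-find structure -/

/-- The set `T = {a_1, …, a_n, 1, 1 + ε}`. -/
def timePoints {n : ℕ} (J : JobSet n) (ε : ℝ) : Finset ℝ :=
  Finset.univ.image J.a ∪ {1, 1 + ε}

/-- The `i`-th smallest element of `T`, for `1 ≤ i ≤ |T|`. -/
def nthSmallest (T : Finset ℝ) (i : ℕ) : ℝ := (T.sort (fun x y => x ≤ y)).getD (i - 1) 0

/-- State of the algorithm: the numbers `e_i`, for `1 ≤ i < m`; the union-find structure on
`{1, …, m - 1}`, where `name i` is the name of the set that contains `i`; the numbers of union and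
find operations so far; the pieces scheduled so far. -/
structure AlgState (n : ℕ) where
  e : ℕ → ℝ
  name : ℕ → ℕ
  unions : ℕ
  finds : ℕ
  pieces : List (Piece n)

/-- Initially `e_i = t_i`, and every set is a singleton. -/
def AlgState.init (n : ℕ) (T : Finset ℝ) : AlgState n where
  e := nthSmallest T
  name := id
  unions := 0
  finds := 0
  pieces := []

/-- One find operation, without further effect. -/
def AlgState.countFind {n : ℕ} (σ : AlgState n) : AlgState n :=
  { σ with finds := σ.finds + 1 }

/-- Schedule job `k` during `[e_p, v)` and set `e_p` to `v`. -/
def AlgState.schedule {n : ℕ} (σ : AlgState n) (k : Fin n) (p : ℕ) (v : ℝ) : AlgState n :=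
  { σ with
    e := Function.update σ.e p v
    pieces := σ.pieces ++ [⟨k, σ.e p, v⟩] }

/-- Merge the set named `p` with the set containing `p + 1`, which takes one find (for the latter)
and one union. The new set inherits the name of the set containing `p + 1`. -/
def AlgState.union {n : ℕ} (σ : AlgState n) (p : ℕ) : AlgState n :=
  { σ with
    name := fun x => if σ.name x = p then σ.name (p + 1) else σ.name x
    unions := σ.unions + 1
    finds := σ.finds + 1 }

open Classical in
/-- Everything that one successful search for the canonical interval `[e_p, t_{p+1})` leads to:
the find of the search, the scheduling of job `k` during `[e_p, v)`, and a union if the canonical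
interval has become empty. -/
def AlgState.place {n : ℕ} (T : Finset ℝ) (σ : AlgState n) (k : Fin n) (p : ℕ) (v : ℝ) :
    AlgState n :=
  if v = nthSmallest T (p + 1) then (σ.countFind.schedule k p v).union p
  else σ.countFind.schedule k p v

/-- The search: a find of `i` returns `p`, and `[e_p, t_{p+1})` is the earliest nonempty canonical
interval that begins at or after `t_i`. (If a find returned anything else, a run would be stuck.) -/
def AlgState.Search {n : ℕ} (T : Finset ℝ) (σ : AlgState n) (i p : ℕ) : Prop :=
  σ.name i = p ∧
  IsLeast {q | 1 ≤ q ∧ q < T.card ∧ nthSmallest T i ≤ σ.e q ∧ σ.e q < nthSmallest T (q + 1)} p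

/-- The while loop for job `k`, where `t_i = a_k` and `r` is the remaining workload. The loop ends
when the job is finished, when the canonical interval found is not before the deadline, or when
the job has been scheduled up to its deadline. -/
inductive PlaceJob {n : ℕ} (J : JobSet n) (s : ℝ) (T : Finset ℝ) (k : Fin n) (i : ℕ) :
    AlgState n → ℝ → AlgState n → Prop
  | done (σ : AlgState n) (r : ℝ) (hr : r ≤ 0) : PlaceJob J s T k i σ r σ
  | late (σ : AlgState n) (r : ℝ) (p : ℕ) (hr : 0 < r) (hp : σ.Search T i p)
      (hb : J.b k ≤ σ.e p) :
      PlaceJob J s T k i σ r σ.countFind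
  | fill (σ σ' : AlgState n) (r : ℝ) (p : ℕ) (u : ℝ) (hr : 0 < r) (hp : σ.Search T i p)
      (hb : σ.e p < J.b k) (hu : u = min (J.b k) (nthSmallest T (p + 1)))
      (h : s * (u - σ.e p) < r) (hub : u < J.b k)
      (rest : PlaceJob J s T k i (σ.place T k p u) (r - s * (u - σ.e p)) σ') :
      PlaceJob J s T k i σ r σ'
  | cut (σ : AlgState n) (r : ℝ) (p : ℕ) (u : ℝ) (hr : 0 < r) (hp : σ.Search T i p)
      (hb : σ.e p < J.b k) (hu : u = min (J.b k) (nthSmallest T (p + 1)))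
      (h : s * (u - σ.e p) < r) (hub : u = J.b k) :
      PlaceJob J s T k i σ r (σ.place T k p u)
  | finish (σ : AlgState n) (r : ℝ) (p : ℕ) (u : ℝ) (hr : 0 < r) (hp : σ.Search T i p)
      (hb : σ.e p < J.b k) (hu : u = min (J.b k) (nthSmallest T (p + 1)))
      (h : r ≤ s * (u - σ.e p)) :
      PlaceJob J s T k i σ r (σ.place T k p (σ.e p + r / s))

/-- The for loop: place the jobs of a list one after the other. -/
inductive PlaceJobs {n : ℕ} (J : JobSet n) (s : ℝ) (T : Finset ℝ) :
    List (Fin n) → AlgState n → AlgState n → Prop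
  | nil (σ : AlgState n) : PlaceJobs J s T [] σ σ
  | cons (k : Fin n) (ks : List (Fin n)) (σ σ' σ'' : AlgState n)
      (first : PlaceJob J s T k (rankIn T (J.a k)) σ (J.R k) σ')
      (rest : PlaceJobs J s T ks σ' σ'') :
      PlaceJobs J s T (k :: ks) σ σ''

/-- The permutation `π` lists the jobs in the order of their deadlines. -/
def IsDeadlineOrder {n : ℕ} (J : JobSet n) (π : Equiv.Perm (Fin n)) : Prop :=
  Monotone (fun i => J.b (π i))

/-- The algorithm, run on the jobs in the order `π`, terminates in the state `σ`. -/
def AlgRun {n : ℕ} (J : JobSet n) (s ε : ℝ) (π : Equiv.Perm (Fin n)) (σ : AlgState n) : Prop :=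
  PlaceJobs J s (timePoints J ε) (List.ofFn π) (AlgState.init n (timePoints J ε)) σ

/-! ## Unit-cost RAM with word size `w`

There are word registers and word arrays, whose cells hold integers in `[0, 2^w)`, and real
registers and real arrays for the numerical data of the problem. Arrays are addressed by the
contents of word registers. A program is finite, so it uses finitely many registers and arrays.
Words and reals cannot be converted into each other (there is no rounding of reals), and the only
real constants in a program are integers. -/

namespace RAM

/-- Word operations. -/
inductive WordOp
  | add | sub | mul | div | mod | and | or | xor | shl | shr

/-- Word operations are carried out modulo `2^w`. -/
def WordOp.eval (w : ℕ) : WordOp → ℕ → ℕ → ℕ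
  | .add, x, y => (x + y) % 2 ^ w
  | .sub, x, y => (x + (2 ^ w - y % 2 ^ w)) % 2 ^ w
  | .mul, x, y => (x * y) % 2 ^ w
  | .div, x, y => (x / y) % 2 ^ w
  | .mod, x, y => (x % y) % 2 ^ w
  | .and, x, y => (x &&& y) % 2 ^ w
  | .or, x, y => (x ||| y) % 2 ^ w
  | .xor, x, y => (x ^^^ y) % 2 ^ w
  | .shl, x, y => (x <<< y) % 2 ^ w
  | .shr, x, y => (x >>> y) % 2 ^ w

/-- Operations on reals. -/
inductive RealOp
  | add | sub | mul | div

def RealOp.eval : RealOp → ℝ → ℝ → ℝ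
  | .add, x, y => x + y
  | .sub, x, y => x - y
  | .mul, x, y => x * y
  | .div, x, y => x / y

/-- Elementary instructions. Registers and arrays are named by numbers; `d` is the destination. -/
inductive Instr
  | const (d v : ℕ)
  | copy (d x : ℕ)
  | op (o : WordOp) (d x y : ℕ)
  | load (d A x : ℕ)
  | store (A x y : ℕ)
  | rconst (d : ℕ) (v : ℤ)
  | rcopy (d x : ℕ)
  | rop (o : RealOp) (d x y : ℕ)
  | rload (d A x : ℕ)
  | rstore (A x y : ℕ)

/-- Contents of word registers, word arrays, real registers, real arrays. -/
structure State where
  reg : ℕ → ℕ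
  arr : ℕ → ℕ → ℕ
  rreg : ℕ → ℝ
  rarr : ℕ → ℕ → ℝ

/-- Effect of an instruction: `load` is `reg d := arr A [reg x]`, `store` is
`arr A [reg x] := reg y`, and likewise for reals. -/
def Instr.eval (w : ℕ) : Instr → State → State
  | .const d v, σ => { σ with reg := Function.update σ.reg d (v % 2 ^ w) }
  | .copy d x, σ => { σ with reg := Function.update σ.reg d (σ.reg x) }
  | .op o d x y, σ => { σ with reg := Function.update σ.reg d (o.eval w (σ.reg x) (σ.reg y)) }
  | .load d A x, σ => { σ with reg := Function.update σ.reg d (σ.arr A (σ.reg x)) }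
  | .store A x y, σ =>
      { σ with arr := Function.update σ.arr A (Function.update (σ.arr A) (σ.reg x) (σ.reg y)) }
  | .rconst d v, σ => { σ with rreg := Function.update σ.rreg d (v : ℝ) }
  | .rcopy d x, σ => { σ with rreg := Function.update σ.rreg d (σ.rreg x) }
  | .rop o d x y, σ => { σ with rreg := Function.update σ.rreg d (o.eval (σ.rreg x) (σ.rreg y)) }
  | .rload d A x, σ => { σ with rreg := Function.update σ.rreg d (σ.rarr A (σ.reg x)) }
  | .rstore A x y, σ =>
      { σ with rarr := Function.update σ.rarr A (Function.update (σ.rarr A) (σ.reg x) (σ.rreg y)) }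

/-- Tests on the contents of two registers. -/
inductive Test
  | wlt (x y : ℕ) | wle (x y : ℕ) | weq (x y : ℕ) | wne (x y : ℕ)
  | rlt (x y : ℕ) | rle (x y : ℕ)

def Test.Holds : Test → State → Prop
  | .wlt x y, σ => σ.reg x < σ.reg y
  | .wle x y, σ => σ.reg x ≤ σ.reg y
  | .weq x y, σ => σ.reg x = σ.reg y
  | .wne x y, σ => σ.reg x ≠ σ.reg y
  | .rlt x y, σ => σ.rreg x < σ.rreg y
  | .rle x y, σ => σ.rreg x ≤ σ.rreg y

/-- Programs: jumps are used in the form of branches and loops only. -/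
inductive Prog
  | instr (i : Instr)
  | seq (P Q : Prog)
  | ite (c : Test) (P Q : Prog)
  | loop (c : Test) (P : Prog)

/-- `Exec w P σ τ σ'`: started in the state `σ` with word size `w`, the program `P` halts after
exactly `τ` steps in the state `σ'`. Each instruction and each evaluation of a test is a step. -/
inductive Exec (w : ℕ) : Prog → State → ℕ → State → Prop
  | instr (i : Instr) (σ : State) : Exec w (.instr i) σ 1 (i.eval w σ)
  | seq (P Q : Prog) (σ σ' σ'' : State) (τ τ' : ℕ) (hP : Exec w P σ τ σ')
      (hQ : Exec w Q σ' τ' σ'') : Exec w (.seq P Q) σ (τ + τ') σ''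
  | ite_true (c : Test) (P Q : Prog) (σ σ' : State) (τ : ℕ) (hc : c.Holds σ)
      (hP : Exec w P σ τ σ') : Exec w (.ite c P Q) σ (τ + 1) σ'
  | ite_false (c : Test) (P Q : Prog) (σ σ' : State) (τ : ℕ) (hc : ¬ c.Holds σ)
      (hQ : Exec w Q σ τ σ') : Exec w (.ite c P Q) σ (τ + 1) σ'
  | loop_true (c : Test) (P : Prog) (σ σ' σ'' : State) (τ τ' : ℕ) (hc : c.Holds σ)
      (hP : Exec w P σ τ σ') (hL : Exec w (.loop c P) σ' τ' σ'') :
      Exec w (.loop c P) σ (τ + τ' + 1) σ''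
  | loop_false (c : Test) (P : Prog) (σ : State) (hc : ¬ c.Holds σ) :
      Exec w (.loop c P) σ 1 σ

/-- An array with the given first `n` entries, and zeros after them. -/
def ofFn {α : Type} [Zero α] {n : ℕ} (f : Fin n → α) (i : ℕ) : α :=
  if h : i < n then f ⟨i, h⟩ else 0

/-- The input: word register `0` holds `n`, real register `0` holds `s`; word arrays `0` and `1`
hold the ranks of the arrival times among the arrival times and of the deadlines among the
deadlines; real arrays `0`, `1`, `2` hold the arrival times, deadlines and workloads. Everything
else is zero. The jobs may be listed in any order. -/
def input {n : ℕ} (J : JobSet n) (s : ℝ) : State where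
  reg := fun i => if i = 0 then n else 0
  arr := fun A =>
    if A = 0 then ofFn (fun k => rankIn (Finset.univ.image J.a) (J.a k))
    else if A = 1 then ofFn (fun k => rankIn (Finset.univ.image J.b) (J.b k))
    else fun _ => 0
  rreg := fun i => if i = 0 then s else 0
  rarr := fun A =>
    if A = 0 then ofFn J.a else if A = 1 then ofFn J.b else if A = 2 then ofFn J.R
    else fun _ => 0

/-- The output: word register `0` holds the length of the list of pieces, word array `2` the
(zero-based) numbers of the jobs of the pieces, real arrays `3` and `4` their end points. -/
def Outputs {n : ℕ} (σ : State) (L : List (Piece n)) : Prop :=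
  σ.reg 0 = L.length ∧
  ∀ (j : ℕ) (hj : j < L.length),
    σ.arr 2 j = ((L[j]'hj).job : ℕ) ∧
    σ.rarr 3 j = (L[j]'hj).start ∧
    σ.rarr 4 j = (L[j]'hj).finish

end RAM

end

/-! Correctness rests on one picture (`Greedy`): the occupied points are exactly those of the
intervals `[t_q, e_q)`, so a canonical interval is the free part of its slot `[t_q, t_{q+1})`.
Arrival times are slot borders, hence the first free time at or after `a_k = t_i` is `e_p` for the
least `p ≥ i` whose canonical interval is nonempty, and this `p` is the name of the set of `i`
(`Valid.search_iff`, `Valid.place`). In deadline order, each job thus takes the earliest free time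
of its window. Afterwards, at every point of the window, the job is already finished or the point is
occupied by a job whose deadline is no later; further placements destroy neither alternative
(`PlacedAll.exists_placeJobs`). Conversely, the pieces of a job are laid from left to right, so the
job is unfinished while it runs (`Placing.place`). Together this is the definition of an
`s`-schedule (`PlacedAll.exists_schedule`).

Every round of a job except possibly the last fills a canonical interval and so makes a union. The
last canonical interval begins at `1`, where no job may run, and stays nonempty; this leaves `m - 2`
unions. A union comes with two finds, and each job adds at most one more.

For linear time, a find is read as a successor query: the least index `≥ i` outside the set `dead`
of emptied canonical intervals. The indices are cut into blocks of `B = ⌊log₂ n⌋ + 1` bits. Inside a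
block, a shift and a table of lowest bits with `2^B = O(n)` entries answer the query. The blocks,
`O(n / B)` in number, form a quick-find structure whose intervals consist of empty blocks followed
by one nonempty block. Relabelling the smaller of two united intervals costs `O(M log M)` in total
for `M` blocks, which is `O(n)` for this `B` (`QuickFind.union`, `QuickFind.potential_le`). Finds
take constant time (`runs_findProg`), and a deletion takes constant time apart from relabelling
(`runs_deleteProg`). The given ranks replace sorting: they place the arrival times in an array and
the jobs in buckets.

The program does not know `ε`: the point `1 + ε` is never read. Its single run therefore simulates
the algorithm for every `ε`, and determinism of the RAM yields the same list of pieces each time. -/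

noncomputable section

/-! ## Ranks and order statistics of finite sets of reals -/

section Ranks

variable {T : Finset ℝ}

lemma nthSmallest_eq_orderEmbOfFin {i : ℕ} (h1 : 1 ≤ i) (h2 : i ≤ T.card) :
    nthSmallest T i = T.orderEmbOfFin rfl ⟨i - 1, by omega⟩ := by
  rw [Finset.orderEmbOfFin_apply]
  unfold nthSmallest
  rw [List.getD_eq_getElem _ _ (by rw [Finset.length_sort]; omega)]
  rfl

lemma nthSmallest_mem {i : ℕ} (h1 : 1 ≤ i) (h2 : i ≤ T.card) : nthSmallest T i ∈ T := by
  rw [nthSmallest_eq_orderEmbOfFin h1 h2]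
  exact Finset.orderEmbOfFin_mem _ _ _

lemma nthSmallest_lt {i j : ℕ} (h1 : 1 ≤ i) (hij : i < j) (h2 : j ≤ T.card) :
    nthSmallest T i < nthSmallest T j := by
  rw [nthSmallest_eq_orderEmbOfFin h1 (by omega), nthSmallest_eq_orderEmbOfFin (by omega) h2]
  apply (T.orderEmbOfFin rfl).strictMono
  simp only [Fin.mk_lt_mk]
  omega

lemma nthSmallest_le {i j : ℕ} (h1 : 1 ≤ i) (hij : i ≤ j) (h2 : j ≤ T.card) :
    nthSmallest T i ≤ nthSmallest T j := by
  rcases hij.eq_or_lt with rfl | h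
  · exact le_rfl
  · exact (nthSmallest_lt h1 h h2).le

lemma exists_nthSmallest_eq {x : ℝ} (hx : x ∈ T) :
    ∃ i, 1 ≤ i ∧ i ≤ T.card ∧ nthSmallest T i = x := by
  have : x ∈ Set.range (T.orderEmbOfFin rfl) := by
    rw [Finset.range_orderEmbOfFin]; exact hx
  obtain ⟨j, hj⟩ := this
  refine ⟨j + 1, by omega, by omega, ?_⟩
  rw [nthSmallest_eq_orderEmbOfFin (by omega) (by omega), ← hj]
  congr

lemma rankIn_nthSmallest {i : ℕ} (h1 : 1 ≤ i) (h2 : i ≤ T.card) :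
    rankIn T (nthSmallest T i) = i := by
  unfold rankIn
  have : T.filter (fun y => y ≤ nthSmallest T i) = (Finset.Icc 1 i).image (nthSmallest T) := by
    ext x
    simp only [Finset.mem_filter, Finset.mem_image, Finset.mem_Icc]
    constructor
    · rintro ⟨hx, hle⟩
      obtain ⟨j, hj1, hj2, rfl⟩ := exists_nthSmallest_eq hx
      refine ⟨j, ⟨hj1, ?_⟩, rfl⟩
      by_contra! h
      exact absurd (nthSmallest_lt h1 h hj2) (not_lt.2 hle)
    · rintro ⟨j, ⟨hj1, hj2⟩, rfl⟩
      exact ⟨nthSmallest_mem hj1 (hj2.trans h2), nthSmallest_le hj1 hj2 h2⟩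
  rw [this, Finset.card_image_of_injOn]
  · simp
  · intro x hx y hy hxy
    simp only [Finset.coe_Icc, Set.mem_Icc] at hx hy
    by_contra hne
    rcases lt_or_gt_of_ne hne with h | h
    · exact (nthSmallest_lt hx.1 h (by omega)).ne hxy
    · exact (nthSmallest_lt hy.1 h (by omega)).ne hxy.symm

lemma nthSmallest_rankIn {x : ℝ} (hx : x ∈ T) : nthSmallest T (rankIn T x) = x := by
  obtain ⟨i, h1, h2, rfl⟩ := exists_nthSmallest_eq hx
  rw [rankIn_nthSmallest h1 h2]

lemma one_le_rankIn {x : ℝ} (hx : x ∈ T) : 1 ≤ rankIn T x := by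
  obtain ⟨i, h1, h2, rfl⟩ := exists_nthSmallest_eq hx
  rwa [rankIn_nthSmallest h1 h2]

lemma rankIn_le_card (x : ℝ) : rankIn T x ≤ T.card := Finset.card_filter_le _ _

lemma rankIn_mono {x y : ℝ} (h : x ≤ y) : rankIn T x ≤ rankIn T y := by
  apply Finset.card_le_card
  intro z hz
  simp only [Finset.mem_filter] at hz ⊢
  exact ⟨hz.1, hz.2.trans h⟩

lemma rankIn_lt {x y : ℝ} (h : x < y) (hy : y ∈ T) : rankIn T x < rankIn T y := by
  apply Finset.card_lt_card
  rw [Finset.ssubset_iff_of_subset]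
  · exact ⟨y, by simp [hy], by simp [h]⟩
  · intro z hz
    simp only [Finset.mem_filter] at hz ⊢
    exact ⟨hz.1, hz.2.trans h.le⟩

lemma le_of_rankIn_le {x y : ℝ} (hx : x ∈ T) (h : rankIn T x ≤ rankIn T y) : x ≤ y := by
  by_contra! hlt
  exact absurd (rankIn_lt hlt hx) (not_lt.2 h)

end Ranks

/-! ### The points `1` and `1 + ε` among the time points -/

section TimePoints

variable {n : ℕ} (J : JobSet n) {ε : ℝ}

lemma JobSet.a_le_one (k : Fin n) : J.a k ≤ 1 := (J.a_le_b k).trans (J.b_le_one k)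

lemma arrival_mem_timePoints (ε : ℝ) (k : Fin n) : J.a k ∈ timePoints J ε := by
  simp [timePoints]

lemma one_mem_timePoints (ε : ℝ) : (1 : ℝ) ∈ timePoints J ε := by simp [timePoints]

lemma timePoints_insert (hε : 0 < ε) :
    (timePoints J ε).filter (fun y => y ≤ 1) = Finset.univ.image J.a ∪ {1} := by
  ext x
  simp only [timePoints, Finset.mem_filter, Finset.mem_union, Finset.mem_image, Finset.mem_univ,
    true_and, Finset.mem_insert, Finset.mem_singleton]
  constructor
  · rintro ⟨h | h | h, hx⟩
    · exact Or.inl h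
    · exact Or.inr h
    · linarith
  · rintro (⟨k, rfl⟩ | rfl)
    · exact ⟨Or.inl ⟨k, rfl⟩, J.a_le_one k⟩
    · exact ⟨Or.inr (Or.inl rfl), le_rfl⟩

/-- Only `1 + ε` lies beyond `1`, so `1` is the last but one time point and the last canonical
interval starts there. -/
lemma rankIn_timePoints_one (hε : 0 < ε) :
    rankIn (timePoints J ε) 1 = (timePoints J ε).card - 1 := by
  have h : timePoints J ε = insert (1 + ε) ((timePoints J ε).filter (fun y => y ≤ 1)) := by
    rw [timePoints_insert J hε]
    ext x
    simp only [timePoints, Finset.mem_union, Finset.mem_insert, Finset.mem_singleton]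
    tauto
  have h2 : (timePoints J ε).card = ((timePoints J ε).filter (fun y => y ≤ 1)).card + 1 := by
    conv_lhs => rw [h]
    rw [Finset.card_insert_of_notMem]
    simp [hε]
  rw [h2]
  rfl

lemma card_timePoints_eq (hε : 0 < ε) :
    (timePoints J ε).card = (Finset.univ.image J.a ∪ {1}).card + 1 := by
  have h1 := rankIn_timePoints_one J hε
  have h2 := one_le_rankIn (one_mem_timePoints J ε)
  rw [rankIn, timePoints_insert J hε] at h1 h2
  omega

lemma two_le_card_timePoints (hε : 0 < ε) : 2 ≤ (timePoints J ε).card := by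
  have h1 := rankIn_timePoints_one J hε
  have h2 := one_le_rankIn (one_mem_timePoints J ε)
  omega

lemma card_timePoints_le (hε : 0 < ε) : (timePoints J ε).card ≤ n + 2 := by
  rw [card_timePoints_eq J hε]
  have := Finset.card_union_le (Finset.univ.image J.a) {1}
  have h2 := Finset.card_image_le (s := Finset.univ) (f := J.a)
  simp only [Finset.card_singleton, Finset.card_univ, Fintype.card_fin] at this h2
  omega

lemma nthSmallest_timePoints_one (hε : 0 < ε) :
    nthSmallest (timePoints J ε) ((timePoints J ε).card - 1) = 1 := by
  rw [← rankIn_timePoints_one J hε, nthSmallest_rankIn (one_mem_timePoints J ε)]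

lemma rankIn_arrival_lt (hε : 0 < ε) (k : Fin n) :
    rankIn (timePoints J ε) (J.a k) < (timePoints J ε).card := by
  have h1 := rankIn_timePoints_one J hε
  have h2 := two_le_card_timePoints J hε
  have := rankIn_mono (T := timePoints J ε) (J.a_le_one k)
  omega

/-- The points `1` and `1 + ε` do not affect the ranks of the arrival times. -/
lemma rankIn_timePoints_arrival (hε : 0 < ε) (k : Fin n) :
    rankIn (timePoints J ε) (J.a k) = rankIn (Finset.univ.image J.a) (J.a k) := by
  unfold rankIn
  congr 1
  ext x
  simp only [timePoints, Finset.mem_filter, Finset.mem_union, Finset.mem_image, Finset.mem_univ,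
    true_and, Finset.mem_insert, Finset.mem_singleton]
  have := J.a_le_one k
  constructor
  · rintro ⟨h | rfl | rfl, hx⟩
    · exact ⟨h, hx⟩
    · exact ⟨⟨k, le_antisymm this hx⟩, hx⟩
    · linarith
  · rintro ⟨h, hx⟩
    exact ⟨Or.inl h, hx⟩

/-- An order statistic of the time points below the last one is `1` or an arrival time. -/
lemma nthSmallest_timePoints_cases (hε : 0 < ε) {q : ℕ} (h1 : 1 ≤ q)
    (h2 : q < (timePoints J ε).card) :
    nthSmallest (timePoints J ε) q = 1 ∨
      ∃ k, rankIn (timePoints J ε) (J.a k) = q ∧ nthSmallest (timePoints J ε) q = J.a k := by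
  have hmem := nthSmallest_mem (T := timePoints J ε) h1 h2.le
  have hr := rankIn_nthSmallest (T := timePoints J ε) h1 h2.le
  have hle : nthSmallest (timePoints J ε) q ≤ 1 := by
    rw [← nthSmallest_timePoints_one J hε]
    exact nthSmallest_le h1 (by omega) (by omega)
  generalize nthSmallest (timePoints J ε) q = x at hmem hr hle
  simp only [timePoints, Finset.mem_union, Finset.mem_image, Finset.mem_univ,
    true_and, Finset.mem_insert, Finset.mem_singleton] at hmem
  rcases hmem with ⟨k, rfl⟩ | rfl | rfl
  · exact Or.inr ⟨k, hr, rfl⟩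
  · exact Or.inl rfl
  · linarith

end TimePoints

/-! ## Invariants of the union-find structure -/

namespace AlgState

variable {n : ℕ} {T : Finset ℝ} {σ : AlgState n} {k : Fin n} {p : ℕ} {v : ℝ}

open Classical in
/-- The indices of the canonical intervals that have become empty. -/
def dead (T : Finset ℝ) (σ : AlgState n) : Finset ℕ :=
  (Finset.Ico 1 T.card).filter (fun q => σ.e q = nthSmallest T (q + 1))

lemma mem_dead {q : ℕ} :
    q ∈ σ.dead T ↔ (1 ≤ q ∧ q < T.card) ∧ σ.e q = nthSmallest T (q + 1) := by
  simp [dead]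

lemma place_e : (σ.place T k p v).e = Function.update σ.e p v := by
  unfold place; split_ifs <;> rfl

lemma place_pieces : (σ.place T k p v).pieces = σ.pieces ++ [⟨k, σ.e p, v⟩] := by
  unfold place; split_ifs <;> rfl

lemma place_of_eq (h : v = nthSmallest T (p + 1)) :
    σ.place T k p v = (σ.countFind.schedule k p v).union p := by
  unfold place; rw [if_pos h]

lemma place_of_ne (h : v ≠ nthSmallest T (p + 1)) :
    σ.place T k p v = σ.countFind.schedule k p v := by
  unfold place; rw [if_neg h]

/-- The numbers `e_i` stay in their intervals, the last canonical interval is untouched, and the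
names of the sets are those of the nonempty canonical intervals. -/
structure Valid (T : Finset ℝ) (σ : AlgState n) : Prop where
  le_e : ∀ q, 1 ≤ q → q < T.card → nthSmallest T q ≤ σ.e q
  e_le : ∀ q, 1 ≤ q → q < T.card → σ.e q ≤ nthSmallest T (q + 1)
  e_last : σ.e (T.card - 1) = nthSmallest T (T.card - 1)
  name_isLeast : ∀ i, 1 ≤ i → i < T.card →
    IsLeast {q | i ≤ q ∧ q < T.card ∧ σ.e q < nthSmallest T (q + 1)} (σ.name i)
  unions_eq : σ.unions = (σ.dead T).card

namespace Valid

lemma init : (AlgState.init n T).Valid T where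
  le_e _ _ _ := le_rfl
  e_le q h1 h2 := (nthSmallest_lt h1 (Nat.lt_succ_self q) h2).le
  e_last := rfl
  name_isLeast i h1 h2 := by
    refine ⟨⟨le_rfl, h2, nthSmallest_lt h1 (Nat.lt_succ_self i) h2⟩, fun q hq => hq.1⟩
  unions_eq := by
    symm
    change (dead T (AlgState.init n T)).card = 0
    rw [Finset.card_eq_zero, Finset.eq_empty_iff_forall_notMem]
    intro q hq
    rw [mem_dead] at hq
    exact (nthSmallest_lt hq.1.1 (Nat.lt_succ_self q) hq.1.2).ne hq.2

/-- By `e_last` the last canonical interval never becomes empty. Together with `unions_eq` this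
bounds the unions, one for each emptied interval. -/
lemma dead_subset (h : σ.Valid T) (hT : 2 ≤ T.card) :
    σ.dead T ⊆ Finset.Ico 1 (T.card - 1) := by
  intro q hq
  rw [mem_dead] at hq
  rw [Finset.mem_Ico]
  refine ⟨hq.1.1, ?_⟩
  by_contra! hc
  have hqe : q = T.card - 1 := by omega
  have h2 := hq.2
  have h3 := nthSmallest_lt (T := T) hq.1.1 (Nat.lt_succ_self q) hq.1.2
  rw [hqe, h.e_last, ← hqe] at h2
  exact h3.ne h2

lemma unions_le (h : σ.Valid T) (hT : 2 ≤ T.card) : σ.unions ≤ T.card - 2 := by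
  rw [h.unions_eq]
  have := Finset.card_le_card (h.dead_subset hT)
  rw [Nat.card_Ico] at this
  omega

/-- Each `e_q` stays in its slot: a nonempty canonical interval with `q < i` has `e_q < t_{q+1} ≤
t_i`, while `q ≥ i` gives `e_q ≥ t_q ≥ t_i`. The condition on times in `Search` thus becomes the
condition on indices that `name_isLeast` maintains. -/
lemma search_iff (h : σ.Valid T) {i : ℕ} (h1 : 1 ≤ i) (h2 : i < T.card) :
    σ.Search T i p ↔ IsLeast {q | i ≤ q ∧ q < T.card ∧ σ.e q < nthSmallest T (q + 1)} p := by
  have hset : {q | 1 ≤ q ∧ q < T.card ∧ nthSmallest T i ≤ σ.e q ∧ σ.e q < nthSmallest T (q + 1)}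
      = {q | i ≤ q ∧ q < T.card ∧ σ.e q < nthSmallest T (q + 1)} := by
    ext q
    simp only [Set.mem_ofPred_eq]
    constructor
    · rintro ⟨ha, hb, hc, hd⟩
      refine ⟨?_, hb, hd⟩
      by_contra! hlt
      have := nthSmallest_le (T := T) (by omega : 1 ≤ q + 1) (by omega : q + 1 ≤ i) h2.le
      linarith
    · rintro ⟨ha, hb, hd⟩
      exact ⟨by omega, hb, (nthSmallest_le h1 ha hb.le).trans (h.le_e q (by omega) hb), hd⟩
  unfold Search
  rw [hset]
  constructor
  · exact fun hs => hs.2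
  · exact fun hs => ⟨(h.name_isLeast i h1 h2).unique hs, hs⟩

lemma search_name (h : σ.Valid T) {i : ℕ} (h1 : 1 ≤ i) (h2 : i < T.card) :
    σ.Search T i (σ.name i) :=
  (h.search_iff h1 h2).2 (h.name_isLeast i h1 h2)

lemma countFind (h : σ.Valid T) : σ.countFind.Valid T :=
  ⟨h.le_e, h.e_le, h.e_last, h.name_isLeast, h.unions_eq⟩

/-- What is known when a job is run from `e_p` to `v`. -/
structure Placeable (T : Finset ℝ) (σ : AlgState n) (p : ℕ) (v : ℝ) : Prop where
  one_le : 1 ≤ p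
  lt_last : p < T.card - 1
  e_lt : σ.e p < v
  le_next : v ≤ nthSmallest T (p + 1)

/-- The last canonical interval begins at `t_{m-1}`, so a nonempty run ending by `t_{m-1}` cannot be
in it. In the application `t_{m-1} = 1`, and `v` is at most a deadline. -/
lemma placeable (h : σ.Valid T) {i : ℕ} (h1 : 1 ≤ i) (h2 : i < T.card) (hs : σ.Search T i p)
    (hev : σ.e p < v) (hv : v ≤ nthSmallest T (p + 1))
    (hlast : v ≤ nthSmallest T (T.card - 1)) : Placeable T σ p v := by
  rw [h.search_iff h1 h2] at hs
  obtain ⟨⟨ha, hb, hc⟩, -⟩ := hs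
  refine ⟨by omega, ?_, hev, hv⟩
  by_contra! hp
  have : p = T.card - 1 := by omega
  rw [this, h.e_last] at hev
  linarith

lemma dead_place_of_eq (hp : Placeable T σ p v) (h : v = nthSmallest T (p + 1)) :
    (σ.place T k p v).dead T = insert p (σ.dead T) := by
  ext q
  have := hp.one_le
  have := hp.lt_last
  rw [Finset.mem_insert, mem_dead, mem_dead, place_e]
  rcases eq_or_ne q p with rfl | hq
  · simp only [Function.update_self, true_or, iff_true]
    exact ⟨⟨by omega, by omega⟩, h⟩
  · simp [hq]

lemma dead_place_of_ne (hp : Placeable T σ p v) (h : v ≠ nthSmallest T (p + 1)) :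
    (σ.place T k p v).dead T = σ.dead T := by
  ext q
  rw [mem_dead, mem_dead, place_e]
  rcases eq_or_ne q p with rfl | hq
  · simp only [Function.update_self]
    have := hp.e_lt
    have := hp.le_next
    constructor
    · rintro ⟨_, h2⟩; exact absurd h2 h
    · rintro ⟨_, h2⟩; exfalso; linarith
  · simp [Function.update_of_ne hq]

lemma notMem_dead (hp : Placeable T σ p v) : p ∉ σ.dead T := by
  rw [mem_dead]
  rintro ⟨_, h⟩
  have := hp.e_lt
  have := hp.le_next
  linarith

/-- If `p` dies, only the indices named `p` lose their least live successor, and the next one is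
that of `p + 1`; this is what the union assigns. A partial filling leaves the live indices
unchanged. -/
lemma place (h : σ.Valid T) (hp : Placeable T σ p v) (k : Fin n) :
    (σ.place T k p v).Valid T := by
  have hp1 := hp.one_le
  have hp2 := hp.lt_last
  have hp3 := hp.e_lt
  have hp4 := hp.le_next
  refine ⟨?_, ?_, ?_, ?_, ?_⟩
  · intro q h1 h2
    rw [place_e]
    rcases eq_or_ne q p with rfl | hq
    · rw [Function.update_self]
      exact (h.le_e q h1 h2).trans hp3.le
    · rw [Function.update_of_ne hq]
      exact h.le_e q h1 h2
  · intro q h1 h2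
    rw [place_e]
    rcases eq_or_ne q p with rfl | hq
    · rwa [Function.update_self]
    · rw [Function.update_of_ne hq]
      exact h.e_le q h1 h2
  · rw [place_e, Function.update_of_ne (by omega)]
    exact h.e_last
  · intro i h1 h2
    by_cases hv : v = nthSmallest T (p + 1)
    · have hset : {q | i ≤ q ∧ q < T.card ∧ (σ.place T k p v).e q < nthSmallest T (q + 1)}
          = {q | i ≤ q ∧ q < T.card ∧ σ.e q < nthSmallest T (q + 1)} \ {p} := by
        ext q
        simp only [Set.mem_ofPred_eq, place_e, Set.mem_sdiff, Set.mem_singleton_iff]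
        rcases eq_or_ne q p with rfl | hq
        · simp only [Function.update_self, not_true, and_false, iff_false]
          rintro ⟨_, _, h3⟩
          linarith
        · simp [hq]
      rw [hset, place_of_eq hv]
      show IsLeast _ (if σ.name i = p then σ.name (p + 1) else σ.name i)
      have hi := h.name_isLeast i h1 h2
      split_ifs with hn
      · have hpn := h.name_isLeast (p + 1) (by omega) (by omega)
        rw [hn] at hi
        obtain ⟨⟨hb1, hb2, hb3⟩, hb4⟩ := hpn
        have := hi.1.1
        refine ⟨⟨⟨by omega, hb2, hb3⟩, ?_⟩, ?_⟩
        · simp only [Set.mem_singleton_iff]; omega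
        · rintro q ⟨⟨hq1, hq2, hq3⟩, hq4⟩
          simp only [Set.mem_singleton_iff] at hq4
          have := hi.2 ⟨hq1, hq2, hq3⟩
          exact hb4 ⟨by omega, hq2, hq3⟩
      · exact ⟨⟨hi.1, hn⟩, fun q hq => hi.2 hq.1⟩
    · have hset : {q | i ≤ q ∧ q < T.card ∧ (σ.place T k p v).e q < nthSmallest T (q + 1)}
          = {q | i ≤ q ∧ q < T.card ∧ σ.e q < nthSmallest T (q + 1)} := by
        ext q
        simp only [Set.mem_ofPred_eq, place_e]
        rcases eq_or_ne q p with rfl | hq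
        · have h5 : v < nthSmallest T (q + 1) := lt_of_le_of_ne hp4 hv
          simp [Function.update_self, h5, hp3.trans h5]
        · simp [Function.update_of_ne hq]
      rw [hset, place_of_ne hv]
      exact h.name_isLeast i h1 h2
  · by_cases hv : v = nthSmallest T (p + 1)
    · rw [dead_place_of_eq hp hv, Finset.card_insert_of_notMem (notMem_dead hp), ← h.unions_eq,
        place_of_eq hv]
      rfl
    · rw [dead_place_of_ne hp hv, ← h.unions_eq, place_of_ne hv]
      rfl

end Valid

end AlgState

/-! ## Greedy schedules -/

/-- The points covered by the pieces of job `k`. -/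
def coveredBy {n : ℕ} (L : List (Piece n)) (k : Fin n) : Set ℝ :=
  {x | ∃ p ∈ L, p.job = k ∧ x ∈ Ico p.start p.finish}

/-- The time for which job `k` is run before time `x`. -/
def runTime {n : ℕ} (L : List (Piece n)) (k : Fin n) (x : ℝ) : ℝ :=
  volume.real (Ico 0 x ∩ coveredBy L k)

/-- The point `x` belongs to some piece. -/
def Covered {n : ℕ} (L : List (Piece n)) (x : ℝ) : Prop :=
  ∃ p ∈ L, x ∈ Ico p.start p.finish

section RunTime

variable {n : ℕ} {L : List (Piece n)} {k : Fin n} {x : ℝ}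

lemma coveredBy_cons (p : Piece n) :
    coveredBy (p :: L) k = (if p.job = k then Ico p.start p.finish else ∅) ∪ coveredBy L k := by
  ext x
  simp only [coveredBy, List.mem_cons, Set.mem_union, Set.mem_ofPred_eq]
  split_ifs with h
  · constructor
    · rintro ⟨q, rfl | hq, h1, h2⟩
      · exact Or.inl h2
      · exact Or.inr ⟨q, hq, h1, h2⟩
    · rintro (h2 | ⟨q, hq, h1, h2⟩)
      · exact ⟨p, Or.inl rfl, h, h2⟩
      · exact ⟨q, Or.inr hq, h1, h2⟩
  · constructor
    · rintro ⟨q, rfl | hq, h1, h2⟩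
      · exact absurd h1 h
      · exact Or.inr ⟨q, hq, h1, h2⟩
    · rintro (h2 | ⟨q, hq, h1, h2⟩)
      · exact absurd h2 (Set.notMem_empty _)
      · exact ⟨q, Or.inr hq, h1, h2⟩

lemma measurableSet_coveredBy : MeasurableSet (coveredBy L k) := by
  induction L with
  | nil => simp [coveredBy]
  | cons p L ih =>
    rw [coveredBy_cons]
    split_ifs
    · exact measurableSet_Ico.union ih
    · exact MeasurableSet.empty.union ih

lemma coveredBy_append_singleton (q : Piece n) :
    coveredBy (L ++ [q]) k = coveredBy L k ∪ (if q.job = k then Ico q.start q.finish else ∅) := by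
  ext x
  simp only [coveredBy, List.mem_append, List.mem_singleton, Set.mem_union, Set.mem_ofPred_eq]
  split_ifs with h
  · constructor
    · rintro ⟨p, hp | rfl, h1, h2⟩
      · exact Or.inl ⟨p, hp, h1, h2⟩
      · exact Or.inr h2
    · rintro (⟨p, hp, h1, h2⟩ | h2)
      · exact ⟨p, Or.inl hp, h1, h2⟩
      · exact ⟨q, Or.inr rfl, h, h2⟩
  · constructor
    · rintro ⟨p, hp | rfl, h1, h2⟩
      · exact Or.inl ⟨p, hp, h1, h2⟩
      · exact absurd h1 h
    · rintro (⟨p, hp, h1, h2⟩ | h2)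
      · exact ⟨p, Or.inl hp, h1, h2⟩
      · exact absurd h2 (Set.notMem_empty _)

lemma runTime_mono_append (L' : List (Piece n)) : runTime L k x ≤ runTime (L ++ L') k x := by
  apply measureReal_mono
  · rintro y ⟨h1, p, hp, h2⟩
    exact ⟨h1, p, List.mem_append_left _ hp, h2⟩
  · exact ((measure_mono Set.inter_subset_left).trans_lt measure_Ico_lt_top).ne

lemma runTime_append_of_ne {q : Piece n} (hq : q.job ≠ k) :
    runTime (L ++ [q]) k x = runTime L k x := by
  unfold runTime
  rw [coveredBy_append_singleton, if_neg hq, Set.union_empty]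

lemma runTime_append_of_le {q : Piece n} (hx : x ≤ q.start) :
    runTime (L ++ [q]) k x = runTime L k x := by
  unfold runTime
  congr 1
  rw [coveredBy_append_singleton]
  split_ifs
  · ext y
    simp only [Set.mem_inter_iff, Set.mem_union, Set.mem_Ico]
    constructor
    · rintro ⟨h1, h2 | h2⟩
      · exact ⟨h1, h2⟩
      · linarith [h1.2, h2.1]
    · rintro ⟨h1, h2⟩
      exact ⟨h1, Or.inl h2⟩
  · rw [Set.union_empty]

/-- Adding a piece after all the other pieces of its job. -/
lemma runTime_append {q : Piece n} (h0 : 0 ≤ q.start) (hk : q.job = k) (hx : q.start ≤ x)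
    (hsf : q.start ≤ q.finish)
    (hL : ∀ p ∈ L, p.job = k → p.finish ≤ q.start) :
    runTime (L ++ [q]) k x = runTime L k q.start + (min x q.finish - q.start) := by
  unfold runTime
  have : Ico 0 x ∩ coveredBy (L ++ [q]) k =
      (Ico 0 q.start ∩ coveredBy L k) ∪ Ico q.start (min x q.finish) := by
    rw [coveredBy_append_singleton, if_pos hk]
    ext y
    simp only [Set.mem_inter_iff, Set.mem_union, Set.mem_Ico, lt_min_iff]
    constructor
    · rintro ⟨⟨h1, h2⟩, ⟨p, hp, h3, h4⟩ | ⟨h3, h4⟩⟩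
      · exact Or.inl ⟨⟨h1, h4.2.trans_le (hL p hp h3)⟩, ⟨p, hp, h3, h4⟩⟩
      · exact Or.inr ⟨h3, h2, h4⟩
    · rintro (⟨⟨h1, h2⟩, h3⟩ | ⟨h1, h2, h3⟩)
      · exact ⟨⟨h1, h2.trans_le hx⟩, Or.inl h3⟩
      · exact ⟨⟨h0.trans h1, h2⟩, Or.inr ⟨h1, h3⟩⟩
  rw [this, measureReal_union ?_ measurableSet_Ico
    ((measure_mono Set.inter_subset_left).trans_lt measure_Ico_lt_top).ne measure_Ico_lt_top.ne]
  · rw [Real.volume_real_Ico_of_le (le_min hx hsf)]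
  · rw [Set.disjoint_left]
    rintro y ⟨⟨_, h1⟩, _⟩ ⟨h2, _⟩
    linarith

end RunTime

/-! ## The algorithm yields an `s`-schedule -/

lemma covered_append_singleton {n : ℕ} {L : List (Piece n)} {q : Piece n} {x : ℝ} :
    Covered (L ++ [q]) x ↔ Covered L x ∨ x ∈ Ico q.start q.finish := by
  simp only [Covered, List.mem_append, List.mem_singleton]
  constructor
  · rintro ⟨p, hp | rfl, h⟩
    · exact Or.inl ⟨p, hp, h⟩
    · exact Or.inr h
  · rintro (⟨p, hp, h⟩ | h)
    · exact ⟨p, Or.inl hp, h⟩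
    · exact ⟨q, Or.inr rfl, h⟩

/-- The pieces fill the space left by the canonical intervals, lie between the arrival times and
the deadlines of their jobs, and a job that is running is unfinished. -/
structure Greedy {n : ℕ} (J : JobSet n) (s : ℝ) (T : Finset ℝ) (σ : AlgState n) : Prop where
  valid : σ.Valid T
  bounds : ∀ p ∈ σ.pieces, 0 ≤ p.start ∧ p.start < p.finish ∧ p.finish ≤ 1
  pairwise : σ.pieces.Pairwise
    (fun p q => Disjoint (Ico p.start p.finish) (Ico q.start q.finish))
  covered_iff : ∀ x, Covered σ.pieces x ↔
    ∃ q, (1 ≤ q ∧ q < T.card) ∧ nthSmallest T q ≤ x ∧ x < σ.e q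
  window : ∀ p ∈ σ.pieces, J.a p.job ≤ p.start ∧ p.finish ≤ J.b p.job
  running : ∀ p ∈ σ.pieces, ∀ x ∈ Ico p.start p.finish,
    s * runTime σ.pieces p.job x < J.R p.job
  length_le : σ.pieces.length ≤ σ.finds

/-- The situation while job `k` is being placed, with remaining workload `r`. -/
structure Placing {n : ℕ} (J : JobSet n) (s : ℝ) (T : Finset ℝ) (k : Fin n) (r : ℝ)
    (σ : AlgState n) : Prop extends Greedy J s T σ where
  run_eq : ∀ x, J.a k ≤ x → ¬ Covered σ.pieces x → s * runTime σ.pieces k x = J.R k - r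
  finish_le : ∀ x, J.a k ≤ x → ¬ Covered σ.pieces x →
    ∀ p ∈ σ.pieces, p.job = k → p.finish ≤ x

section

variable {n : ℕ} {J : JobSet n} {s ε : ℝ} {k : Fin n} {r : ℝ} {σ : AlgState n}

lemma Greedy.init :
    Greedy J s (timePoints J ε) (AlgState.init n (timePoints J ε)) where
  valid := AlgState.Valid.init
  bounds p hp := absurd hp List.not_mem_nil
  pairwise := List.Pairwise.nil
  covered_iff x := by
    constructor
    · rintro ⟨p, hp, _⟩
      exact absurd hp List.not_mem_nil
    · rintro ⟨q, _, h1, h2⟩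
      exact absurd h1 (not_le.2 h2)
  window p hp := absurd hp List.not_mem_nil
  running p hp := absurd hp List.not_mem_nil
  length_le := le_rfl

/-- A free point that is not before the arrival time of the job is not before the canonical
interval found by the search. -/
lemma Greedy.le_of_not_covered (h : Greedy J s (timePoints J ε) σ) (hε : 0 < ε) {p : ℕ}
    (hp : IsLeast {q | rankIn (timePoints J ε) (J.a k) ≤ q ∧ q < (timePoints J ε).card ∧
      σ.e q < nthSmallest (timePoints J ε) (q + 1)} p) {x : ℝ} (hx : J.a k ≤ x)
    (hc : ¬ Covered σ.pieces x) : σ.e p ≤ x := by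
  set T := timePoints J ε with hT
  have hm := two_le_card_timePoints J hε
  have hi1 := one_le_rankIn (arrival_mem_timePoints J ε k)
  have hi2 := rankIn_arrival_lt J hε k
  have hia := nthSmallest_rankIn (arrival_mem_timePoints J ε k)
  rw [← hT] at *
  rw [← hia] at hx
  obtain ⟨⟨hp1, hp2, hp3⟩, hp4⟩ := hp
  set i := rankIn T (J.a k)
  by_cases hxm : nthSmallest T T.card ≤ x
  · exact ((h.valid.e_le p (by omega) hp2).trans
      (nthSmallest_le (by omega) (by omega) le_rfl)).trans hxm
  push Not at hxm
  -- With `q` the first index from `i` on such that `x < t_q`, the point lies in slot `q - 1`. Being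
  -- free, it is at or after `e_{q-1}`, so `q - 1` is live and `p ≤ q - 1` by minimality.
  have hex : ∃ q, x < nthSmallest T q ∧ i ≤ q ∧ q ≤ T.card := ⟨T.card, hxm, hi2.le, le_rfl⟩
  classical
  obtain ⟨hq1, hq2, hq3⟩ := Nat.find_spec hex
  have hmin := fun j => @Nat.find_min _ _ hex j
  set q := Nat.find hex
  have hq0 : i ≠ q := by
    intro hiq
    rw [← hiq] at hq1
    linarith
  have hle : nthSmallest T (q - 1) ≤ x := by
    by_contra! hlt
    exact hmin (q - 1) (by omega) ⟨hlt, by omega, by omega⟩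
  have heq : σ.e (q - 1) ≤ x := by
    by_contra! hlt
    exact hc ((h.covered_iff x).2 ⟨q - 1, ⟨by omega, by omega⟩, hle, hlt⟩)
  have hpq : p ≤ q - 1 := by
    apply hp4
    refine ⟨by omega, by omega, ?_⟩
    rw [Nat.sub_add_cancel (by omega)]
    linarith
  rcases hpq.eq_or_lt with h1 | h1
  · rwa [← h1] at heq
  · exact (h.valid.e_le p (by omega) hp2).trans
      ((nthSmallest_le (by omega) (by omega) (by omega)).trans hle)

/-- Slots do not overlap, so only `[t_p, e_p)` could cover a point of slot `p`. -/
lemma Greedy.not_covered (h : Greedy J s (timePoints J ε) σ) {p : ℕ}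
    (hp1 : 1 ≤ p) (hp2 : p < (timePoints J ε).card) {x : ℝ} (h1 : σ.e p ≤ x)
    (h2 : x < nthSmallest (timePoints J ε) (p + 1)) :
    ¬ Covered σ.pieces x := by
  rw [h.covered_iff]
  rintro ⟨q, ⟨hq1, hq2⟩, h3, h4⟩
  rcases lt_trichotomy q p with hqp | rfl | hqp
  · have := h.valid.e_le q hq1 hq2
    have := nthSmallest_le (T := timePoints J ε) (i := q + 1) (j := p) (by omega) (by omega)
      hp2.le
    have := h.valid.le_e p hp1 hp2
    linarith
  · linarith
  · have := nthSmallest_le (T := timePoints J ε) (i := p + 1) (j := q) (by omega) (by omega)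
      hq2.le
    linarith

/-- Since `e_p` is free, `finish_le` puts all older pieces of job `k` to its left. Hence the new
piece leaves `runTime` unchanged at the points of older pieces, and at a point `x` of the new piece
the work done is `R - r + s (x - e_p)`, which is below `R` because `s (v - e_p) ≤ r`. By
`Greedy.le_of_not_covered`, every point of the window still free is at or after `v`. -/
lemma Placing.place (h : Placing J s (timePoints J ε) k r σ) (hs : 0 < s) (hε : 0 < ε) {p : ℕ}
    (hp : σ.Search (timePoints J ε) (rankIn (timePoints J ε) (J.a k)) p) {v : ℝ}
    (hev : σ.e p < v) (hvb : v ≤ J.b k) (hvt : v ≤ nthSmallest (timePoints J ε) (p + 1))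
    (hvr : s * (v - σ.e p) ≤ r) :
    Placing J s (timePoints J ε) k (r - s * (v - σ.e p)) (σ.place (timePoints J ε) k p v) := by
  set T := timePoints J ε with hT
  have hm := two_le_card_timePoints J hε
  have hi1 := one_le_rankIn (arrival_mem_timePoints J ε k)
  have hi2 := rankIn_arrival_lt J hε k
  have hia := nthSmallest_rankIn (arrival_mem_timePoints J ε k)
  have hlast := nthSmallest_timePoints_one J hε
  rw [← hT] at *
  have hP := h.valid.placeable hi1 hi2 hp hev hvt
    (by rw [hlast]; exact hvb.trans (J.b_le_one k))
  have hp' := hp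
  rw [h.valid.search_iff hi1 hi2] at hp
  have hp1 := hP.one_le
  have hp2 := hP.lt_last
  have hae : J.a k ≤ σ.e p := by
    rw [← hia]
    exact (nthSmallest_le hi1 hp.1.1 hp.1.2.1.le).trans (h.valid.le_e p hp1 hp.1.2.1)
  have hfree : ∀ x, σ.e p ≤ x → x < v → ¬ Covered σ.pieces x := fun x h1 h2 =>
    h.toGreedy.not_covered hp1 hp.1.2.1 h1 (h2.trans_le hvt)
  have hfe := hfree (σ.e p) le_rfl hev
  have hbefore := h.finish_le (σ.e p) hae hfe
  have hrun := h.run_eq (σ.e p) hae hfe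
  have he0 : 0 ≤ σ.e p := (J.zero_le_a k).trans hae
  have hcov : ∀ x, Covered (σ.place T k p v).pieces x ↔
      Covered σ.pieces x ∨ x ∈ Ico (σ.e p) v := by
    intro x
    rw [AlgState.place_pieces, covered_append_singleton]
  have hnew : ∀ x, J.a k ≤ x → ¬ Covered (σ.place T k p v).pieces x →
      ¬ Covered σ.pieces x ∧ v ≤ x := by
    intro x hx hc
    rw [hcov] at hc
    push Not at hc
    refine ⟨hc.1, ?_⟩
    by_contra! hlt
    exact hc.2 ⟨h.toGreedy.le_of_not_covered hε hp hx hc.1, hlt⟩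
  have happ : ∀ x, σ.e p ≤ x → runTime (σ.place T k p v).pieces k x =
      runTime σ.pieces k (σ.e p) + (min x v - σ.e p) := by
    intro x hx
    rw [AlgState.place_pieces]
    exact runTime_append (q := ⟨k, σ.e p, v⟩) he0 rfl hx hev.le hbefore
  refine ⟨⟨h.valid.place hP k, ?_, ?_, ?_, ?_, ?_, ?_⟩, ?_, ?_⟩
  · intro q hq
    rw [AlgState.place_pieces, List.mem_append, List.mem_singleton] at hq
    rcases hq with hq | rfl
    · exact h.bounds q hq
    · exact ⟨he0, hev, hvb.trans (J.b_le_one k)⟩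
  · rw [AlgState.place_pieces, List.pairwise_append]
    refine ⟨h.pairwise, List.pairwise_singleton _ _, ?_⟩
    intro q hq q' hq'
    rw [List.mem_singleton] at hq'
    subst hq'
    rw [Set.disjoint_left]
    rintro x hx ⟨hx1, hx2⟩
    exact hfree x hx1 hx2 ⟨q, hq, hx⟩
  · intro x
    rw [hcov, h.covered_iff, AlgState.place_e]
    constructor
    · rintro (⟨q, hq, h1, h2⟩ | ⟨h1, h2⟩)
      · refine ⟨q, hq, h1, ?_⟩
        rcases eq_or_ne q p with rfl | hqp
        · rw [Function.update_self]; linarith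
        · rwa [Function.update_of_ne hqp]
      · refine ⟨p, ⟨hp1, hp.1.2.1⟩, ?_, ?_⟩
        · exact (h.valid.le_e p hp1 hp.1.2.1).trans h1
        · rwa [Function.update_self]
    · rintro ⟨q, hq, h1, h2⟩
      rcases eq_or_ne q p with rfl | hqp
      · rw [Function.update_self] at h2
        rcases lt_or_ge x (σ.e q) with hlt | hge
        · exact Or.inl ⟨q, hq, h1, hlt⟩
        · exact Or.inr ⟨hge, h2⟩
      · rw [Function.update_of_ne hqp] at h2
        exact Or.inl ⟨q, hq, h1, h2⟩
  · intro q hq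
    rw [AlgState.place_pieces, List.mem_append, List.mem_singleton] at hq
    rcases hq with hq | rfl
    · exact h.window q hq
    · exact ⟨hae, hvb⟩
  · intro q hq x hx
    rw [AlgState.place_pieces, List.mem_append, List.mem_singleton] at hq
    rcases hq with hq | rfl
    · have hold := h.running q hq x hx
      rw [AlgState.place_pieces]
      rcases eq_or_ne q.job k with hqk | hqk
      · rwa [runTime_append_of_le]
        exact hx.2.le.trans (hbefore q hq hqk)
      · rwa [runTime_append_of_ne hqk.symm]
    · simp only at hx ⊢
      rw [happ x hx.1, min_eq_left hx.2.le, mul_add, hrun]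
      have : s * (x - σ.e p) < s * (v - σ.e p) := by
        apply mul_lt_mul_of_pos_left _ hs
        linarith [hx.2]
      linarith
  -- Each piece has a find of its own, so the bound on finds also bounds the length of the output.
  · rw [AlgState.place_pieces, List.length_append, List.length_singleton]
    have := h.length_le
    unfold AlgState.place
    split_ifs
    · show _ ≤ σ.finds + 1 + 1
      omega
    · show _ ≤ σ.finds + 1
      omega
  · intro x hx hc
    obtain ⟨hc1, hc2⟩ := hnew x hx hc
    rw [happ x (hev.le.trans hc2), min_eq_right hc2, mul_add, hrun]
    ring
  · intro x hx hc q hq hqk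
    obtain ⟨hc1, hc2⟩ := hnew x hx hc
    rw [AlgState.place_pieces, List.mem_append, List.mem_singleton] at hq
    rcases hq with hq | rfl
    · exact h.finish_le x hx hc1 q hq hqk
    · exact hc2

lemma Greedy.countFind {T : Finset ℝ} (h : Greedy J s T σ) : Greedy J s T σ.countFind :=
  ⟨h.valid.countFind, h.bounds, h.pairwise, h.covered_iff, h.window, h.running,
    h.length_le.trans (Nat.le_succ _)⟩

/-- What holds after job `k` has been placed, `σ` being the state before. -/
structure Placed (J : JobSet n) (s : ℝ) (T : Finset ℝ) (k : Fin n) (σ σ' : AlgState n) : Prop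
    extends Greedy J s T σ' where
  append : ∃ L, σ'.pieces = σ.pieces ++ L ∧ ∀ p ∈ L, p.job = k
  served : ∀ x, J.a k ≤ x → x < J.b k → ¬ Covered σ'.pieces x →
    J.R k ≤ s * runTime σ'.pieces k x
  finds_le : σ'.finds + 2 * σ.unions ≤ σ.finds + 2 * σ'.unions + 1

/-- The quantity `finds - 2 * unions`, written without subtraction, is unchanged by a round with a
union and grows by one otherwise. The latter can happen only in the last round of a job. -/
lemma AlgState.place_counts {T : Finset ℝ} {p : ℕ} {v : ℝ} :
    ((σ.place T k p v).finds + 2 * σ.unions = σ.finds + 2 * (σ.place T k p v).unions ∧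
      (σ.place T k p v).unions = σ.unions + 1) ∨
    ((σ.place T k p v).finds = σ.finds + 1 ∧ (σ.place T k p v).unions = σ.unions) := by
  unfold AlgState.place
  split_ifs
  · left
    constructor
    · show σ.finds + 1 + 1 + 2 * σ.unions = σ.finds + 2 * (σ.unions + 1)
      ring
    · rfl
  · exact Or.inr ⟨rfl, rfl⟩

/-- The last round of a job: if the piece reaches the deadline, no free point of the window is left
by `finish_le`; otherwise the remaining workload is used up, and `run_eq` shows that the job is
finished at each free point. -/
lemma Placing.placed_place (hs : 0 < s) (hε : 0 < ε)
    (h : Placing J s (timePoints J ε) k r σ) {p : ℕ}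
    (hp : σ.Search (timePoints J ε) (rankIn (timePoints J ε) (J.a k)) p) {v : ℝ}
    (hev : σ.e p < v) (hvb : v ≤ J.b k) (hvt : v ≤ nthSmallest (timePoints J ε) (p + 1))
    (hvr : s * (v - σ.e p) ≤ r) (hend : v = J.b k ∨ r ≤ s * (v - σ.e p)) :
    Placed J s (timePoints J ε) k σ (σ.place (timePoints J ε) k p v) := by
  have h' := h.place hs hε hp hev hvb hvt hvr
  refine ⟨h'.toGreedy, ⟨[⟨k, σ.e p, v⟩], AlgState.place_pieces, by simp⟩, ?_, ?_⟩
  · intro x hx hxb hc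
    rw [h'.run_eq x hx hc]
    rcases hend with hend | hend
    · exfalso
      have := h'.finish_le x hx hc ⟨k, σ.e p, v⟩
        (by rw [AlgState.place_pieces]; simp) rfl
      simp only at this
      linarith
    · linarith
  · have := AlgState.place_counts (T := timePoints J ε) (σ := σ) (k := k) (p := p) (v := v)
    omega

/-- The placement of a job terminates, each search succeeding. -/
lemma Placing.exists_placeJob (hs : 0 < s) (hε : 0 < ε) :
    ∀ (N : ℕ) (σ : AlgState n) (r : ℝ), (timePoints J ε).card ≤ σ.unions + N →
      Placing J s (timePoints J ε) k r σ →
      ∃ σ', PlaceJob J s (timePoints J ε) k (rankIn (timePoints J ε) (J.a k)) σ r σ' ∧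
        Placed J s (timePoints J ε) k σ σ' := by
  have hm := two_le_card_timePoints J hε
  have hi1 := one_le_rankIn (arrival_mem_timePoints J ε k)
  have hi2 := rankIn_arrival_lt J hε k
  -- Induction on a bound for the unions still possible: a round after which the loop continues
  -- makes one, and `unions_le` forbids reaching `m`.
  intro N
  induction N with
  | zero =>
    intro σ r hN h
    have := h.valid.unions_le hm
    omega
  | succ N ih =>
    intro σ r hN h
    rcases le_or_gt r 0 with hr | hr
    · refine ⟨σ, PlaceJob.done σ r hr, h.toGreedy, ⟨[], by simp⟩, ?_, by omega⟩
      intro x hx _ hc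
      rw [h.run_eq x hx hc]
      linarith
    have hp := h.valid.search_name hi1 hi2
    set p := σ.name (rankIn (timePoints J ε) (J.a k))
    have hp' := (h.valid.search_iff hi1 hi2).1 hp
    rcases le_or_gt (J.b k) (σ.e p) with hb | hb
    · refine ⟨_, PlaceJob.late σ r p hr hp hb, h.toGreedy.countFind, ⟨[], ?_, by simp⟩, ?_, ?_⟩
      · simp [AlgState.countFind]
      · intro x hx hxb hc
        have := h.toGreedy.le_of_not_covered hε hp' hx hc
        linarith
      · show σ.finds + 1 + 2 * σ.unions ≤ σ.finds + 2 * σ.unions + 1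
        omega
    have heu : σ.e p < min (J.b k) (nthSmallest (timePoints J ε) (p + 1)) :=
      lt_min hb hp'.1.2.2
    obtain ⟨u, hu⟩ : ∃ u, u = min (J.b k) (nthSmallest (timePoints J ε) (p + 1)) := ⟨_, rfl⟩
    rw [← hu] at heu
    have hub : u ≤ J.b k := hu ▸ min_le_left _ _
    have hut : u ≤ nthSmallest (timePoints J ε) (p + 1) := hu ▸ min_le_right _ _
    rcases lt_or_ge (s * (u - σ.e p)) r with hur | hur
    · rcases hub.eq_or_lt with hub' | hub'
      · exact ⟨_, PlaceJob.cut σ r p u hr hp hb hu hur hub',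
          h.placed_place hs hε hp heu hub hut hur.le (Or.inl hub')⟩
      · have h' := h.place hs hε hp heu hub hut hur.le
        -- The run stops before the deadline, so it was stopped by the end of the canonical
        -- interval, which is now empty.
        have hueq : u = nthSmallest (timePoints J ε) (p + 1) := by
          rw [hu]
          apply min_eq_right
          by_contra! hc
          rw [min_eq_left hc.le] at hu
          exact hub'.ne hu
        have hcnt : (σ.place (timePoints J ε) k p u).unions = σ.unions + 1 := by
          rw [AlgState.place_of_eq hueq]; rfl
        have hfnd : (σ.place (timePoints J ε) k p u).finds = σ.finds + 2 := by
          rw [AlgState.place_of_eq hueq]; rfl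
        obtain ⟨σ', hrun, hpl⟩ := ih _ _ (by omega) h'
        refine ⟨σ', PlaceJob.fill σ σ' r p u hr hp hb hu hur hub' hrun, hpl.toGreedy, ?_,
          hpl.served, ?_⟩
        · obtain ⟨L, hL, hLk⟩ := hpl.append
          refine ⟨⟨k, σ.e p, u⟩ :: L, ?_, ?_⟩
          · rw [hL, AlgState.place_pieces]; simp
          · intro q hq
            rcases List.mem_cons.1 hq with rfl | hq
            · rfl
            · exact hLk q hq
        · have := hpl.finds_le
          omega
    · have hv : s * (σ.e p + r / s - σ.e p) = r := by
        field_simp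
        ring
      have hle : σ.e p + r / s ≤ u := by
        have : r / s ≤ u - σ.e p := by
          rw [div_le_iff₀ hs]; linarith
        linarith
      have hlt : σ.e p < σ.e p + r / s := by
        have := div_pos hr hs
        linarith
      exact ⟨_, PlaceJob.finish σ r p u hr hp hb hu hur,
        h.placed_place hs hε hp hlt (hle.trans hub) (hle.trans hut) hv.le (Or.inr hv.ge)⟩

/-- What holds when the jobs of the list `done` have been placed. -/
structure PlacedAll (J : JobSet n) (s : ℝ) (T : Finset ℝ) (done : List (Fin n))
    (σ : AlgState n) : Prop extends Greedy J s T σ where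
  job_mem : ∀ p ∈ σ.pieces, p.job ∈ done
  served : ∀ l ∈ done, ∀ x, J.a l ≤ x → x < J.b l →
    J.R l ≤ s * runTime σ.pieces l x ∨
      ∃ p ∈ σ.pieces, x ∈ Ico p.start p.finish ∧ J.b p.job ≤ J.b l
  finds_le : σ.finds ≤ 2 * σ.unions + done.length

lemma coveredBy_eq_empty {L : List (Piece n)} (h : ∀ p ∈ L, p.job ≠ k) : coveredBy L k = ∅ := by
  rw [Set.eq_empty_iff_forall_notMem]
  rintro x ⟨p, hp, h1, _⟩
  exact h p hp h1

/-- Pieces are only ever added, so run times do not decrease and an occupied point keeps its job;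
`served` therefore persists for the jobs done. For the new job, a free point of the window is
settled by `Placed.served`, and an occupied point belongs to this job or to an earlier one, whose
deadline is no later. -/
lemma PlacedAll.exists_placeJobs (hs : 0 < s) (hε : 0 < ε) :
    ∀ (ks done : List (Fin n)) (σ : AlgState n), (done ++ ks).Nodup →
      (done ++ ks).Pairwise (fun k l => J.b k ≤ J.b l) →
      PlacedAll J s (timePoints J ε) done σ →
      ∃ σ', PlaceJobs J s (timePoints J ε) ks σ σ' ∧
        PlacedAll J s (timePoints J ε) (done ++ ks) σ' := by
  intro ks
  induction ks with
  | nil =>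
    intro done σ _ _ h
    exact ⟨σ, PlaceJobs.nil σ, by simpa using h⟩
  | cons k ks ih =>
    intro done σ hnd hord h
    have hk : k ∉ done := by
      rw [List.nodup_append] at hnd
      exact fun hk => hnd.2.2 k hk k (List.mem_cons_self) rfl
    have hno : ∀ p ∈ σ.pieces, p.job ≠ k := fun p hp hpk => hk (hpk ▸ h.job_mem p hp)
    have hstart : Placing J s (timePoints J ε) k (J.R k) σ := by
      refine ⟨h.toGreedy, ?_, ?_⟩
      · intro x _ _
        simp [runTime, coveredBy_eq_empty hno]
      · intro x _ _ p hp hpk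
        exact absurd hpk (hno p hp)
    obtain ⟨σ₁, hrun, hpl⟩ := hstart.exists_placeJob hs hε _ σ _ (Nat.le_add_left _ _)
    obtain ⟨L, hL, hLk⟩ := hpl.append
    have hbk : ∀ l ∈ done, J.b l ≤ J.b k := by
      rw [List.pairwise_append] at hord
      exact fun l hl => hord.2.2 l hl k List.mem_cons_self
    have hmem : ∀ p ∈ σ₁.pieces, p.job ∈ done ∨ p.job = k := by
      intro p hp
      rw [hL, List.mem_append] at hp
      exact hp.imp (h.job_mem p) (hLk p)
    have h₁ : PlacedAll J s (timePoints J ε) (done ++ [k]) σ₁ := by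
      refine ⟨hpl.toGreedy, ?_, ?_, ?_⟩
      · intro p hp
        rw [List.mem_append, List.mem_singleton]
        exact hmem p hp
      · intro l hl x hx1 hx2
        rw [List.mem_append, List.mem_singleton] at hl
        rcases hl with hl | rfl
        · rcases h.served l hl x hx1 hx2 with h1 | ⟨p, hp, h1⟩
          · left
            refine h1.trans (mul_le_mul_of_nonneg_left ?_ hs.le)
            rw [hL]
            exact runTime_mono_append L
          · right
            exact ⟨p, hL ▸ List.mem_append_left _ hp, h1⟩
        · by_cases hc : Covered σ₁.pieces x
          · obtain ⟨p, hp, hxp⟩ := hc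
            refine Or.inr ⟨p, hp, hxp, ?_⟩
            rcases hmem p hp with h1 | h1
            · exact hbk _ h1
            · rw [h1]
          · exact Or.inl (hpl.served x hx1 hx2 hc)
      · have h1 := h.finds_le
        have h2 := hpl.finds_le
        rw [List.length_append, List.length_singleton]
        omega
    obtain ⟨σ₂, hrun₂, h₂⟩ := ih (done ++ [k]) σ₁ (by simpa using hnd) (by simpa using hord) h₁
    exact ⟨σ₂, PlaceJobs.cons k ks σ σ₁ σ₂ hrun hrun₂, by simpa using h₂⟩

end

/-! ## From lists of pieces to schedules -/

section Schedules

variable {n : ℕ}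

open Classical in
/-- The job function described by a list of pieces. -/
def jobAt (L : List (Piece n)) (t : ℝ) : Option (Fin n) :=
  (L.find? (fun p => decide (t ∈ Ico p.start p.finish))).map Piece.job

lemma jobAt_congr {L : List (Piece n)} {t u : ℝ}
    (h : ∀ p ∈ L, (t ∈ Ico p.start p.finish ↔ u ∈ Ico p.start p.finish)) :
    jobAt L t = jobAt L u := by
  unfold jobAt
  rw [List.find?_congr]
  intro p hp
  simp only [decide_eq_decide]
  exact h p hp

lemma eventually_mem_Ico_iff {x y t : ℝ} (h1 : t ≠ x) (h2 : t ≠ y) :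
    ∀ᶠ u in 𝓝 t, (u ∈ Ico x y ↔ t ∈ Ico x y) := by
  have hx : ∀ᶠ u in 𝓝 t, (x ≤ u ↔ x ≤ t) := by
    rcases lt_or_gt_of_ne h1 with h | h
    · filter_upwards [Iio_mem_nhds h] with u hu
      simp [not_le.2 h, not_le.2 (Set.mem_Iio.1 hu)]
    · filter_upwards [Ioi_mem_nhds h] with u hu
      simp [h.le, (Set.mem_Ioi.1 hu).le]
  have hy : ∀ᶠ u in 𝓝 t, (u < y ↔ t < y) := by
    rcases lt_or_gt_of_ne h2 with h | h
    · filter_upwards [Iio_mem_nhds h] with u hu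
      simp [h, Set.mem_Iio.1 hu]
    · filter_upwards [Ioi_mem_nhds h] with u hu
      simp [not_lt.2 h.le, not_lt.2 (Set.mem_Ioi.1 hu).le]
  filter_upwards [hx, hy] with u hu1 hu2
  rw [Set.mem_Ico, Set.mem_Ico, hu1, hu2]

lemma eventually_jobAt_eq (L : List (Piece n)) {t : ℝ}
    (h : ∀ p ∈ L, t ≠ p.start ∧ t ≠ p.finish) : ∀ᶠ u in 𝓝 t, jobAt L u = jobAt L t := by
  have : ∀ᶠ u in 𝓝 t, ∀ p ∈ L, (u ∈ Ico p.start p.finish ↔ t ∈ Ico p.start p.finish) := by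
    have := (Filter.eventually_all_finite (l := 𝓝 t) (List.finite_toSet L)
      (p := fun p u => u ∈ Ico p.start p.finish ↔ t ∈ Ico p.start p.finish)).2
      (fun p hp => eventually_mem_Ico_iff (h p hp).1 (h p hp).2)
    exact this
  filter_upwards [this] with u hu
  exact jobAt_congr hu

/-- The schedule with speed `s` described by a list of pieces. -/
def scheduleOf (s : ℝ) (L : List (Piece n)) : Schedule n where
  job := jobAt L
  speed t := if (jobAt L t).isSome then s else 0
  piecewise := by
    classical
    refine ⟨(L.map Piece.start ++ L.map Piece.finish).toFinset, fun t ht => ?_⟩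
    have hev := eventually_jobAt_eq L (t := t) (by
      intro p hp
      simp only [List.toFinset_append, Finset.mem_union, List.mem_toFinset, List.mem_map,
        not_or, not_exists, not_and] at ht
      exact ⟨fun h => ht.1 p hp h.symm, fun h => ht.2 p hp h.symm⟩)
    refine ⟨?_, hev⟩
    apply (continuousAt_const (y := if (jobAt L t).isSome then s else 0)).congr
    filter_upwards [hev] with u hu
    rw [hu]

/-- Disjointness makes the first piece found at `t` the only one there. -/
lemma jobAt_eq_some_iff {L : List (Piece n)}
    (hL : L.Pairwise (fun p q => Disjoint (Ico p.start p.finish) (Ico q.start q.finish)))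
    {t : ℝ} {k : Fin n} :
    jobAt L t = some k ↔ ∃ p ∈ L, p.job = k ∧ t ∈ Ico p.start p.finish := by
  induction L with
  | nil => simp [jobAt]
  | cons q L ih =>
    rw [List.pairwise_cons] at hL
    by_cases ht : t ∈ Ico q.start q.finish
    · have h1 : jobAt (q :: L) t = some q.job := by
        unfold jobAt
        rw [List.find?_cons_of_pos (by simpa using ht)]
        rfl
      rw [h1]
      constructor
      · intro h
        exact ⟨q, List.mem_cons_self, Option.some.inj h, ht⟩
      · rintro ⟨p, hp, hk, htp⟩
        rcases List.mem_cons.1 hp with rfl | hp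
        · rw [hk]
        · exact absurd htp (Set.disjoint_left.1 (hL.1 p hp) ht)
    · have h1 : jobAt (q :: L) t = jobAt L t := by
        unfold jobAt
        rw [List.find?_cons_of_neg (by simpa using ht)]
      rw [h1, ih hL.2]
      constructor
      · rintro ⟨p, hp, h⟩
        exact ⟨p, List.mem_cons_of_mem _ hp, h⟩
      · rintro ⟨p, hp, hk, htp⟩
        rcases List.mem_cons.1 hp with rfl | hp
        · exact absurd htp ht
        · exact ⟨p, hp, hk, htp⟩

lemma work_scheduleOf {s : ℝ} {L : List (Piece n)}
    (hL : L.Pairwise (fun p q => Disjoint (Ico p.start p.finish) (Ico q.start q.finish)))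
    (k : Fin n) (t : ℝ) : (scheduleOf s L).work k t = s * runTime L k t := by
  have hset : {τ | (scheduleOf s L).job τ = some k} = coveredBy L k := by
    ext τ
    exact jobAt_eq_some_iff hL
  unfold Schedule.work
  rw [hset, setIntegral_congr_fun (g := fun _ => s)
    (measurableSet_Ico.inter measurableSet_coveredBy), setIntegral_const, runTime, smul_eq_mul,
    mul_comm]
  rintro τ ⟨_, hτ⟩
  have : jobAt L τ = some k := (jobAt_eq_some_iff hL).2 hτ
  simp [scheduleOf, this]

/-- A waiting job is unfinished, so `served` leaves only the alternative that `t` lies in a piece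
with a deadline no later. By disjointness this is the running job, and at an idle time there is no
such piece. -/
lemma PlacedAll.exists_schedule {J : JobSet n} {s : ℝ} {T : Finset ℝ} {done : List (Fin n)}
    {σ : AlgState n} (h : PlacedAll J s T done σ) (hdone : ∀ k, k ∈ done) :
    ∃ S : Schedule n, IsSSchedule J s S ∧ Represents σ.pieces S := by
  refine ⟨scheduleOf s σ.pieces, ⟨?_, ?_⟩, h.bounds, h.pairwise, fun t k =>
    jobAt_eq_some_iff h.pairwise⟩
  · intro t k hk
    obtain ⟨p, hp, rfl, htp⟩ := (jobAt_eq_some_iff h.pairwise).1 hk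
    refine ⟨?_, ⟨?_, ?_, ?_⟩, ?_⟩
    · change jobAt σ.pieces t = _ at hk
      simp [scheduleOf, hk]
    · exact (h.window p hp).1.trans htp.1
    · exact htp.2.trans_le (h.window p hp).2
    · rw [work_scheduleOf h.pairwise]
      exact h.running p hp t htp
    · rintro l ⟨h1, h2, h3⟩
      rw [work_scheduleOf h.pairwise] at h3
      rcases h.served l (hdone l) t h1 h2 with h4 | ⟨q, hq, h4, h5⟩
      · linarith
      · have hq' := (jobAt_eq_some_iff h.pairwise).2 ⟨q, hq, rfl, h4⟩
        have hk' : jobAt σ.pieces t = some p.job := hk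
        rw [hk', Option.some.injEq] at hq'
        rwa [hq']
  · intro t ht
    change jobAt σ.pieces t = _ at ht
    refine ⟨by simp [scheduleOf, ht], ?_⟩
    rintro l ⟨h1, h2, h3⟩
    rw [work_scheduleOf h.pairwise] at h3
    rcases h.served l (hdone l) t h1 h2 with h4 | ⟨q, hq, h4, _⟩
    · linarith
    · have hq' := (jobAt_eq_some_iff h.pairwise).2 ⟨q, hq, rfl, h4⟩
      rw [hq'] at ht
      exact absurd ht (by simp)

end Schedules

/-- The algorithm terminates, computes an `s`-schedule, and performs few unions and finds. -/
lemma exists_algRun {n : ℕ} (J : JobSet n) {s ε : ℝ} (π : Equiv.Perm (Fin n)) (hs : 0 < s)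
    (hε : 0 < ε) (hπ : IsDeadlineOrder J π) :
    ∃ σ : AlgState n, AlgRun J s ε π σ ∧
      (∃ S : Schedule n, IsSSchedule J s S ∧ Represents σ.pieces S) ∧
      σ.unions ≤ (timePoints J ε).card - 2 ∧
      σ.finds ≤ 2 * ((timePoints J ε).card - 2) + n ∧ σ.pieces.length ≤ σ.finds := by
  have hnd : (List.ofFn π).Nodup := List.nodup_ofFn.2 π.injective
  have hord : (List.ofFn π).Pairwise (fun k l => J.b k ≤ J.b l) := by
    rw [List.pairwise_ofFn]
    exact fun i j hij => hπ hij.le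
  have h0 : PlacedAll J s (timePoints J ε) [] (AlgState.init n (timePoints J ε)) :=
    ⟨Greedy.init, fun p hp => absurd hp List.not_mem_nil,
      fun l hl => absurd hl List.not_mem_nil, Nat.zero_le _⟩
  obtain ⟨σ, hrun, h⟩ := h0.exists_placeJobs hs hε (List.ofFn π) [] _ (by simpa using hnd)
    (by simpa using hord)
  rw [List.nil_append] at h
  refine ⟨σ, hrun, h.exists_schedule ?_, ?_, ?_, h.length_le⟩
  · intro k
    rw [List.mem_ofFn]
    exact ⟨π.symm k, π.apply_symm_apply k⟩
  · exact h.valid.unions_le (two_le_card_timePoints J hε)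
  · have h1 := h.valid.unions_le (two_le_card_timePoints J hε)
    have h2 := h.finds_le
    rw [List.length_ofFn] at h2
    omega

/-! ## Quick-find on intervals -/

/-- The numbers `0, …, M` are partitioned into intervals, `lab x` being the label of the interval
of `x`, and `lo` and `hi` giving the end points of the interval with a given label. The last
element of an interval is the only one for which `E` fails. -/
structure QuickFind (M : ℕ) (E : ℕ → Prop) (lab lo hi : ℕ → ℕ) : Prop where
  lo_le : ∀ x ≤ M, lo (lab x) ≤ x
  le_hi : ∀ x ≤ M, x ≤ hi (lab x)
  hi_le : ∀ x ≤ M, hi (lab x) ≤ M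
  hi_alive : ∀ x ≤ M, ¬ E (hi (lab x))
  dead : ∀ x ≤ M, ∀ y, lo (lab x) ≤ y → y < hi (lab x) → E y
  lab_eq : ∀ x ≤ M, ∀ y, lo (lab x) ≤ y → y ≤ hi (lab x) → lab y = lab x

/-- The sum of the logarithms of the sizes of the intervals, over all elements. -/
def quickFindPotential (M : ℕ) (lab lo hi : ℕ → ℕ) : ℕ :=
  ∑ x ∈ Finset.range (M + 1), Nat.log 2 (hi (lab x) + 1 - lo (lab x))

namespace QuickFind

variable {M : ℕ} {E E' : ℕ → Prop} {lab lo hi lab' lo' hi' : ℕ → ℕ} {j : ℕ}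

/-- A union raises the potential by at least the size of the smaller interval, so this bounds the
cost of all relabellings together. -/
lemma potential_le (h : QuickFind M E lab lo hi) :
    quickFindPotential M lab lo hi ≤ (M + 1) * Nat.log 2 (M + 1) := by
  unfold quickFindPotential
  calc _ ≤ ∑ _x ∈ Finset.range (M + 1), Nat.log 2 (M + 1) := by
        apply Finset.sum_le_sum
        intro x hx
        have := h.hi_le x (by simp at hx; omega)
        exact Nat.log_mono_right (by omega)
    _ = _ := by simp

lemma congr (h : QuickFind M E lab lo hi) (hE : ∀ x ≤ M, E x ↔ E' x) :
    QuickFind M E' lab lo hi where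
  lo_le := h.lo_le
  le_hi := h.le_hi
  hi_le := h.hi_le
  hi_alive x hx := by
    rw [← hE _ (h.hi_le x hx)]
    exact h.hi_alive x hx
  dead x hx y h1 h2 := by
    have := h.hi_le x hx
    rw [← hE _ (by omega)]
    exact h.dead x hx y h1 h2
  lab_eq := h.lab_eq

/-- Elements before the right end satisfy `E`, so one that fails `E` must be the right end. -/
lemma hi_lab (h : QuickFind M E lab lo hi) (hj : j ≤ M) (hE : ¬ E j) : hi (lab j) = j := by
  by_contra hne
  have := h.le_hi j hj
  exact hE (h.dead j hj j (h.lo_le j hj) (by omega))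

lemma lo_lab_succ (h : QuickFind M E lab lo hi) (hj : j < M) (hE : ¬ E j) :
    lo (lab (j + 1)) = j + 1 := by
  by_contra hne
  have h1 := h.lo_le (j + 1) hj
  have h2 := h.le_hi (j + 1) hj
  have h3 := h.lab_eq (j + 1) hj j (by omega) (by omega)
  rw [← h3, h.hi_lab hj.le hE] at h2
  omega

lemma lab_eq_iff (h : QuickFind M E lab lo hi) {x y : ℕ} (hx : x ≤ M) (hy : y ≤ M) :
    lab y = lab x ↔ lo (lab x) ≤ y ∧ y ≤ hi (lab x) := by
  constructor
  · intro heq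
    rw [← heq]
    exact ⟨h.lo_le y hy, h.le_hi y hy⟩
  · rintro ⟨h1, h2⟩
    exact h.lab_eq x hx y h1 h2

/-- The effect of uniting the intervals of `j` and `j + 1`, irrespective of the label that the new
interval gets. -/
lemma union (h : QuickFind M E lab lo hi) (hj : j < M) (hE : ¬ E j) (c : ℕ)
    (hin : ∀ x, lo (lab j) ≤ x → x ≤ hi (lab (j + 1)) → lab' x = c)
    (hlo : lo' c = lo (lab j)) (hhi : hi' c = hi (lab (j + 1)))
    (hout : ∀ x ≤ M, ¬ (lo (lab j) ≤ x ∧ x ≤ hi (lab (j + 1))) →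
      lab' x = lab x ∧ lo' (lab x) = lo (lab x) ∧ hi' (lab x) = hi (lab x)) :
    QuickFind M (fun x => E x ∨ x = j) lab' lo' hi' ∧
      quickFindPotential M lab lo hi + min (j + 1 - lo (lab j)) (hi (lab (j + 1)) - j) ≤
        quickFindPotential M lab' lo' hi' := by
  have hhj := h.hi_lab hj.le hE
  have hlj := h.lo_lab_succ hj hE
  have hl1 := h.lo_le j hj.le
  have hh2 := h.le_hi (j + 1) hj
  have hh3 := h.hi_le (j + 1) hj
  -- Intervals other than the two being united lie entirely to one side of them; an overlap would
  -- force a common label.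
  have hsep : ∀ x ≤ M, ¬ (lo (lab j) ≤ x ∧ x ≤ hi (lab (j + 1))) →
      hi (lab x) < lo (lab j) ∨ hi (lab (j + 1)) < lo (lab x) := by
    intro x hx hn
    by_contra! hc
    have h1 := h.lo_le x hx
    have h2 := h.le_hi x hx
    rcases Nat.lt_or_ge (hi (lab (j + 1))) x with h3 | h3
    · have h4 := h.lab_eq x hx (hi (lab (j + 1))) (by omega) (by omega)
      have h5 := h.lab_eq (j + 1) hj (hi (lab (j + 1))) (by omega) le_rfl
      rw [← h4, h5] at h2
      omega
    · have h4 := h.lab_eq x hx (lo (lab j)) (by omega) (by omega)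
      have h5 := h.lab_eq j hj.le (lo (lab j)) le_rfl (by omega)
      rw [← h4, h5] at h1
      omega
  refine ⟨⟨?_, ?_, ?_, ?_, ?_, ?_⟩, ?_⟩
  · intro x hx
    by_cases hc : lo (lab j) ≤ x ∧ x ≤ hi (lab (j + 1))
    · rw [hin x hc.1 hc.2, hlo]; exact hc.1
    · obtain ⟨h1, h2, h3⟩ := hout x hx hc
      rw [h1, h2]; exact h.lo_le x hx
  · intro x hx
    by_cases hc : lo (lab j) ≤ x ∧ x ≤ hi (lab (j + 1))
    · rw [hin x hc.1 hc.2, hhi]; exact hc.2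
    · obtain ⟨h1, h2, h3⟩ := hout x hx hc
      rw [h1, h3]; exact h.le_hi x hx
  · intro x hx
    by_cases hc : lo (lab j) ≤ x ∧ x ≤ hi (lab (j + 1))
    · rw [hin x hc.1 hc.2, hhi]; exact hh3
    · obtain ⟨h1, h2, h3⟩ := hout x hx hc
      rw [h1, h3]; exact h.hi_le x hx
  · intro x hx
    by_cases hc : lo (lab j) ≤ x ∧ x ≤ hi (lab (j + 1))
    · rw [hin x hc.1 hc.2, hhi]
      have := h.hi_alive (j + 1) hj
      rintro (h1 | h1)
      · exact this h1
      · omega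
    · obtain ⟨h1, h2, h3⟩ := hout x hx hc
      rw [h1, h3]
      have := h.hi_alive x hx
      have := hsep x hx hc
      have := h.lo_le x hx
      have := h.le_hi x hx
      rintro (h1 | h1)
      · contradiction
      · omega
  · intro x hx y
    by_cases hc : lo (lab j) ≤ x ∧ x ≤ hi (lab (j + 1))
    · rw [hin x hc.1 hc.2, hlo, hhi]
      intro h1 h2
      rcases lt_trichotomy y j with h3 | h3 | h3
      · exact Or.inl (h.dead j hj.le y h1 (by omega))
      · exact Or.inr h3
      · exact Or.inl (h.dead (j + 1) hj y (by omega) h2)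
    · obtain ⟨h1, h2, h3⟩ := hout x hx hc
      rw [h1, h2, h3]
      exact fun h4 h5 => Or.inl (h.dead x hx y h4 h5)
  · intro x hx y
    by_cases hc : lo (lab j) ≤ x ∧ x ≤ hi (lab (j + 1))
    · rw [hin x hc.1 hc.2, hlo, hhi]
      exact fun h1 h2 => hin y h1 h2
    · obtain ⟨h1, h2, h3⟩ := hout x hx hc
      rw [h1, h2, h3]
      intro h4 h5
      have := hsep x hx hc
      have := h.hi_le x hx
      rw [(hout y (by omega) (by omega)).1]
      exact h.lab_eq x hx y h4 h5
  -- With `I` the smaller interval: its elements see their interval at least double, which adds one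
  -- to each logarithm, and no other element sees its interval shrink.
  · have key : ∀ (I : Finset ℕ), I ⊆ Finset.range (M + 1) →
        (∀ x ∈ I, Nat.log 2 (hi (lab x) + 1 - lo (lab x)) + 1 ≤
          Nat.log 2 (hi' (lab' x) + 1 - lo' (lab' x))) →
        quickFindPotential M lab lo hi + I.card ≤ quickFindPotential M lab' lo' hi' := by
      intro I hI hstep
      have hcard : I.card = ∑ x ∈ Finset.range (M + 1), if x ∈ I then 1 else 0 := by
        rw [Finset.sum_ite_mem, Finset.inter_eq_right.2 hI]
        simp
      rw [hcard]
      unfold quickFindPotential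
      rw [← Finset.sum_add_distrib]
      apply Finset.sum_le_sum
      intro x hx
      split_ifs with hxI
      · exact hstep x hxI
      · rw [add_zero]
        apply Nat.log_mono_right
        have hxM : x ≤ M := by simp at hx; omega
        by_cases hc : lo (lab j) ≤ x ∧ x ≤ hi (lab (j + 1))
        · rw [hin x hc.1 hc.2, hlo, hhi]
          rcases Nat.lt_or_ge j x with h1 | h1
          · rw [h.lab_eq (j + 1) hj x (by omega) hc.2]
            omega
          · rw [h.lab_eq j hj.le x hc.1 (by omega)]
            omega
        · obtain ⟨h1, h2, h3⟩ := hout x hxM hc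
          rw [h1, h2, h3]
    have hlog : ∀ a b : ℕ, 1 ≤ a → a ≤ b → Nat.log 2 a + 1 ≤ Nat.log 2 (a + b) := by
      intro a b ha hab
      rw [← Nat.log_mul_base (by norm_num) (by omega)]
      exact Nat.log_mono_right (by omega)
    rcases le_total (j + 1 - lo (lab j)) (hi (lab (j + 1)) - j) with hmin | hmin
    · rw [min_eq_left hmin]
      have := key (Finset.Icc (lo (lab j)) j) (by
        intro x hx
        simp only [Finset.mem_Icc, Finset.mem_range] at hx ⊢
        omega) (by
        intro x hx
        rw [Finset.mem_Icc] at hx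
        rw [hin x hx.1 (by omega), hlo, hhi, h.lab_eq j hj.le x hx.1 (by omega), hhj]
        refine (hlog _ (hi (lab (j + 1)) - j) (by omega) hmin).trans (le_of_eq ?_)
        congr 1
        omega)
      rwa [Nat.card_Icc] at this
    · rw [min_eq_right hmin]
      have := key (Finset.Icc (j + 1) (hi (lab (j + 1)))) (by
        intro x hx
        simp only [Finset.mem_Icc, Finset.mem_range] at hx ⊢
        omega) (by
        intro x hx
        rw [Finset.mem_Icc] at hx
        rw [hin x (by omega) hx.2, hlo, hhi, h.lab_eq (j + 1) hj x (by omega) hx.2, hlj]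
        refine (hlog _ (j + 1 - lo (lab j)) (by omega) (by omega)).trans (le_of_eq ?_)
        congr 1
        omega)
      rw [Nat.card_Icc] at this
      omega

/-- Uniting the intervals of `j` and `j + 1` by relabelling the former. -/
lemma union_left (h : QuickFind M E lab lo hi) (hj : j < M) (hE : ¬ E j)
    (hsize : j + 1 - lo (lab j) ≤ hi (lab (j + 1)) - j) :
    QuickFind M (fun x => E x ∨ x = j)
      (fun y => if lo (lab j) ≤ y ∧ y ≤ j then lab (j + 1) else lab y)
      (Function.update lo (lab (j + 1)) (lo (lab j))) hi ∧
    quickFindPotential M lab lo hi + (j + 1 - lo (lab j)) ≤ quickFindPotential M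
      (fun y => if lo (lab j) ≤ y ∧ y ≤ j then lab (j + 1) else lab y)
      (Function.update lo (lab (j + 1)) (lo (lab j))) hi := by
  have hlj := h.lo_lab_succ hj hE
  have hh2 := h.le_hi (j + 1) hj
  have := h.union (lab' := fun y => if lo (lab j) ≤ y ∧ y ≤ j then lab (j + 1) else lab y)
    (lo' := Function.update lo (lab (j + 1)) (lo (lab j))) (hi' := hi) hj hE (lab (j + 1)) ?_
    (Function.update_self _ _ _) rfl ?_
  · rwa [min_eq_left hsize] at this
  · intro x h1 h2
    split_ifs with h3
    · rfl
    · exact h.lab_eq (j + 1) hj x (by omega) h2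
  · intro x hx hn
    have hne : lab x ≠ lab (j + 1) := by
      rw [Ne, h.lab_eq_iff (x := j + 1) hj hx]
      have := h.lo_le j hj.le
      omega
    refine ⟨?_, Function.update_of_ne hne _ _, rfl⟩
    rw [if_neg]
    omega

/-- Uniting the intervals of `j` and `j + 1` by relabelling the latter. -/
lemma union_right (h : QuickFind M E lab lo hi) (hj : j < M) (hE : ¬ E j)
    (hsize : hi (lab (j + 1)) - j ≤ j + 1 - lo (lab j)) :
    QuickFind M (fun x => E x ∨ x = j)
      (fun y => if j + 1 ≤ y ∧ y ≤ hi (lab (j + 1)) then lab j else lab y)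
      lo (Function.update hi (lab j) (hi (lab (j + 1)))) ∧
    quickFindPotential M lab lo hi + (hi (lab (j + 1)) - j) ≤ quickFindPotential M
      (fun y => if j + 1 ≤ y ∧ y ≤ hi (lab (j + 1)) then lab j else lab y)
      lo (Function.update hi (lab j) (hi (lab (j + 1)))) := by
  have hhj := h.hi_lab hj.le hE
  have hh2 := h.le_hi (j + 1) hj
  have := h.union (lab' := fun y => if j + 1 ≤ y ∧ y ≤ hi (lab (j + 1)) then lab j else lab y)
    (lo' := lo) (hi' := Function.update hi (lab j) (hi (lab (j + 1)))) hj hE (lab j) ?_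
    rfl (Function.update_self _ _ _) ?_
  · rwa [min_eq_right hsize] at this
  · intro x h1 h2
    split_ifs with h3
    · rfl
    · exact h.lab_eq j hj.le x h1 (by omega)
  · intro x hx hn
    have hne : lab x ≠ lab j := by
      rw [Ne, h.lab_eq_iff (x := j) hj.le hx]
      omega
    refine ⟨?_, rfl, Function.update_of_ne hne _ _⟩
    have := h.lo_le j hj.le
    rw [if_neg]
    omega

lemma singletons (M : ℕ) (hlab : ∀ x ≤ M, lab x = x) (hlo : ∀ x ≤ M, lo x = x)
    (hhi : ∀ x ≤ M, hi x = x) (hE : ∀ x ≤ M, ¬ E x) : QuickFind M E lab lo hi where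
  lo_le x hx := by rw [hlab x hx, hlo x hx]
  le_hi x hx := by rw [hlab x hx, hhi x hx]
  hi_le x hx := by rwa [hlab x hx, hhi x hx]
  hi_alive x hx := by rw [hlab x hx, hhi x hx]; exact hE x hx
  dead x hx y h1 h2 := by
    rw [hlab x hx, hlo x hx] at h1
    rw [hlab x hx, hhi x hx] at h2
    omega
  lab_eq x hx y h1 h2 := by
    rw [hlab x hx, hlo x hx] at h1
    rw [hlab x hx, hhi x hx] at h2
    rw [show y = x by omega]

end QuickFind

/-! ## Reasoning about RAM programs -/

namespace RAM

/-- The program halts, and the number of steps and the final state satisfy `Q`. -/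
def Runs (w : ℕ) (P : Prog) (σ : State) (Q : ℕ → State → Prop) : Prop :=
  ∃ τ σ', Exec w P σ τ σ' ∧ Q τ σ'

/-- A straight-line program. -/
def block : List Instr → Prog
  | [] => .instr (.copy 0 0)
  | i :: l => .seq (.instr i) (block l)

/-- The effect of a straight-line program. -/
def evalBlock (w : ℕ) : List Instr → State → State
  | [], σ => σ
  | i :: l, σ => evalBlock w l (i.eval w σ)

variable {w : ℕ} {P Q : Prog} {σ : State} {R S : ℕ → State → Prop} {c : Test}

lemma Runs.mono (h : Runs w P σ R) (hRS : ∀ τ σ', R τ σ' → S τ σ') : Runs w P σ S := by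
  obtain ⟨τ, σ', h1, h2⟩ := h
  exact ⟨τ, σ', h1, hRS _ _ h2⟩

/-- The extra step is the instruction `copy 0 0` that ends each block and changes nothing. -/
lemma exec_block (l : List Instr) (σ : State) :
    Exec w (block l) σ (l.length + 1) (evalBlock w l σ) := by
  induction l generalizing σ with
  | nil =>
    have h := Exec.instr (w := w) (.copy 0 0) σ
    have h2 : (Instr.copy 0 0).eval w σ = σ := by simp [Instr.eval]
    rw [h2] at h
    exact h
  | cons i l ih =>
    have h := Exec.seq (w := w) (.instr i) (block l) σ _ _ 1 _ (Exec.instr i σ) (ih _)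
    rw [List.length_cons, Nat.add_comm l.length 1, Nat.add_assoc]
    exact h

lemma runs_block {l : List Instr} (h : R (l.length + 1) (evalBlock w l σ)) :
    Runs w (block l) σ R := ⟨_, _, exec_block l σ, h⟩

/-- The remaining program becomes the postcondition of `P`, so that proofs follow the execution. -/
lemma runs_seq (h : Runs w P σ (fun τ σ' => Runs w Q σ' (fun τ' => R (τ + τ')))) :
    Runs w (.seq P Q) σ R := by
  obtain ⟨τ, σ', h1, τ', σ'', h2, h3⟩ := h
  exact ⟨_, _, Exec.seq P Q σ σ' σ'' τ τ' h1 h2, h3⟩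

lemma runs_block_seq {l : List Instr}
    (h : Runs w Q (evalBlock w l σ) (fun τ' => R (l.length + 1 + τ'))) :
    Runs w (.seq (block l) Q) σ R := runs_seq (runs_block h)

lemma runs_ite (h1 : c.Holds σ → Runs w P σ (fun τ => R (τ + 1)))
    (h2 : ¬ c.Holds σ → Runs w Q σ (fun τ => R (τ + 1))) : Runs w (.ite c P Q) σ R := by
  by_cases hc : c.Holds σ
  · obtain ⟨τ, σ', h3, h4⟩ := h1 hc
    exact ⟨_, _, Exec.ite_true c P Q σ σ' τ hc h3, h4⟩
  · obtain ⟨τ, σ', h3, h4⟩ := h2 hc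
    exact ⟨_, _, Exec.ite_false c P Q σ σ' τ hc h3, h4⟩

lemma runs_loop_true (hc : c.Holds σ)
    (h : Runs w P σ (fun τ σ' => Runs w (.loop c P) σ' (fun τ' => R (τ + τ' + 1)))) :
    Runs w (.loop c P) σ R := by
  obtain ⟨τ, σ', h1, τ', σ'', h2, h3⟩ := h
  exact ⟨_, _, Exec.loop_true c P σ σ' σ'' τ τ' hc h1 h2, h3⟩

lemma runs_loop_false (hc : ¬ c.Holds σ) (h : R 1 σ) : Runs w (.loop c P) σ R :=
  ⟨_, _, Exec.loop_false c P σ hc, h⟩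

/-- A loop with a known number of rounds. The invariant may refer to the time spent so far. -/
lemma runs_loop (N : ℕ) (I : ℕ → ℕ → State → Prop)
    (hstep : ∀ i < N, ∀ t σ, I i t σ →
      c.Holds σ ∧ Runs w P σ (fun τ σ' => I (i + 1) (t + τ + 1) σ'))
    (hend : ∀ t σ, I N t σ → ¬ c.Holds σ) (h0 : I 0 0 σ)
    (hR : ∀ t σ', I N t σ' → R (t + 1) σ') : Runs w (.loop c P) σ R := by
  -- Here `d` is the number of rounds left and `t` the time spent before the current round.
  have key : ∀ d i, i + d = N → ∀ t σ, I i t σ →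
      Runs w (.loop c P) σ (fun τ σ' => ∃ t', t + τ = t' + 1 ∧ I N t' σ') := by
    intro d
    induction d with
    | zero =>
      intro i hi t σ h
      obtain rfl : i = N := by omega
      exact runs_loop_false (hend t σ h) ⟨t, rfl, h⟩
    | succ d ih =>
      intro i hi t σ h
      obtain ⟨hc, hrun⟩ := hstep i (by omega) t σ h
      refine runs_loop_true hc (hrun.mono ?_)
      intro τ σ' h'
      refine (ih (i + 1) (by omega) _ σ' h').mono ?_
      rintro τ' σ'' ⟨t', ht', h''⟩
      exact ⟨t', by omega, h''⟩
  refine (key N 0 (by omega) 0 σ h0).mono ?_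
  rintro τ σ' ⟨t', ht', h'⟩
  rw [Nat.zero_add] at ht'
  rw [ht']
  exact hR t' σ' h'

/-- A loop with a known number of rounds, each of which takes at most `K` steps. -/
lemma runs_loop_const (N K : ℕ) (I : ℕ → State → Prop)
    (hstep : ∀ i < N, ∀ σ, I i σ →
      c.Holds σ ∧ Runs w P σ (fun τ σ' => τ ≤ K ∧ I (i + 1) σ'))
    (hend : ∀ σ, I N σ → ¬ c.Holds σ) (h0 : I 0 σ)
    (hR : ∀ τ σ', τ ≤ (K + 1) * N + 1 → I N σ' → R τ σ') : Runs w (.loop c P) σ R := by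
  refine runs_loop N (fun i t σ => t ≤ (K + 1) * i ∧ I i σ) ?_ (fun t σ h => hend σ h.2)
    ⟨Nat.zero_le _, h0⟩ (fun t σ' h => hR _ _ (by omega) h.2)
  rintro i hi t σ ⟨ht, h⟩
  obtain ⟨hc, hrun⟩ := hstep i hi σ h
  refine ⟨hc, hrun.mono ?_⟩
  rintro τ σ' ⟨h1, h2⟩
  refine ⟨?_, h2⟩
  rw [Nat.mul_add, Nat.mul_one]
  omega

/-- Needed to identify the runs obtained for different values of `ε`: the input does not depend on
`ε`, so these are the same run. -/
lemma Exec.deterministic {τ τ' : ℕ} {σ' σ'' : State} (h : Exec w P σ τ σ') :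
    Exec w P σ τ' σ'' → τ = τ' ∧ σ' = σ'' := by
  intro h2
  induction h generalizing τ' σ'' with
  | instr i σ => cases h2; exact ⟨rfl, rfl⟩
  | seq P Q σ σ₁ σ₂ t t' _ _ ih1 ih2 =>
    cases h2 with
    | seq _ _ _ _ _ _ _ hP hQ =>
      obtain ⟨rfl, rfl⟩ := ih1 hP
      obtain ⟨rfl, rfl⟩ := ih2 hQ
      exact ⟨rfl, rfl⟩
  | ite_true c P Q σ σ' t hc _ ih =>
    cases h2 with
    | ite_true _ _ _ _ _ _ _ hP =>
      obtain ⟨rfl, rfl⟩ := ih hP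
      exact ⟨rfl, rfl⟩
    | ite_false _ _ _ _ _ _ hn _ => exact absurd hc hn
  | ite_false c P Q σ σ' t hc _ ih =>
    cases h2 with
    | ite_true _ _ _ _ _ _ hp _ => exact absurd hp hc
    | ite_false _ _ _ _ _ _ _ hP =>
      obtain ⟨rfl, rfl⟩ := ih hP
      exact ⟨rfl, rfl⟩
  | loop_true c P σ σ₁ σ₂ t t' hc _ _ ih1 ih2 =>
    cases h2 with
    | loop_true _ _ _ _ _ _ _ _ hP hL =>
      obtain ⟨rfl, rfl⟩ := ih1 hP
      obtain ⟨rfl, rfl⟩ := ih2 hL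
      exact ⟨rfl, rfl⟩
    | loop_false _ _ _ hn => exact absurd hc hn
  | loop_false c P σ hc =>
    cases h2 with
    | loop_true _ _ _ _ _ _ _ hp _ _ => exact absurd hp hc
    | loop_false _ _ _ _ => exact ⟨rfl, rfl⟩

lemma sub_eval {x y : ℕ} (hyx : y ≤ x) (hx : x < 2 ^ w) : WordOp.sub.eval w x y = x - y := by
  simp only [WordOp.eval]
  rw [Nat.mod_eq_of_lt (by omega : y < 2 ^ w), show x + (2 ^ w - y) = x - y + 2 ^ w by omega,
    Nat.add_mod_right, Nat.mod_eq_of_lt (by omega)]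

lemma add_eval {x y : ℕ} (h : x + y < 2 ^ w) : WordOp.add.eval w x y = x + y :=
  Nat.mod_eq_of_lt h

lemma mul_eval {x y : ℕ} (h : x * y < 2 ^ w) : WordOp.mul.eval w x y = x * y :=
  Nat.mod_eq_of_lt h

lemma div_eval {x y : ℕ} (h : x < 2 ^ w) : WordOp.div.eval w x y = x / y :=
  Nat.mod_eq_of_lt ((Nat.div_le_self x y).trans_lt h)

lemma mod_eval {x y : ℕ} (h : x < 2 ^ w) : WordOp.mod.eval w x y = x % y :=
  Nat.mod_eq_of_lt ((Nat.mod_le x y).trans_lt h)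

lemma shr_eval {x y : ℕ} (h : x < 2 ^ w) : WordOp.shr.eval w x y = x >>> y :=
  Nat.mod_eq_of_lt ((Nat.shiftRight_le x y).trans_lt h)

lemma shl_one_eval {y : ℕ} (h : y < w) : WordOp.shl.eval w 1 y = 2 ^ y := by
  simp only [WordOp.eval]
  rw [Nat.one_shiftLeft]
  exact Nat.mod_eq_of_lt (Nat.pow_lt_pow_right (by norm_num) h)

lemma xor_eval {x y : ℕ} (hx : x < 2 ^ w) (hy : y < 2 ^ w) : WordOp.xor.eval w x y = x ^^^ y :=
  Nat.mod_eq_of_lt (Nat.xor_lt_two_pow hx hy)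

/-! ## A search structure on blocks of bits -/

/-- The words `wd j` mark the elements of `{0, …, N}` that do not belong to `D`, in blocks of `B`
bits. -/
structure BitBlocks (B N : ℕ) (D : Finset ℕ) (wd : ℕ → ℕ) : Prop where
  lt : ∀ j ≤ N / B, wd j < 2 ^ B
  testBit : ∀ j ≤ N / B, ∀ c < B, ((wd j).testBit c = true ↔ j * B + c ∉ D)

/-- `tab x` is the position of the lowest bit of `x`. -/
def LowBitTable (B : ℕ) (tab : ℕ → ℕ) : Prop :=
  ∀ x, x ≠ 0 → x < 2 ^ B → IsLeast {c | x.testBit c = true} (tab x)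

/-- The state contains a search structure for the complement of `D` in `{0, …, N}`. -/
structure SearchStructure (B N : ℕ) (D : Finset ℕ) (σ : State) : Prop where
  reg_two : σ.reg 2 = 1
  reg_three : σ.reg 3 = B
  reg_nine : σ.reg 9 = 0
  bits : BitBlocks B N D (σ.arr 5)
  table : LowBitTable B (σ.arr 6)
  find : QuickFind (N / B) (fun j => σ.arr 5 j = 0) (σ.arr 7) (σ.arr 8) (σ.arr 9)

/-- The potential of the search structure. -/
def searchPotential (B N : ℕ) (σ : State) : ℕ :=
  quickFindPotential (N / B) (σ.arr 7) (σ.arr 8) (σ.arr 9)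

/-- Find the least element of the structure that is at least the contents of register 7. -/
def findProg : Prog :=
  .seq (block [.op .div 10 7 3, .op .mod 11 7 3, .load 12 5 10, .op .shr 12 12 11])
    (.ite (.wne 12 9) (block [.load 13 6 12, .op .add 8 7 13])
      (block [.op .add 10 10 2, .load 12 7 10, .load 10 9 12, .load 12 5 10, .load 13 6 12,
        .op .mul 10 10 3, .op .add 8 10 13]))

lemma BitBlocks.ne_zero_iff {B N : ℕ} {D : Finset ℕ} {wd : ℕ → ℕ} (h : BitBlocks B N D wd)
    {j : ℕ} (hj : j ≤ N / B) : wd j ≠ 0 ↔ ∃ c < B, j * B + c ∉ D := by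
  constructor
  · intro hne
    obtain ⟨c, hc⟩ := Nat.exists_testBit_of_ne_zero hne
    have hcB : c < B := by
      by_contra! hcB
      rw [Nat.testBit_lt_two_pow ((h.lt j hj).trans_le (Nat.pow_le_pow_right (by norm_num) hcB))]
        at hc
      exact absurd hc (by simp)
    exact ⟨c, hcB, (h.testBit j hj c hcB).1 hc⟩
  · rintro ⟨c, hc, hD⟩ h0
    have := (h.testBit j hj c hc).2 hD
    rw [h0] at this
    simp at this

/-- Shifting the word of the block of `i` by `i % B` drops the elements below `i`. If something
remains, its lowest bit is the answer; otherwise the answer is the lowest bit of the next nonempty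
block, which quick-find supplies as the right end of the interval of block `i / B + 1`. -/
lemma runs_findProg {B N i : ℕ} {D : Finset ℕ} {σ : State} (h : SearchStructure B N D σ)
    (hB : 1 ≤ B) (hBw : 2 ^ B < 2 ^ w) (hN : 2 * N + 2 * B < 2 ^ w) (hND : N ∉ D)
    (hi : σ.reg 7 = i) (hiN : i ≤ N) :
    Runs w findProg σ (fun τ σ' => τ ≤ 20 ∧ ∃ f : ℕ → ℕ, σ' = { σ with reg := f } ∧
      IsLeast {q | i ≤ q ∧ q ∉ D} (f 8) ∧ ∀ x < 10, x ≠ 8 → f x = σ.reg x) := by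
  have hBpos : 0 < B := hB
  have hjN : i / B ≤ N / B := Nat.div_le_div_right hiN
  have hmod : i % B < B := Nat.mod_lt _ hBpos
  have hdm := Nat.div_add_mod' i B
  have hwd := h.bits.lt _ hjN
  apply runs_block_seq
  simp only [evalBlock, Instr.eval, Function.update_apply, Nat.reduceEqDiff, ↓reduceIte,
    h.reg_three, hi]
  rw [div_eval (by omega), mod_eval (by omega), shr_eval (by simpa using hwd.trans hBw)]
  apply runs_ite
  · intro hc
    simp only [Test.Holds, Function.update_apply] at hc
    norm_num [h.reg_nine] at hc
    apply runs_block
    refine ⟨by norm_num, _, rfl, ?_, ?_⟩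
    · simp only [Instr.eval, Function.update_apply]
      norm_num
      set x := σ.arr 5 (i / B) >>> (i % B) with hx
      have hxlt : x < 2 ^ B := (Nat.shiftRight_le _ _).trans_lt hwd
      obtain ⟨ht1, ht2⟩ := h.table x hc hxlt
      rw [Set.mem_ofPred_eq, hx, Nat.testBit_shiftRight] at ht1
      have hlt : i % B + σ.arr 6 x < B := by
        by_contra! hge
        rw [Nat.testBit_lt_two_pow (hwd.trans_le (Nat.pow_le_pow_right (by norm_num) hge))]
          at ht1
        exact absurd ht1 (by simp)
      have hnD := (h.bits.testBit _ hjN _ hlt).1 ht1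
      rw [hi, add_eval (by omega)]
      refine ⟨⟨by omega, ?_⟩, ?_⟩
      · rwa [← Nat.add_assoc, hdm] at hnD
      · rintro q ⟨hq1, hq2⟩
        by_contra! hqlt
        have hqc : i % B + (q - i) < B := by omega
        have := (h.bits.testBit _ hjN _ hqc).2 (by
          rwa [← Nat.add_assoc, hdm, Nat.add_sub_cancel' hq1])
        rw [← Nat.testBit_shiftRight, ← hx] at this
        have := ht2 this
        omega
    · intro x hx hx8
      simp only [Instr.eval, Function.update_apply]
      simp [hx8, show x ≠ 10 by omega, show x ≠ 11 by omega, show x ≠ 12 by omega,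
        show x ≠ 13 by omega]
  · intro hc
    simp only [Test.Holds, Function.update_apply] at hc
    norm_num [h.reg_nine] at hc
    have hdead : ∀ c, i % B ≤ c → c < B → i / B * B + c ∈ D := by
      intro c hc1 hc2
      by_contra hnD
      have := (h.bits.testBit _ hjN c hc2).2 hnD
      have h2 : (σ.arr 5 (i / B) >>> (i % B)).testBit (c - i % B) = true := by
        rw [Nat.testBit_shiftRight, Nat.add_sub_cancel' hc1]
        exact this
      rw [hc] at h2
      simp at h2
    -- If `i` were in the last block, the undeleted element `N` would have survived the shift.
    have hjlt : i / B + 1 ≤ N / B := by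
      by_contra! hge
      have heq : i / B = N / B := by omega
      have hNdm := Nat.div_add_mod' N B
      have hNmod : N % B < B := Nat.mod_lt _ hBpos
      apply hND
      rw [← hNdm, ← heq]
      apply hdead _ _ hNmod
      rw [heq] at hdm
      omega
    apply runs_block
    refine ⟨by norm_num, _, rfl, ?_, ?_⟩
    · simp only [Instr.eval, Function.update_apply]
      norm_num
      have hw1 : i / B + 1 < 2 ^ w := by
        have := Nat.div_le_self N B
        omega
      rw [h.reg_two, add_eval hw1]
      set y := σ.arr 9 (σ.arr 7 (i / B + 1)) with hy
      have hyN : y ≤ N / B := h.find.hi_le _ hjlt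
      have hyi : i / B + 1 ≤ y := h.find.le_hi _ hjlt
      have hyE : σ.arr 5 y ≠ 0 := h.find.hi_alive _ hjlt
      have hyd := h.find.dead _ hjlt
      rw [← hy] at hyd
      obtain ⟨ht1, ht2⟩ := h.table _ hyE (h.bits.lt _ hyN)
      rw [Set.mem_ofPred_eq] at ht1
      have hlt : σ.arr 6 (σ.arr 5 y) < B := by
        by_contra! hge
        rw [Nat.testBit_lt_two_pow ((h.bits.lt _ hyN).trans_le
          (Nat.pow_le_pow_right (by norm_num) hge))] at ht1
        exact absurd ht1 (by simp)
      have hyB : y * B ≤ N := (Nat.mul_le_mul_right B hyN).trans (Nat.div_mul_le_self N B)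
      rw [h.reg_three, mul_eval (by omega), add_eval (by omega)]
      have hiy : (i / B + 1) * B ≤ y * B := Nat.mul_le_mul_right B hyi
      rw [Nat.add_mul, Nat.one_mul] at hiy
      refine ⟨⟨by omega, (h.bits.testBit _ hyN _ hlt).1 ht1⟩, ?_⟩
      rintro q ⟨hq1, hq2⟩
      have hqdm := Nat.div_add_mod' q B
      have hqmod : q % B < B := Nat.mod_lt _ hBpos
      have hqi : i / B ≤ q / B := Nat.div_le_div_right hq1
      rcases Nat.lt_or_ge (q / B) y with h1 | h1
      · exfalso
        rcases hqi.eq_or_lt with h2 | h2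
        · apply hq2
          rw [← hqdm, ← h2]
          apply hdead _ _ hqmod
          rw [← h2] at hqdm
          omega
        · have h3 := hyd (q / B) ((h.find.lo_le _ hjlt).trans h2) h1
          have h4 := (h.bits.ne_zero_iff (j := q / B) (by omega)).2
            ⟨q % B, hqmod, by rwa [hqdm]⟩
          exact h4 h3
      · rcases h1.eq_or_lt with h2 | h2
        · rw [← hqdm, ← h2]
          have := (h.bits.testBit y hyN _ hqmod).2 (by rwa [h2, hqdm])
          have := ht2 this
          omega
        · have : (y + 1) * B ≤ q / B * B := Nat.mul_le_mul_right B h2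
          rw [Nat.add_mul, Nat.one_mul] at this
          omega
    · intro x hx hx8
      simp only [Instr.eval, Function.update_apply]
      simp [hx8, show x ≠ 10 by omega, show x ≠ 11 by omega, show x ≠ 12 by omega,
        show x ≠ 13 by omega]

/-! ### Uniting neighbouring blocks and deleting an element -/

/-- Give the label in register `l` to all numbers from the contents of register 18 to the contents
of register `m`. -/
def relabelProg (l m : ℕ) : Prog :=
  .loop (.wle 18 m) (block [.store 7 18 l, .op .add 18 18 2])

/-- A relabelled element costs four steps: the test, two instructions and the no-op that ends the
block. Hence the factor 4 before every potential below. -/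
lemma runs_relabelProg {l m x y : ℕ} {σ : State} (hl : l ≠ 18) (hm : m ≠ 18)
    (h2 : σ.reg 2 = 1) (hx : σ.reg 18 = x) (hy : σ.reg m = y) (hxy : x ≤ y + 1)
    (hyw : y + 1 < 2 ^ w) :
    Runs w (relabelProg l m) σ (fun τ σ' => τ ≤ 4 * (y + 1 - x) + 1 ∧
      σ' = { σ with
        reg := Function.update σ.reg 18 (y + 1)
        arr := Function.update σ.arr 7
          (fun z => if x ≤ z ∧ z ≤ y then σ.reg l else σ.arr 7 z) }) := by
  refine runs_loop_const (y + 1 - x) 3 (fun i σ' =>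
      σ' = { σ with
        reg := Function.update σ.reg 18 (x + i)
        arr := Function.update σ.arr 7
          (fun z => if x ≤ z ∧ z < x + i then σ.reg l else σ.arr 7 z) }) ?_ ?_ ?_ ?_
  · rintro i hi _ rfl
    constructor
    · simp only [Test.Holds, Function.update_self, Function.update_of_ne hm, hy]
      omega
    · apply runs_block
      refine ⟨by norm_num, ?_⟩
      simp only [evalBlock, Instr.eval, Function.update_self, Function.update_of_ne hl,
        Function.update_of_ne (show (2 : ℕ) ≠ 18 by norm_num), h2, Function.update_idem]
      rw [add_eval (by omega)]
      congr 2
      funext z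
      rw [Function.update_apply]
      split_ifs <;> first | rfl | omega
  · rintro _ rfl
    simp only [Test.Holds, Function.update_self, Function.update_of_ne hm, hy]
    omega
  · have h1 : (fun z => if x ≤ z ∧ z < x + 0 then σ.reg l else σ.arr 7 z) = σ.arr 7 := by
      funext z
      rw [if_neg (by omega)]
    rw [h1, Function.update_eq_self, Nat.add_zero, ← hx, Function.update_eq_self]
  · rintro τ _ hτ rfl
    refine ⟨hτ, ?_⟩
    have h1 : x + (y + 1 - x) = y + 1 := by omega
    rw [h1]
    simp only [Nat.lt_succ_iff]

/-- Unite the interval of the block in register 10 with the next one. -/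
def uniteProg : Prog :=
  .seq (block [.op .add 11 10 2, .load 12 7 10, .load 13 7 11, .load 14 8 12, .load 15 9 13,
      .op .sub 16 11 14, .op .sub 17 15 10])
    (.ite (.wle 16 17)
      (.seq (block [.store 8 13 14, .copy 18 14]) (relabelProg 13 10))
      (.seq (block [.store 9 12 15, .copy 18 11]) (relabelProg 12 15)))

/-- Registers 16 and 17 receive the sizes of the two intervals. As the smaller one is relabelled,
the rise of the potential pays for the loop and 15 covers the rest. -/
lemma runs_uniteProg {M j : ℕ} {E : ℕ → Prop} {σ : State} (h2 : σ.reg 2 = 1)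
    (hj : σ.reg 10 = j) (hjM : j < M) (hMw : M + 1 < 2 ^ w)
    (h : QuickFind M E (σ.arr 7) (σ.arr 8) (σ.arr 9)) (hE : ¬ E j) :
    Runs w uniteProg σ (fun τ σ' => ∃ f g, σ' = { σ with reg := f, arr := g } ∧
      (∀ x < 10, f x = σ.reg x) ∧ (∀ A < 7, g A = σ.arr A) ∧
      QuickFind M (fun x => E x ∨ x = j) (g 7) (g 8) (g 9) ∧
      τ + 4 * quickFindPotential M (σ.arr 7) (σ.arr 8) (σ.arr 9) ≤
        4 * quickFindPotential M (g 7) (g 8) (g 9) + 15) := by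
  have hlo := h.lo_le j hjM.le
  have hh2 := h.le_hi (j + 1) hjM
  have hh3 := h.hi_le (j + 1) hjM
  apply runs_block_seq
  simp only [evalBlock, Instr.eval, Function.update_apply, Nat.reduceEqDiff, ↓reduceIte, h2, hj]
  rw [add_eval (by omega), sub_eval (by omega) (by omega), sub_eval (by omega) (by omega)]
  apply runs_ite
  · intro hc
    simp only [Test.Holds, Function.update_apply, Nat.reduceEqDiff, ↓reduceIte] at hc
    obtain ⟨hq, hpot⟩ := h.union_left hjM hE hc
    apply runs_block_seq
    refine (runs_relabelProg (x := σ.arr 8 (σ.arr 7 j)) (y := j) (by norm_num) (by norm_num)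
      ?_ ?_ ?_ (by omega) (by omega)).mono ?_
    · simp [evalBlock, Instr.eval, h2]
    · simp [evalBlock, Instr.eval]
    · simp [evalBlock, Instr.eval, hj]
    · rintro τ _ ⟨hτ, rfl⟩
      refine ⟨_, _, rfl, ?_, ?_, ?_⟩
      · intro x hx
        simp only [evalBlock, Instr.eval, Function.update_apply]
        simp [show x ≠ 11 by omega, show x ≠ 12 by omega,
          show x ≠ 13 by omega, show x ≠ 14 by omega, show x ≠ 15 by omega,
          show x ≠ 16 by omega, show x ≠ 17 by omega, show x ≠ 18 by omega]
      · intro A hA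
        simp [evalBlock, Instr.eval, show A ≠ 7 by omega,
          show A ≠ 8 by omega]
      · simp only [evalBlock, Instr.eval, Function.update_apply, Nat.reduceEqDiff, ↓reduceIte]
        refine ⟨hq, ?_⟩
        simp only [List.length_cons, List.length_nil]
        refine le_trans ?_ (Nat.add_le_add_right (Nat.mul_le_mul_left 4 hpot) 15)
        omega
  · intro hc
    simp only [Test.Holds, Function.update_apply, Nat.reduceEqDiff, ↓reduceIte] at hc
    obtain ⟨hq, hpot⟩ := h.union_right hjM hE (by omega)
    apply runs_block_seq
    refine (runs_relabelProg (x := j + 1) (y := σ.arr 9 (σ.arr 7 (j + 1))) (by norm_num)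
      (by norm_num) ?_ ?_ ?_ (by omega) (by omega)).mono ?_
    · simp [evalBlock, Instr.eval, h2]
    · simp [evalBlock, Instr.eval]
    · simp [evalBlock, Instr.eval]
    · rintro τ _ ⟨hτ, rfl⟩
      refine ⟨_, _, rfl, ?_, ?_, ?_⟩
      · intro x hx
        simp only [evalBlock, Instr.eval, Function.update_apply]
        simp [show x ≠ 11 by omega, show x ≠ 12 by omega,
          show x ≠ 13 by omega, show x ≠ 14 by omega, show x ≠ 15 by omega,
          show x ≠ 16 by omega, show x ≠ 17 by omega, show x ≠ 18 by omega]
      · intro A hA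
        simp [evalBlock, Instr.eval, show A ≠ 7 by omega,
          show A ≠ 9 by omega]
      · simp only [evalBlock, Instr.eval, Function.update_apply, Nat.reduceEqDiff, ↓reduceIte]
        refine ⟨hq, ?_⟩
        simp only [List.length_cons, List.length_nil]
        refine le_trans ?_ (Nat.add_le_add_right (Nat.mul_le_mul_left 4 hpot) 15)
        omega

/-- Delete the element in register 8 from the search structure. -/
def deleteProg : Prog :=
  .seq (block [.op .div 10 8 3, .op .mod 11 8 3, .op .shl 12 2 11, .load 13 5 10,
      .op .xor 13 13 12, .store 5 10 13])
    (.ite (.weq 13 9) uniteProg (block []))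

/-- The bit of `p` is known to be set, so the exclusive or clears it. -/
lemma BitBlocks.insert {B N p : ℕ} {D : Finset ℕ} {wd : ℕ → ℕ} (h : BitBlocks B N D wd)
    (hB : 1 ≤ B) (hpN : p ≤ N) (hpD : p ∉ D) :
    BitBlocks B N (insert p D) (Function.update wd (p / B) (wd (p / B) ^^^ 2 ^ (p % B))) := by
  have hmod : p % B < B := Nat.mod_lt _ hB
  have hdm := Nat.div_add_mod' p B
  have hj : p / B ≤ N / B := Nat.div_le_div_right hpN
  constructor
  · intro j hjN
    rw [Function.update_apply]
    split_ifs with hjp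
    · exact Nat.xor_lt_two_pow (h.lt _ hj) (Nat.pow_lt_pow_right (by norm_num) hmod)
    · exact h.lt j hjN
  · intro j hjN c hc
    rw [Function.update_apply, Finset.mem_insert, not_or]
    split_ifs with hjp
    · subst hjp
      rw [Nat.testBit_xor, Nat.testBit_two_pow]
      have h1 := h.testBit _ hj c hc
      by_cases hcp : p % B = c
      · subst hcp
        have h2 : (wd (p / B)).testBit (p % B) = true := h1.2 (by rwa [hdm])
        simp [h2, hdm]
      · have h3 : p / B * B + c ≠ p := by omega
        simp only [hcp, decide_false, Bool.bne_false, h1]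
        exact ⟨fun h4 => ⟨h3, h4⟩, fun h4 => h4.2⟩
    · rw [h.testBit j hjN c hc]
      have h3 : j * B + c ≠ p := by
        intro h4
        apply hjp
        rw [← h4, Nat.mul_comm, Nat.mul_add_div (by omega), Nat.div_eq_of_lt hc, Nat.add_zero]
      exact ⟨fun h4 => ⟨h3, h4⟩, fun h4 => h4.2⟩

lemma runs_deleteProg {B N p : ℕ} {D : Finset ℕ} {σ : State} (h : SearchStructure B N D σ)
    (hB : 1 ≤ B) (hBw : B < w) (hN : N + 1 < 2 ^ w) (hND : N ∉ D)
    (hp : σ.reg 8 = p) (hpN : p < N) (hpD : p ∉ D) :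
    Runs w deleteProg σ (fun τ σ' => ∃ f g, σ' = { σ with reg := f, arr := g } ∧
      (∀ x < 10, f x = σ.reg x) ∧ (∀ A < 5, g A = σ.arr A) ∧
      SearchStructure B N (insert p D) σ' ∧
      τ + 4 * searchPotential B N σ ≤ 4 * searchPotential B N σ' + 30) := by
  have hmod : p % B < B := Nat.mod_lt _ hB
  have hdm := Nat.div_add_mod' p B
  have hj : p / B ≤ N / B := Nat.div_le_div_right hpN.le
  have hBw' : 2 ^ B < 2 ^ w := Nat.pow_lt_pow_right (by norm_num) hBw
  have hwd := h.bits.lt _ hj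
  have hpow : 2 ^ (p % B) < 2 ^ B := Nat.pow_lt_pow_right (by norm_num) hmod
  have hbits := h.bits.insert hB hpN.le hpD
  have hNdiv := Nat.div_le_self N B
  have halive : σ.arr 5 (p / B) ≠ 0 :=
    (h.bits.ne_zero_iff hj).2 ⟨p % B, hmod, by rwa [hdm]⟩
  apply runs_block_seq
  simp only [evalBlock, Instr.eval, Function.update_apply, Nat.reduceEqDiff, ↓reduceIte,
    h.reg_two, h.reg_three, hp]
  rw [div_eval (by omega), mod_eval (by omega), shl_one_eval (by omega),
    xor_eval (by omega) (by omega)]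
  set y := σ.arr 5 (p / B) ^^^ 2 ^ (p % B) with hy
  apply runs_ite
  · intro hc
    simp only [Test.Holds, Function.update_apply, Nat.reduceEqDiff, ↓reduceIte, h.reg_nine] at hc
    -- The last block keeps the element `N ≠ p`, so a block that has become empty has a right
    -- neighbour to be united with.
    have hjlt : p / B < N / B := by
      by_contra! hge
      have heq : p / B = N / B := by omega
      refine absurd hc ?_
      have h1 := (hbits.ne_zero_iff (j := N / B) le_rfl).2
        ⟨N % B, Nat.mod_lt _ hB, by
          rw [Nat.div_add_mod' N B, Finset.mem_insert]
          push Not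
          exact ⟨by omega, hND⟩⟩
      rwa [← heq, Function.update_self] at h1
    refine (runs_uniteProg (M := N / B) (j := p / B) (E := fun j => σ.arr 5 j = 0)
      ?_ ?_ hjlt (by omega) ?_ halive).mono ?_
    · simp [h.reg_two]
    · simp
    · simpa [Function.update_apply] using h.find
    · rintro τ _ ⟨f, g, rfl, hf, hg, hq, hpot⟩
      refine ⟨f, g, rfl, ?_, ?_, ⟨?_, ?_, ?_, ?_, ?_, ?_⟩, ?_⟩
      · intro x hx
        rw [hf x hx]
        simp [show x ≠ 10 by omega, show x ≠ 11 by omega,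
          show x ≠ 12 by omega, show x ≠ 13 by omega]
      · intro A hA
        rw [hg A (by omega)]
        simp [show A ≠ 5 by omega]
      · simp [hf, h.reg_two]
      · simp [hf, h.reg_three]
      · simp [hf, h.reg_nine]
      · simpa [hg] using hbits
      · simpa [hg] using h.table
      · refine hq.congr fun x hx => ?_
        simp only [hg 5 (by norm_num), Function.update_self]
        rw [Function.update_apply]
        split_ifs with hxp
        · simp [hxp, hc]
        · simp [hxp]
      · simp only [Function.update_apply, Nat.reduceEqDiff, ↓reduceIte] at hpot
        simp only [searchPotential, List.length_cons, List.length_nil]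
        omega
  · intro hc
    simp only [Test.Holds, Function.update_apply, Nat.reduceEqDiff, ↓reduceIte, h.reg_nine] at hc
    apply runs_block
    refine ⟨_, _, rfl, ?_, ?_, ⟨?_, ?_, ?_, ?_, ?_, ?_⟩, ?_⟩
    · intro x hx
      simp [show x ≠ 10 by omega, show x ≠ 11 by omega,
        show x ≠ 12 by omega, show x ≠ 13 by omega]
    · intro A hA
      simp [show A ≠ 5 by omega]
    · simp [evalBlock, h.reg_two]
    · simp [evalBlock, h.reg_three]
    · simp [evalBlock, h.reg_nine]
    · simpa [evalBlock] using hbits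
    · simpa [evalBlock] using h.table
    · simp only [evalBlock, Function.update_apply, Nat.reduceEqDiff, ↓reduceIte]
      refine h.find.congr fun x hx => ?_
      split_ifs with hxp
      · rw [hxp]
        exact iff_of_false halive hc
      · rfl
    · simp [searchPotential, evalBlock]
      omega

/-! ### Simulation of the placement of one job -/

/-- The words are long enough for `N` intervals in blocks of `B`. -/
structure Fits (w B N : ℕ) : Prop where
  one_le : 1 ≤ B
  lt_word : B < w
  bound : 2 * N + 2 * B + 2 < 2 ^ w

/-- The RAM state represents the state `τ` of the algorithm. -/
structure Encodes {n : ℕ} (J : JobSet n) (s : ℝ) (T : Finset ℝ) (B : ℕ) (τ : AlgState n)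
    (σ : State) : Prop where
  search : SearchStructure B (T.card - 1) (τ.dead T) σ
  count : σ.reg 1 = τ.pieces.length
  speed : σ.rreg 0 = s
  zero : σ.rreg 1 = 0
  ranks : ∀ k : Fin n, σ.arr 0 k = rankIn T (J.a k)
  deadlines : ∀ k : Fin n, σ.rarr 1 k = J.b k
  workloads : ∀ k : Fin n, σ.rarr 2 k = J.R k
  -- The last point `1 + ε` is left out. The end `t_{p+1}` is read only after `e_p < b_k` has been
  -- established, and then `p + 1 < m`.
  times : ∀ q, 1 ≤ q → q < T.card → σ.rarr 5 q = nthSmallest T q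
  e_eq : ∀ q, 1 ≤ q → q < T.card → σ.rarr 6 q = τ.e q
  pieces : ∀ (j : ℕ) (hj : j < τ.pieces.length), σ.arr 2 j = ((τ.pieces[j]'hj).job : ℕ) ∧
    σ.rarr 3 j = (τ.pieces[j]'hj).start ∧ σ.rarr 4 j = (τ.pieces[j]'hj).finish

lemma SearchStructure.congr {B N : ℕ} {D : Finset ℕ} {σ σ' : State}
    (h : SearchStructure B N D σ) (hreg : ∀ x, x = 2 ∨ x = 3 ∨ x = 9 → σ'.reg x = σ.reg x)
    (harr : ∀ A, 5 ≤ A → σ'.arr A = σ.arr A) : SearchStructure B N D σ' := by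
  refine ⟨?_, ?_, ?_, ?_, ?_, ?_⟩
  · rw [hreg 2 (by simp), h.reg_two]
  · rw [hreg 3 (by simp), h.reg_three]
  · rw [hreg 9 (by simp), h.reg_nine]
  · rw [harr 5 (by norm_num)]; exact h.bits
  · rw [harr 6 (by norm_num)]; exact h.table
  · rw [harr 5 (by norm_num), harr 7 (by norm_num), harr 8 (by norm_num), harr 9 (by norm_num)]
    exact h.find

section

variable {n : ℕ} {J : JobSet n} {s : ℝ} {T : Finset ℝ} {B : ℕ} {τ τ' : AlgState n}
  {σ σ' : State} {k : Fin n}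

lemma Encodes.congr (h : Encodes J s T B τ σ)
    (hreg : ∀ x, x = 1 ∨ x = 2 ∨ x = 3 ∨ x = 9 → σ'.reg x = σ.reg x) (harr : σ'.arr = σ.arr)
    (hrreg : ∀ x < 2, σ'.rreg x = σ.rreg x) (hrarr : σ'.rarr = σ.rarr) :
    Encodes J s T B τ σ' := by
  refine ⟨h.search.congr (fun x hx => hreg x (Or.inr hx)) (fun A _ => by rw [harr]), ?_, ?_, ?_,
    ?_, ?_, ?_, ?_, ?_, ?_⟩
  · rw [hreg 1 (by simp), h.count]
  · rw [hrreg 0 (by norm_num), h.speed]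
  · rw [hrreg 1 (by norm_num), h.zero]
  · rw [harr]; exact h.ranks
  · rw [hrarr]; exact h.deadlines
  · rw [hrarr]; exact h.workloads
  · rw [hrarr]; exact h.times
  · rw [hrarr]; exact h.e_eq
  · rw [harr, hrarr]; exact h.pieces

lemma Encodes.countFind (h : Encodes J s T B τ σ) : Encodes J s T B τ.countFind σ :=
  ⟨h.search, h.count, h.speed, h.zero, h.ranks, h.deadlines, h.workloads, h.times, h.e_eq,
    h.pieces⟩

/-- The data of the job being placed. -/
structure Loaded (J : JobSet n) (T : Finset ℝ) (k : Fin n) (r : ℝ) (σ : State) : Prop where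
  job : σ.reg 6 = k
  rank : σ.reg 7 = rankIn T (J.a k)
  work : σ.rreg 2 = r
  deadline : σ.rreg 3 = J.b k

/-- The parts of the state that are left alone by the placement of a job. -/
structure Frame (σ σ' : State) : Prop where
  reg : ∀ x, x = 0 ∨ x = 4 ∨ x = 5 → σ'.reg x = σ.reg x
  arr : ∀ A, A = 3 ∨ A = 4 → σ'.arr A = σ.arr A

lemma Frame.trans {σ'' : State} (h : Frame σ σ') (h' : Frame σ' σ'') : Frame σ σ'' :=
  ⟨fun x hx => (h'.reg x hx).trans (h.reg x hx), fun A hA => (h'.arr A hA).trans (h.arr A hA)⟩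

/-- Run the job in register 6 in the interval with the number in register 8, between the times in
the real registers 4 and 6, real register 5 holding the end of the interval. -/
def commitProg : Prog :=
  .seq (block [.rstore 6 8 6, .store 2 1 6, .rstore 3 1 4, .rstore 4 1 6, .op .add 1 1 2])
    (.ite (.rle 5 6) deleteProg (block []))

/-- Since `v ≤ t_{p+1}`, the test `t_{p+1} ≤ v` decides equality, so the RAM deletes `p` exactly
when the algorithm makes a union. -/
lemma runs_commitProg {p : ℕ} {v : ℝ} (hT : 2 ≤ T.card) (hfit : Fits w B (T.card - 1))
    (h : Encodes J s T B τ σ) (hv : τ.Valid T)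
    (hP : AlgState.Valid.Placeable T τ p v) (hlen : τ.pieces.length + 1 < 2 ^ w)
    (h6 : σ.reg 6 = k) (h8 : σ.reg 8 = p) (hr4 : σ.rreg 4 = τ.e p)
    (hr5 : σ.rreg 5 = nthSmallest T (p + 1)) (hr6 : σ.rreg 6 = v) :
    Runs w commitProg σ (fun t σ' => Encodes J s T B (τ.place T k p v) σ' ∧ σ'.rreg = σ.rreg ∧
      (∀ x < 10, x ≠ 1 → σ'.reg x = σ.reg x) ∧ (∀ A, A = 3 ∨ A = 4 → σ'.arr A = σ.arr A) ∧
      t + 4 * searchPotential B (T.card - 1) σ ≤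
        4 * searchPotential B (T.card - 1) σ' + 40) := by
  have hp1 := hP.one_le
  have hp2 := hP.lt_last
  have hsub := hv.dead_subset hT
  have hlast : T.card - 1 ∉ τ.dead T := by
    intro hmem
    have := hsub hmem
    rw [Finset.mem_Ico] at this
    omega
  have hbound := hfit.bound
  apply runs_block_seq
  simp only [evalBlock, Instr.eval, h.search.reg_two, h.count]
  rw [add_eval hlen]
  -- the effect of the first block, up to the search structure
  have key : ∀ f g, SearchStructure B (T.card - 1) ((τ.place T k p v).dead T)
        ⟨f, g, σ.rreg, Function.update (Function.update (Function.update σ.rarr 6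
          (Function.update (σ.rarr 6) p v)) 3 (Function.update (σ.rarr 3) τ.pieces.length (τ.e p)))
          4 (Function.update (σ.rarr 4) τ.pieces.length v)⟩ →
      f 1 = τ.pieces.length + 1 → g 0 = σ.arr 0 →
      g 2 = Function.update (σ.arr 2) τ.pieces.length k →
      Encodes J s T B (τ.place T k p v)
        ⟨f, g, σ.rreg, Function.update (Function.update (Function.update σ.rarr 6
          (Function.update (σ.rarr 6) p v)) 3 (Function.update (σ.rarr 3) τ.pieces.length (τ.e p)))
          4 (Function.update (σ.rarr 4) τ.pieces.length v)⟩ := by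
    intro f g hs hf hg0 hg2
    refine ⟨hs, ?_, h.speed, h.zero, ?_, ?_, ?_, ?_, ?_, ?_⟩
    · rw [AlgState.place_pieces]
      simpa using hf
    · simpa [hg0] using h.ranks
    · simpa [Function.update_apply] using h.deadlines
    · simpa [Function.update_apply] using h.workloads
    · simpa [Function.update_apply] using h.times
    · intro q h1 h2
      rw [AlgState.place_e]
      simp only [Function.update_apply, Nat.reduceEqDiff, ↓reduceIte]
      split_ifs
      · rfl
      · exact h.e_eq q h1 h2
    · intro j hj
      have hj' : j < (τ.pieces ++ [(⟨k, τ.e p, v⟩ : Piece n)]).length := by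
        rwa [← AlgState.place_pieces]
      have hget : (τ.place T k p v).pieces[j] = (τ.pieces ++ [(⟨k, τ.e p, v⟩ : Piece n)])[j] := by
        simp only [AlgState.place_pieces]
      rw [hget]
      simp only [hg2, Function.update_apply, Nat.reduceEqDiff, ↓reduceIte]
      rw [List.length_append, List.length_singleton] at hj'
      rcases Nat.lt_or_ge j τ.pieces.length with hlt | hge
      · rw [List.getElem_append_left hlt]
        have := h.pieces j hlt
        simpa [hlt.ne] using this
      · obtain rfl : j = τ.pieces.length := by omega
        simp
  apply runs_ite
  · intro hc
    simp only [Test.Holds, hr5, hr6] at hc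
    have hveq : v = nthSmallest T (p + 1) := le_antisymm hP.le_next hc
    refine (runs_deleteProg (p := p) (D := τ.dead T) (B := B) (N := T.card - 1)
      (h.search.congr ?_ ?_) hfit.one_le hfit.lt_word (by omega) hlast ?_ hp2
      (AlgState.Valid.notMem_dead hP)).mono ?_
    · rintro x (rfl | rfl | rfl) <;> simp
    · intro A hA
      simp [show A ≠ 2 by omega]
    · simpa using h8
    · rintro t _ ⟨f, g, rfl, hf, hg, hs, hpot⟩
      rw [← AlgState.Valid.dead_place_of_eq (k := k) hP hveq] at hs
      simp only [Function.update_apply, Nat.reduceEqDiff, ↓reduceIte, h6, h8, hr4, hr6]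
        at hs hf hg hpot ⊢
      refine ⟨key f g ?_ ?_ ?_ ?_, trivial, ?_, ?_, ?_⟩
      · refine hs.congr (fun _ _ => rfl) (fun _ _ => rfl)
      · rw [hf 1 (by norm_num)]; simp
      · rw [hg 0 (by norm_num)]; simp
      · rw [hg 2 (by norm_num)]; simp
      · intro x hx hx1
        rw [hf x hx, if_neg hx1]
      · rintro A (rfl | rfl)
        · rw [hg 3 (by norm_num)]; simp
        · rw [hg 4 (by norm_num)]; simp
      · simp only [searchPotential, List.length_cons, List.length_nil, Function.update_apply,
          Nat.reduceEqDiff, ↓reduceIte] at hpot ⊢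
        omega
  · intro hc
    simp only [Test.Holds, hr5, hr6] at hc
    have hvne : v ≠ nthSmallest T (p + 1) := fun heq => hc heq.ge
    apply runs_block
    simp only [evalBlock, Function.update_apply, Nat.reduceEqDiff, ↓reduceIte, h6, h8, hr4, hr6]
    refine ⟨key _ _ ?_ ?_ ?_ ?_, trivial, ?_, ?_, ?_⟩
    · rw [AlgState.Valid.dead_place_of_ne hP hvne]
      refine h.search.congr ?_ ?_
      · rintro x (rfl | rfl | rfl) <;> simp
      · intro A hA
        simp [show A ≠ 2 by omega]
    · simp
    · simp
    · simp
    · intro x hx hx1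
      simp [hx1]
    · rintro A (rfl | rfl) <;> simp
    · simp [searchPotential]
      omega

end

/-- Compute in real register 6 the time up to which the job can run in the canonical interval from
real register 4 to real register 5, and update the remaining workload in real register 2, which is
set to zero when the placement of the job is over. -/
def splitProg : Prog :=
  .seq (.ite (.rlt 3 5) (block [.rcopy 6 3]) (block [.rcopy 6 5]))
    (.seq (block [.rop .sub 7 6 4, .rop .mul 7 0 7])
      (.ite (.rlt 7 2)
        (.seq (block [.rop .sub 2 2 7]) (.ite (.rle 3 6) (block [.rcopy 2 1]) (block [])))
        (block [.rop .div 6 2 0, .rop .add 6 4 6, .rcopy 2 1])))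

open Classical in
-- The rules `fill`, `cut` and `finish` in one formula: the remaining workload stays nonzero only in
-- the case of `fill`.
lemma runs_splitProg {σ : State} {s e t b r u : ℝ} (h0 : σ.rreg 0 = s) (h1 : σ.rreg 1 = 0)
    (h2 : σ.rreg 2 = r) (h3 : σ.rreg 3 = b) (h4 : σ.rreg 4 = e) (h5 : σ.rreg 5 = t)
    (hu : u = min b t) :
    Runs w splitProg σ (fun τ σ' => τ ≤ 20 ∧ ∃ f, σ' = { σ with rreg := f } ∧
      (∀ x, x ≠ 2 → x ≠ 6 → x ≠ 7 → f x = σ.rreg x) ∧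
      f 6 = (if s * (u - e) < r then u else e + r / s) ∧
      f 2 = (if s * (u - e) < r ∧ u < b then r - s * (u - e) else 0)) := by
  have key : ∀ σ₁ : State, ∀ t₁ ≤ 3, σ₁ = { σ with rreg := Function.update σ.rreg 6 u } →
      Runs w (.seq (block [.rop .sub 7 6 4, .rop .mul 7 0 7])
      (.ite (.rlt 7 2)
        (.seq (block [.rop .sub 2 2 7]) (.ite (.rle 3 6) (block [.rcopy 2 1]) (block [])))
        (block [.rop .div 6 2 0, .rop .add 6 4 6, .rcopy 2 1]))) σ₁
        (fun τ σ' => t₁ + τ ≤ 20 ∧ ∃ f, σ' = { σ with rreg := f } ∧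
      (∀ x, x ≠ 2 → x ≠ 6 → x ≠ 7 → f x = σ.rreg x) ∧
      f 6 = (if s * (u - e) < r then u else e + r / s) ∧
      f 2 = (if s * (u - e) < r ∧ u < b then r - s * (u - e) else 0)) := by
    rintro _ t₁ ht₁ rfl
    apply runs_block_seq
    simp only [evalBlock, Instr.eval, RealOp.eval, Function.update_apply, Nat.reduceEqDiff,
      ↓reduceIte, h0, h4]
    apply runs_ite
    · intro hc
      simp only [Test.Holds, Function.update_apply, Nat.reduceEqDiff, ↓reduceIte, h2] at hc
      apply runs_block_seq
      apply runs_ite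
      · intro hc'
        simp only [Test.Holds, evalBlock, Instr.eval, RealOp.eval, Function.update_apply,
          Nat.reduceEqDiff, ↓reduceIte, h3] at hc'
        apply runs_block
        refine ⟨by simp only [List.length_cons, List.length_nil]; omega, _, rfl, ?_, ?_, ?_⟩
        · intro x hx2 hx6 hx7
          simp [evalBlock, Instr.eval, hx2, hx6, hx7]
        · simp [evalBlock, Instr.eval, hc]
        · simp [evalBlock, Instr.eval, h1, not_lt.2 hc']
      · intro hc'
        simp only [Test.Holds, evalBlock, Instr.eval, RealOp.eval, Function.update_apply,
          Nat.reduceEqDiff, ↓reduceIte, h3, not_le] at hc'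
        apply runs_block
        refine ⟨by simp only [List.length_cons, List.length_nil]; omega, _, rfl, ?_, ?_, ?_⟩
        · intro x hx2 hx6 hx7
          simp [hx2, hx6, hx7]
        · simp [hc]
        · simp [RealOp.eval, h2, hc, hc']
    · intro hc
      simp only [Test.Holds, Function.update_apply, Nat.reduceEqDiff, ↓reduceIte, h2] at hc
      apply runs_block
      refine ⟨by simp only [List.length_cons, List.length_nil]; omega, _, rfl, ?_, ?_, ?_⟩
      · intro x hx2 hx6 hx7
        simp [Instr.eval, hx2, hx6, hx7]
      · simp [Instr.eval, RealOp.eval, h0, h2, h4, hc]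
      · simp [Instr.eval, h1, hc]
  apply runs_seq
  apply runs_ite
  · intro hc
    simp only [Test.Holds, h3, h5] at hc
    apply runs_block
    apply key _ _ (by simp)
    simp only [evalBlock, Instr.eval, h3, hu, min_eq_left hc.le]
  · intro hc
    simp only [Test.Holds, h3, h5, not_lt] at hc
    apply runs_block
    apply key _ _ (by simp)
    simp only [evalBlock, Instr.eval, h5, hu, min_eq_right hc]

/-- One round of the placement of a job. -/
def stepProg : Prog :=
  .seq findProg (.seq (block [.rload 4 6 8])
    (.ite (.rle 3 4) (block [.rcopy 2 1])
      (.seq (block [.op .add 14 8 2, .rload 5 5 14]) (.seq splitProg commitProg))))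

section

variable {n : ℕ} {J : JobSet n} {s ε : ℝ} {T : Finset ℝ} {B : ℕ} {τ τ' : AlgState n}
  {σ σ' : State} {k : Fin n} {r : ℝ} {p : ℕ}

/-- The link between the find of the algorithm and the query to the search structure. Indices from
`m` on are not in `dead` either, but they exceed `p`. -/
lemma isLeast_notMem_dead (hv : τ.Valid T) {i : ℕ} (h1 : 1 ≤ i) (h2 : i < T.card)
    (hp : τ.Search T i p) : IsLeast {q | i ≤ q ∧ q ∉ τ.dead T} p := by
  rw [hv.search_iff h1 h2] at hp
  obtain ⟨⟨ha, hb, hc⟩, hd⟩ := hp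
  refine ⟨⟨ha, ?_⟩, ?_⟩
  · rw [AlgState.mem_dead]
    rintro ⟨_, h⟩
    exact hc.ne h
  · rintro q ⟨hq1, hq2⟩
    rcases Nat.lt_or_ge q T.card with hq | hq
    · refine hd ⟨hq1, hq, lt_of_le_of_ne (hv.e_le q (by omega) hq) ?_⟩
      intro heq
      exact hq2 (AlgState.mem_dead.2 ⟨⟨by omega, hq⟩, heq⟩)
    · omega

open Classical in
lemma runs_stepProg (hs : 0 < s) (hε : 0 < ε)
    (hfit : Fits w B ((timePoints J ε).card - 1))
    (h : Encodes J s (timePoints J ε) B τ σ) (hv : τ.Valid (timePoints J ε))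
    (hl : Loaded J (timePoints J ε) k r σ)
    (hp : τ.Search (timePoints J ε) (rankIn (timePoints J ε) (J.a k)) p) (hr : 0 < r) :
    (J.b k ≤ τ.e p → Runs w stepProg σ (fun t σ' => t ≤ 40 ∧
      Encodes J s (timePoints J ε) B τ.countFind σ' ∧ Loaded J (timePoints J ε) k 0 σ' ∧
      Frame σ σ' ∧ searchPotential B ((timePoints J ε).card - 1) σ' =
        searchPotential B ((timePoints J ε).card - 1) σ)) ∧
    (∀ u v, τ.e p < J.b k → u = min (J.b k) (nthSmallest (timePoints J ε) (p + 1)) →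
      v = (if s * (u - τ.e p) < r then u else τ.e p + r / s) →
      τ.pieces.length + 1 < 2 ^ w →
      Runs w stepProg σ (fun t σ' =>
        Encodes J s (timePoints J ε) B (τ.place (timePoints J ε) k p v) σ' ∧
        (τ.place (timePoints J ε) k p v).Valid (timePoints J ε) ∧
        Loaded J (timePoints J ε) k
          (if s * (u - τ.e p) < r ∧ u < J.b k then r - s * (u - τ.e p) else 0) σ' ∧
        Frame σ σ' ∧
        t + 4 * searchPotential B ((timePoints J ε).card - 1) σ ≤
          4 * searchPotential B ((timePoints J ε).card - 1) σ' + 100)) := by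
  set T := timePoints J ε with hTdef
  have hm := two_le_card_timePoints J hε
  have hi1 := one_le_rankIn (arrival_mem_timePoints J ε k)
  have hi2 := rankIn_arrival_lt J hε k
  have hlast := nthSmallest_timePoints_one J hε
  rw [← hTdef] at hm hi1 hi2 hlast
  have hsub := hv.dead_subset hm
  have hND : T.card - 1 ∉ τ.dead T := by
    intro hmem
    have := hsub hmem
    rw [Finset.mem_Ico] at this
    omega
  have hbound := hfit.bound
  have hp' := (hv.search_iff hi1 hi2).1 hp
  have hpl := isLeast_notMem_dead hv hi1 hi2 hp
  have hfind := runs_findProg (w := w) h.search hfit.one_le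
    (Nat.pow_lt_pow_right (by norm_num) hfit.lt_word) (by omega) hND hl.rank (by omega)
  have he := h.e_eq p (by have := hp'.1.1; omega) hp'.1.2.1
  constructor
  · intro hb
    apply runs_seq
    refine hfind.mono ?_
    rintro t₁ _ ⟨ht₁, f, rfl, hf8, hf⟩
    have hf8 := hf8.unique hpl
    apply runs_block_seq
    simp only [evalBlock, Instr.eval, hf8, he]
    apply runs_ite
    · intro _
      apply runs_block
      simp only [List.length_cons, List.length_nil, evalBlock, Instr.eval, Function.update_apply,
        Nat.reduceEqDiff, ↓reduceIte, h.zero]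
      refine ⟨by omega, h.countFind.congr ?_ rfl ?_ rfl, ⟨?_, ?_, ?_, ?_⟩, ⟨?_, ?_⟩, rfl⟩
      · rintro x (rfl | rfl | rfl | rfl) <;> exact hf _ (by norm_num) (by norm_num)
      · intro x hx
        simp [show x ≠ 2 by omega, show x ≠ 4 by omega]
      · simpa [hf] using hl.job
      · simpa [hf] using hl.rank
      · simp
      · simpa using hl.deadline
      · rintro x (rfl | rfl | rfl) <;> exact hf _ (by norm_num) (by norm_num)
      · intro A _
        rfl
    · intro hc
      simp [Test.Holds, hl.deadline] at hc
      linarith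
  · intro u v hb hu hvdef hlen
    have hue : τ.e p < u := by rw [hu]; exact lt_min hb hp'.1.2.2
    have hut : u ≤ nthSmallest T (p + 1) := hu ▸ min_le_right _ _
    have hub : u ≤ J.b k := hu ▸ min_le_left _ _
    have hev : τ.e p < v := by
      rw [hvdef]
      split_ifs
      · exact hue
      · have := div_pos hr hs
        linarith
    have hvu : v ≤ u := by
      rw [hvdef]
      split_ifs with hc
      · exact le_rfl
      · have : r / s ≤ u - τ.e p := by
          rw [div_le_iff₀ hs]
          linarith
        linarith
    have hP := hv.placeable hi1 hi2 hp hev (hvu.trans hut)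
      (by rw [hlast]; exact (hvu.trans hub).trans (J.b_le_one k))
    have hp1 := hP.one_le
    have hp2 := hP.lt_last
    have htime := h.times (p + 1) (by omega) (by omega)
    apply runs_seq
    refine hfind.mono ?_
    rintro t₁ _ ⟨ht₁, f, rfl, hf8, hf⟩
    have hf8 := hf8.unique hpl
    have hf2 : f 2 = 1 := (hf 2 (by norm_num) (by norm_num)).trans h.search.reg_two
    apply runs_block_seq
    simp only [evalBlock, Instr.eval, hf8, he]
    apply runs_ite
    · intro hc
      simp [Test.Holds, hl.deadline] at hc
      linarith
    · intro _
      apply runs_block_seq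
      simp only [List.length_cons, List.length_nil, evalBlock, Instr.eval, hf8, hf2,
        Function.update_self]
      rw [add_eval (by omega), htime]
      apply runs_seq
      refine (runs_splitProg (s := s) (e := τ.e p) (t := nthSmallest T (p + 1)) (b := J.b k)
        (r := r) (u := u) ?_ ?_ ?_ ?_ ?_ ?_ hu).mono ?_
      · simpa using h.speed
      · simpa using h.zero
      · simpa using hl.work
      · simpa using hl.deadline
      · simp
      · simp
      rintro t₂ _ ⟨ht₂, g, rfl, hg, hg6, hg2⟩
      rw [← hvdef] at hg6
      refine (runs_commitProg (J := J) (s := s) (k := k) (B := B) hm hfit (h.congr ?_ ?_ ?_ ?_)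
        hv hP hlen ?_ ?_ ?_ ?_ ?_).mono ?_
      · rintro x (rfl | rfl | rfl | rfl) <;> simp [hf]
      · rfl
      · intro x hx
        dsimp only
        rw [hg x (by omega) (by omega) (by omega)]
        simp [show x ≠ 4 by omega, show x ≠ 5 by omega]
      · rfl
      · simpa [hf] using hl.job
      · simpa using hf8
      · simp [hg]
      · simp [hg]
      · exact hg6
      · rintro t₃ σ' ⟨h1, h2, h3, h4, h5⟩
        refine ⟨h1, hv.place hP k, ⟨?_, ?_, ?_, ?_⟩, ⟨?_, ?_⟩, ?_⟩
        · rw [h3 6 (by norm_num) (by norm_num)]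
          simpa [hf] using hl.job
        · rw [h3 7 (by norm_num) (by norm_num)]
          simpa [hf] using hl.rank
        · rw [h2]
          exact hg2
        · rw [h2]
          simpa [hg] using hl.deadline
        · rintro x (rfl | rfl | rfl)
          · rw [h3 0 (by norm_num) (by norm_num)]; simp [hf]
          · rw [h3 4 (by norm_num) (by norm_num)]; simp [hf]
          · rw [h3 5 (by norm_num) (by norm_num)]; simp [hf]
        · intro A hA
          exact h4 A hA
        · have h6 : searchPotential B (T.card - 1) { σ with
              reg := Function.update f 14 (p + 1), rreg := g } =
              searchPotential B (T.card - 1) σ := rfl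
          change t₃ + 4 * searchPotential B (T.card - 1) σ ≤ _ at h5
          omega

/-- Place the job whose data have been loaded. -/
def placeProg : Prog := .loop (.rlt 1 2) stepProg

/-- A bound on the final number of pieces thereby keeps the piece counter from overflowing
throughout. -/
lemma length_le_of_placeJob {i : ℕ} (h : PlaceJob J s T k i τ r τ') :
    τ.pieces.length ≤ τ'.pieces.length := by
  induction h with
  | done => exact le_rfl
  | late => exact le_rfl
  | fill σ σ' r p u _ _ _ _ _ _ _ ih =>
    refine le_trans ?_ ih
    rw [AlgState.place_pieces]; simp
  | cut => rw [AlgState.place_pieces]; simp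
  | finish => rw [AlgState.place_pieces]; simp

/-- The RAM simulates the placement of a job; uniting sets pays for the time. -/
lemma runs_placeProg (hs : 0 < s) (hε : 0 < ε) (hfit : Fits w B ((timePoints J ε).card - 1))
    (hrun : PlaceJob J s (timePoints J ε) k (rankIn (timePoints J ε) (J.a k)) τ r τ') :
    ∀ σ : State, Encodes J s (timePoints J ε) B τ σ → τ.Valid (timePoints J ε) →
    Loaded J (timePoints J ε) k r σ → τ'.pieces.length < 2 ^ w →
    Runs w placeProg σ (fun t σ' => Encodes J s (timePoints J ε) B τ' σ' ∧
      τ'.Valid (timePoints J ε) ∧ σ'.reg 6 = k ∧ Frame σ σ' ∧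
      t + 4 * searchPotential B ((timePoints J ε).card - 1) σ + 101 * τ.unions ≤
        4 * searchPotential B ((timePoints J ε).card - 1) σ' + 101 * τ'.unions + 102) := by
  have hunions : ∀ (τ : AlgState n) p v,
      τ.unions ≤ (τ.place (timePoints J ε) k p v).unions := by
    intro τ p v
    have := AlgState.place_counts (T := timePoints J ε) (σ := τ) (k := k) (p := p) (v := v)
    omega
  -- the last round
  have last : ∀ (τ : AlgState n) (r : ℝ) (p : ℕ) (u v : ℝ) (σ : State), 0 < r →
      τ.Search (timePoints J ε) (rankIn (timePoints J ε) (J.a k)) p → τ.e p < J.b k →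
      u = min (J.b k) (nthSmallest (timePoints J ε) (p + 1)) →
      v = (if s * (u - τ.e p) < r then u else τ.e p + r / s) →
      ¬ (s * (u - τ.e p) < r ∧ u < J.b k) →
      Encodes J s (timePoints J ε) B τ σ → τ.Valid (timePoints J ε) →
      Loaded J (timePoints J ε) k r σ →
      (τ.place (timePoints J ε) k p v).pieces.length < 2 ^ w →
      Runs w placeProg σ (fun t σ' =>
        Encodes J s (timePoints J ε) B (τ.place (timePoints J ε) k p v) σ' ∧
        (τ.place (timePoints J ε) k p v).Valid (timePoints J ε) ∧ σ'.reg 6 = k ∧ Frame σ σ' ∧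
        t + 4 * searchPotential B ((timePoints J ε).card - 1) σ + 101 * τ.unions ≤
          4 * searchPotential B ((timePoints J ε).card - 1) σ' +
            101 * (τ.place (timePoints J ε) k p v).unions + 102) := by
    intro τ r p u v σ hr hp hb hu hvdef hnot h hv hl hlen
    rw [AlgState.place_pieces, List.length_append, List.length_singleton] at hlen
    apply runs_loop_true
    · simp only [Test.Holds, h.zero, hl.work]
      exact hr
    refine ((runs_stepProg hs hε hfit h hv hl hp hr).2 u v hb hu hvdef hlen).mono ?_
    rintro t₁ σ₁ ⟨h1, h2, h3, h4, h5⟩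
    rw [if_neg hnot] at h3
    apply runs_loop_false
    · simp only [Test.Holds, h1.zero, h3.work, lt_irrefl, not_false_eq_true]
    · refine ⟨h1, h2, h3.job, h4, ?_⟩
      have := hunions τ p v
      omega
  induction hrun with
  | done τ r hr =>
    intro σ h hv hl hlen
    apply runs_loop_false
    · simp only [Test.Holds, h.zero, hl.work, not_lt]
      exact hr
    · exact ⟨h, hv, hl.job, ⟨fun _ _ => rfl, fun _ _ => rfl⟩, by omega⟩
  | late τ r p hr hp hb =>
    intro σ h hv hl hlen
    apply runs_loop_true
    · simp only [Test.Holds, h.zero, hl.work]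
      exact hr
    refine ((runs_stepProg hs hε hfit h hv hl hp hr).1 hb).mono ?_
    rintro t₁ σ₁ ⟨h1, h2, h3, h4, h5⟩
    apply runs_loop_false
    · simp only [Test.Holds, h2.zero, h3.work, lt_irrefl, not_false_eq_true]
    · refine ⟨h2, hv.countFind, h3.job, h4, ?_⟩
      rw [h5]
      have : τ.countFind.unions = τ.unions := rfl
      omega
  | fill τ τ' r p u hr hp hb hu hur hub rest ih =>
    intro σ h hv hl hlen
    have hlen' := length_le_of_placeJob rest
    rw [AlgState.place_pieces, List.length_append, List.length_singleton] at hlen'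
    apply runs_loop_true
    · simp only [Test.Holds, h.zero, hl.work]
      exact hr
    refine ((runs_stepProg hs hε hfit h hv hl hp hr).2 u u hb hu (by rw [if_pos hur])
      (by omega)).mono ?_
    rintro t₁ σ₁ ⟨h1, h2, h3, h4, h5⟩
    rw [if_pos ⟨hur, hub⟩] at h3
    refine (ih σ₁ h1 h2 h3 hlen).mono ?_
    rintro t₂ σ₂ ⟨h6, h7, h8, h9, h10⟩
    refine ⟨h6, h7, h8, h4.trans h9, ?_⟩
    -- As the loop goes on, the canonical interval has become empty; the union pays `101`, namely at
    -- most 100 steps for the round beyond the relabelling and one for the loop test.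
    have hueq : u = nthSmallest (timePoints J ε) (p + 1) := by
      rw [hu]
      apply min_eq_right
      by_contra! hc
      rw [min_eq_left hc.le] at hu
      exact hub.ne hu
    have hcnt : (τ.place (timePoints J ε) k p u).unions = τ.unions + 1 := by
      rw [AlgState.place_of_eq hueq]; rfl
    omega
  | cut τ r p u hr hp hb hu hur hub =>
    intro σ h hv hl hlen
    exact last τ r p u u σ hr hp hb hu (by rw [if_pos hur]) (fun hc => hc.2.ne hub) h hv hl hlen
  | finish τ r p u hr hp hb hu hur =>
    intro σ h hv hl hlen
    exact last τ r p u _ σ hr hp hb hu (by rw [if_neg (not_lt.2 hur)])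
      (fun hc => absurd hc.1 (not_lt.2 hur)) h hv hl hlen

end

/-! ### Linked buckets and the main loop -/

/-- The list `L`, linked by `nxt`, starts at `h`; the job number `k` is represented by `k + 1`, the
end of the list by `0`. -/
def Chain {n : ℕ} (nxt : ℕ → ℕ) : ℕ → List (Fin n) → Prop
  | h, [] => h = 0
  | h, k :: L => h = k + 1 ∧ Chain nxt (nxt k) L

lemma Chain.congr {n : ℕ} {nxt nxt' : ℕ → ℕ} {L : List (Fin n)} {h : ℕ} (hc : Chain nxt h L)
    (heq : ∀ k ∈ L, nxt' k = nxt k) : Chain nxt' h L := by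
  induction L generalizing h with
  | nil => exact hc
  | cons k L ih =>
    refine ⟨hc.1, ?_⟩
    rw [heq k List.mem_cons_self]
    exact ih hc.2 fun l hl => heq l (List.mem_cons_of_mem k hl)

/-- Place the job in register 5, and go to the next one in its list. -/
def jobProg : Prog :=
  .seq (block [.op .sub 6 5 2, .load 7 0 6, .rload 2 2 6, .rload 3 1 6])
    (.seq placeProg (block [.load 5 4 6]))

/-- Place the jobs of a linked list. -/
def bucketProg : Prog := .loop (.wne 5 9) jobProg

/-- Place the jobs of all buckets. -/
def scheduleProg : Prog :=
  .seq (block [.const 4 1])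
    (.seq (.loop (.wle 4 0) (.seq (block [.load 5 3 4]) (.seq bucketProg (block [.op .add 4 4 2]))))
      (block [.copy 0 1]))

section

variable {n : ℕ} {J : JobSet n} {s ε : ℝ} {T : Finset ℝ} {B : ℕ} {τ τ' : AlgState n}

lemma length_le_of_placeJobs {L : List (Fin n)} (h : PlaceJobs J s T L τ τ') :
    τ.pieces.length ≤ τ'.pieces.length := by
  induction h with
  | nil => exact le_rfl
  | cons k ks σ σ' σ'' first _ ih => exact (length_le_of_placeJob first).trans ih

lemma placeJobs_append {L L' : List (Fin n)} (h : PlaceJobs J s T (L ++ L') τ τ') :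
    ∃ τ₁, PlaceJobs J s T L τ τ₁ ∧ PlaceJobs J s T L' τ₁ τ' := by
  induction L generalizing τ with
  | nil => exact ⟨τ, PlaceJobs.nil τ, h⟩
  | cons k L ih =>
    cases h with
    | cons _ _ _ σ' _ first rest =>
      obtain ⟨τ₁, h1, h2⟩ := ih rest
      exact ⟨τ₁, PlaceJobs.cons k L τ σ' τ₁ first h1, h2⟩

lemma runs_bucketProg (hs : 0 < s) (hε : 0 < ε) (hfit : Fits w B ((timePoints J ε).card - 1))
    (hn : n < 2 ^ w) {L : List (Fin n)} (hrun : PlaceJobs J s (timePoints J ε) L τ τ') :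
    ∀ σ : State, Encodes J s (timePoints J ε) B τ σ → τ.Valid (timePoints J ε) →
    Chain (σ.arr 4) (σ.reg 5) L → τ'.pieces.length < 2 ^ w →
    Runs w bucketProg σ (fun t σ' => Encodes J s (timePoints J ε) B τ' σ' ∧
      τ'.Valid (timePoints J ε) ∧ σ'.reg 0 = σ.reg 0 ∧ σ'.reg 4 = σ.reg 4 ∧
      σ'.arr 3 = σ.arr 3 ∧ σ'.arr 4 = σ.arr 4 ∧
      t + 4 * searchPotential B ((timePoints J ε).card - 1) σ + 101 * τ.unions ≤
        4 * searchPotential B ((timePoints J ε).card - 1) σ' + 101 * τ'.unions +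
          120 * L.length + 1) := by
  induction hrun with
  | nil τ =>
    intro σ h hv hc hlen
    apply runs_loop_false
    · simp only [Test.Holds, h.search.reg_nine, not_not]
      exact hc
    · exact ⟨h, hv, rfl, rfl, rfl, rfl, by omega⟩
  | cons k L τ τ₁ τ₂ first rest ih =>
    intro σ h hv hc hlen
    obtain ⟨hc1, hc2⟩ := hc
    have hk := k.2
    apply runs_loop_true
    · simp only [Test.Holds, h.search.reg_nine, hc1]
      omega
    apply runs_block_seq
    simp only [evalBlock, Instr.eval, Function.update_apply, Nat.reduceEqDiff, ↓reduceIte,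
      h.search.reg_two, hc1]
    rw [sub_eval (by omega) (by omega), Nat.add_sub_cancel]
    apply runs_seq
    refine (runs_placeProg hs hε hfit first _ (h.congr ?_ ?_ ?_ ?_) hv ⟨?_, ?_, ?_, ?_⟩
      ((length_le_of_placeJobs rest).trans_lt hlen)).mono ?_
    · rintro x (rfl | rfl | rfl | rfl) <;> simp
    · rfl
    · intro x hx
      simp [show x ≠ 2 by omega, show x ≠ 3 by omega]
    · rfl
    · simp
    · simpa using h.ranks k
    · simpa using h.workloads k
    · simpa using h.deadlines k
    rintro t₁ σ₁ ⟨h1, h2, h3, h4, h5⟩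
    have harr4 : σ₁.arr 4 = σ.arr 4 := h4.arr 4 (by simp)
    have harr3 : σ₁.arr 3 = σ.arr 3 := h4.arr 3 (by simp)
    have hr0 : σ₁.reg 0 = σ.reg 0 := by simpa using h4.reg 0 (by simp)
    have hr4 : σ₁.reg 4 = σ.reg 4 := by simpa using h4.reg 4 (by simp)
    apply runs_block
    simp only [evalBlock, Instr.eval, h3]
    refine (ih _ (h1.congr ?_ ?_ ?_ ?_) h2 ?_ hlen).mono ?_
    · rintro x (rfl | rfl | rfl | rfl) <;> simp
    · rfl
    · exact fun _ _ => rfl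
    · rfl
    · simpa [harr4] using hc2
    rintro t₂ σ₂ ⟨h6, h7, h8, h9, h10, h11, h12⟩
    refine ⟨h6, h7, ?_, ?_, h10.trans harr3, h11.trans harr4, ?_⟩
    · rw [h8]; simpa using hr0
    · rw [h9]; simpa using hr4
    · change t₂ + 4 * searchPotential B ((timePoints J ε).card - 1) σ₁ + _ ≤ _ at h12
      change t₁ + 4 * searchPotential B ((timePoints J ε).card - 1) σ + _ ≤ _ at h5
      simp only [List.length_cons, List.length_nil]
      omega

/-- The costs of the jobs telescope: what remains is the final potential, bounded by `potential_le`,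
the final number of unions, and a constant for each job and each bucket. -/
lemma runs_scheduleProg (hs : 0 < s) (hε : 0 < ε) (hfit : Fits w B ((timePoints J ε).card - 1))
    (hn : n + 1 < 2 ^ w) {bucket : ℕ → List (Fin n)} {σ : State}
    (hrun : PlaceJobs J s (timePoints J ε) ((List.range' 1 n).flatMap bucket) τ τ')
    (h : Encodes J s (timePoints J ε) B τ σ) (hv : τ.Valid (timePoints J ε))
    (h0 : σ.reg 0 = n) (hc : ∀ r, Chain (σ.arr 4) (σ.arr 3 r) (bucket r))
    (hlen : τ'.pieces.length < 2 ^ w) :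
    Runs w scheduleProg σ (fun t σ' => Outputs σ' τ'.pieces ∧
      t ≤ 4 * (((timePoints J ε).card - 1) / B + 1) *
          Nat.log 2 (((timePoints J ε).card - 1) / B + 1) +
        101 * τ'.unions + 120 * ((List.range' 1 n).flatMap bucket).length + 6 * n + 10) := by
  have key : ∀ d r τ σ, r + d = n + 1 →
      PlaceJobs J s (timePoints J ε) ((List.range' r d).flatMap bucket) τ τ' →
      Encodes J s (timePoints J ε) B τ σ → τ.Valid (timePoints J ε) → σ.reg 0 = n →
      σ.reg 4 = r → (∀ r, Chain (σ.arr 4) (σ.arr 3 r) (bucket r)) →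
      Runs w (.loop (.wle 4 0) (.seq (block [.load 5 3 4])
        (.seq bucketProg (block [.op .add 4 4 2])))) σ (fun t σ' =>
        Encodes J s (timePoints J ε) B τ' σ' ∧
        t + 4 * searchPotential B ((timePoints J ε).card - 1) σ + 101 * τ.unions ≤
        4 * searchPotential B ((timePoints J ε).card - 1) σ' + 101 * τ'.unions +
          120 * ((List.range' r d).flatMap bucket).length + 6 * d + 1) := by
    intro d
    induction d with
    | zero =>
      intro r τ σ hr hrun h hv h0 h4 hc
      cases hrun
      apply runs_loop_false
      · simp only [Test.Holds, h0, h4]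
        omega
      · exact ⟨h, by omega⟩
    | succ d ih =>
      intro r τ σ hr hrun h hv h0 h4 hc
      rw [List.range'_succ, List.flatMap_cons] at hrun ⊢
      obtain ⟨τ₁, hrun₁, hrun₂⟩ := placeJobs_append hrun
      apply runs_loop_true
      · simp only [Test.Holds, h0, h4]
        omega
      apply runs_block_seq
      simp only [evalBlock, Instr.eval, h4]
      apply runs_seq
      refine (runs_bucketProg hs hε hfit (by omega) hrun₁ _ (h.congr ?_ ?_ ?_ ?_) hv ?_
        ((length_le_of_placeJobs hrun₂).trans_lt hlen)).mono ?_
      · rintro x (rfl | rfl | rfl | rfl) <;> simp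
      · rfl
      · exact fun _ _ => rfl
      · rfl
      · simpa using hc r
      rintro t₁ σ₁ ⟨h1, h2, h3, h5, h6, h7, h8⟩
      dsimp only at h3 h5 h6 h7
      rw [Function.update_of_ne (by norm_num)] at h3 h5
      apply runs_block
      simp only [evalBlock, Instr.eval, h1.search.reg_two, h5, h4]
      rw [add_eval (by omega)]
      refine (ih (r + 1) τ₁ _ (by omega) hrun₂ (h1.congr ?_ ?_ ?_ ?_) h2 ?_ ?_ ?_).mono ?_
      · rintro x (rfl | rfl | rfl | rfl) <;> simp
      · rfl
      · exact fun _ _ => rfl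
      · rfl
      · simp [h3, h0]
      · simp
      · simpa [h6, h7] using hc
      rintro t₂ σ₂ ⟨h9, h10⟩
      refine ⟨h9, ?_⟩
      change t₂ + 4 * searchPotential B ((timePoints J ε).card - 1) σ₁ + _ ≤ _ at h10
      change t₁ + 4 * searchPotential B ((timePoints J ε).card - 1) σ + _ ≤ _ at h8
      simp only [List.length_cons, List.length_nil, List.length_append]
      omega
  apply runs_block_seq
  simp only [evalBlock, Instr.eval]
  rw [Nat.mod_eq_of_lt (by omega : 1 < 2 ^ w)]
  apply runs_seq
  refine (key n 1 τ _ (by omega) hrun (h.congr ?_ ?_ ?_ ?_) hv ?_ ?_ ?_).mono ?_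
  · rintro x (rfl | rfl | rfl | rfl) <;> simp
  · rfl
  · exact fun _ _ => rfl
  · rfl
  · simpa using h0
  · simp
  · exact hc
  rintro t₁ σ₁ ⟨h1, h2⟩
  apply runs_block
  have hpot := h1.search.find.potential_le
  change searchPotential B ((timePoints J ε).card - 1) σ₁ ≤ _ at hpot
  refine ⟨⟨?_, ?_⟩, ?_⟩
  · simp [evalBlock, Instr.eval, h1.count]
  · exact h1.pieces
  · simp only [List.length_cons, List.length_nil]
    rw [Nat.mul_assoc]
    omega

end

/-! ## Preparations -/

/-- Compute the block size in register 3 and the corresponding power of two in register 10. -/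
def blockSizeProg : Prog :=
  .seq (block [.const 2 1, .const 3 1, .const 10 2])
    (.loop (.wle 10 0) (block [.op .add 3 3 2, .op .add 10 10 10]))

lemma runs_blockSizeProg {σ : State} {n : ℕ} (h0 : σ.reg 0 = n) (hw : 2 * n + 4 < 2 ^ w)
    (hlog : Nat.log 2 n + 1 < 2 ^ w) :
    Runs w blockSizeProg σ (fun τ σ' => τ ≤ 4 * Nat.log 2 n + 5 ∧ ∃ f, σ' = { σ with reg := f } ∧
      f 2 = 1 ∧ f 3 = Nat.log 2 n + 1 ∧ f 10 = 2 ^ (Nat.log 2 n + 1) ∧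
      ∀ x, x ≠ 2 → x ≠ 3 → x ≠ 10 → f x = σ.reg x) := by
  apply runs_block_seq
  simp only [evalBlock, Instr.eval]
  rw [Nat.mod_eq_of_lt (by omega : 1 < 2 ^ w), Nat.mod_eq_of_lt (by omega : 2 < 2 ^ w)]
  refine runs_loop_const (Nat.log 2 n) 3 (fun i σ' => ∃ f, σ' = { σ with reg := f } ∧
      f 2 = 1 ∧ f 3 = i + 1 ∧ f 10 = 2 ^ (i + 1) ∧
      ∀ x, x ≠ 2 → x ≠ 3 → x ≠ 10 → f x = σ.reg x) ?_ ?_ ?_ ?_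
  · rintro i hi _ ⟨f, rfl, hf2, hf3, hf10, hf⟩
    have hn0 : n ≠ 0 := by
      rintro rfl
      simp at hi
    have hpow : 2 ^ (i + 1) ≤ n := Nat.pow_le_of_le_log hn0 (by omega)
    constructor
    · simp only [Test.Holds, hf10, hf 0 (by norm_num) (by norm_num) (by norm_num), h0]
      exact hpow
    · apply runs_block
      simp only [evalBlock, Instr.eval, Function.update_apply, Nat.reduceEqDiff, ↓reduceIte, hf2,
        hf3, hf10]
      rw [add_eval (by omega), add_eval (by omega)]
      refine ⟨by norm_num, _, rfl, ?_, ?_, ?_, ?_⟩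
      · simpa using hf2
      · simp
      · rw [Function.update_self]
        ring
      · intro x hx2 hx3 hx10
        simp [hx3, hx10, hf x hx2 hx3 hx10]
  · rintro _ ⟨f, rfl, hf2, hf3, hf10, hf⟩
    simp only [Test.Holds, hf10, hf 0 (by norm_num) (by norm_num) (by norm_num), h0, not_le]
    exact Nat.lt_pow_succ_log_self (by norm_num) n
  · refine ⟨_, rfl, by simp, by simp, by simp, ?_⟩
    intro x hx2 hx3 hx10
    simp [hx2, hx3, hx10]
  · rintro τ _ hτ ⟨f, rfl, hf⟩
    exact ⟨by simp only [List.length_cons, List.length_nil]; omega, f, rfl, hf⟩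

/-- Tabulate the positions of the lowest bits of the numbers below the contents of register 10. -/
def tableProg : Prog :=
  .seq (block [.const 11 1, .const 12 2])
    (.loop (.wlt 11 10)
      (.seq (block [.op .mod 13 11 12])
        (.seq (.ite (.weq 13 2) (block [.store 6 11 9])
            (block [.op .div 14 11 12, .load 14 6 14, .op .add 14 14 2, .store 6 11 14]))
          (block [.op .add 11 11 2]))))

lemma isLeast_testBit_of_odd {x : ℕ} (hx : x % 2 = 1) :
    IsLeast {c | x.testBit c = true} 0 :=
  ⟨by simp [Nat.testBit_zero, hx], fun _ _ => Nat.zero_le _⟩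

lemma isLeast_testBit_of_even {x c : ℕ} (hx : x % 2 ≠ 1)
    (h : IsLeast {c | (x / 2).testBit c = true} c) :
    IsLeast {c | x.testBit c = true} (c + 1) := by
  obtain ⟨h1, h2⟩ := h
  constructor
  · rw [Set.mem_ofPred_eq, Nat.testBit_succ]
    exact h1
  · intro d hd
    rw [Set.mem_ofPred_eq] at hd
    cases d with
    | zero =>
      rw [Nat.testBit_zero] at hd
      simp [hx] at hd
    | succ d =>
      rw [Nat.testBit_succ] at hd
      exact Nat.succ_le_succ (h2 hd)

/-- An odd number has lowest bit `0`; for an even `x` the entry is one more than that of `x / 2`,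
which is already in the table. -/
lemma runs_tableProg {σ : State} {B : ℕ} (h2 : σ.reg 2 = 1) (h9 : σ.reg 9 = 0)
    (h10 : σ.reg 10 = 2 ^ B) (hB : 1 ≤ B) (hBw : B < w) :
    Runs w tableProg σ (fun τ σ' => τ ≤ 12 * 2 ^ B + 4 ∧ ∃ f g,
      σ' = { σ with reg := f, arr := g } ∧ (∀ x ≤ 10, f x = σ.reg x) ∧
      (∀ A, A ≠ 6 → g A = σ.arr A) ∧ LowBitTable B (g 6)) := by
  have hpow : 2 ^ B < 2 ^ w := Nat.pow_lt_pow_right (by norm_num) hBw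
  have hpow1 : 2 ≤ 2 ^ B := Nat.le_self_pow (by omega) 2
  apply runs_block_seq
  simp only [evalBlock, Instr.eval]
  rw [Nat.mod_eq_of_lt (by omega : 1 < 2 ^ w), Nat.mod_eq_of_lt (by omega : 2 < 2 ^ w)]
  refine runs_loop_const (2 ^ B - 1) 11 (fun i σ' => ∃ f g,
      σ' = { σ with reg := f, arr := g } ∧ f 11 = i + 1 ∧ f 12 = 2 ∧
      (∀ x ≤ 10, f x = σ.reg x) ∧ (∀ A, A ≠ 6 → g A = σ.arr A) ∧
      ∀ x, x ≠ 0 → x < i + 1 → IsLeast {c | x.testBit c = true} (g 6 x)) ?_ ?_ ?_ ?_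
  · rintro i hi _ ⟨f, g, rfl, hf11, hf12, hf, hg, hg6⟩
    have hf2 : f 2 = 1 := by rw [hf 2 (by norm_num), h2]
    constructor
    · simp only [Test.Holds, hf11, hf 10 (by norm_num), h10]
      omega
    apply runs_block_seq
    simp only [evalBlock, Instr.eval, hf11, hf12]
    rw [mod_eval (by omega)]
    apply runs_seq
    apply runs_ite
    · intro hc
      simp only [Test.Holds, Function.update_apply, Nat.reduceEqDiff, ↓reduceIte, hf2] at hc
      apply runs_block
      apply runs_block
      simp only [evalBlock, Instr.eval, Function.update_apply, Nat.reduceEqDiff, ↓reduceIte, hf11,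
        hf2, hf 9 (by norm_num), h9]
      rw [add_eval (by omega)]
      refine ⟨by norm_num, _, _, rfl, ?_, ?_, ?_, ?_, ?_⟩
      · simp
      · simpa using hf12
      · intro x hx
        simp [show x ≠ 11 by omega, show x ≠ 13 by omega, hf x hx]
      · intro A hA
        simp [hA, hg A hA]
      · intro x hx0 hx
        rw [Function.update_self, Function.update_apply]
        split_ifs with hxi
        · subst hxi
          exact isLeast_testBit_of_odd hc
        · exact hg6 x hx0 (by omega)
    · intro hc
      simp only [Test.Holds, Function.update_apply, Nat.reduceEqDiff, ↓reduceIte, hf2] at hc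
      have hleast := hg6 ((i + 1) / 2) (by omega) (by omega)
      -- A position `c` of a set bit of `y` satisfies `c < 2 ^ c ≤ y`, so adding one cannot
      -- overflow.
      have hlt : g 6 ((i + 1) / 2) < (i + 1) / 2 :=
        (Nat.lt_two_pow_self).trans_le (Nat.ge_two_pow_of_testBit hleast.1)
      apply runs_block
      apply runs_block
      simp only [evalBlock, Instr.eval, Function.update_apply, Nat.reduceEqDiff, ↓reduceIte, hf11,
        hf12, hf2]
      rw [div_eval (by omega), add_eval (by omega), add_eval (by omega)]
      refine ⟨by norm_num, _, _, rfl, ?_, ?_, ?_, ?_, ?_⟩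
      · simp
      · simpa using hf12
      · intro x hx
        simp [show x ≠ 11 by omega, show x ≠ 13 by omega, show x ≠ 14 by omega, hf x hx]
      · intro A hA
        simp [hA, hg A hA]
      · intro x hx0 hx
        rw [Function.update_self, Function.update_apply]
        split_ifs with hxi
        · subst hxi
          exact isLeast_testBit_of_even hc hleast
        · exact hg6 x hx0 (by omega)
  · rintro _ ⟨f, g, rfl, hf11, hf12, hf, hg, hg6⟩
    simp only [Test.Holds, hf11, hf 10 (by norm_num), h10]
    omega
  · refine ⟨_, _, rfl, by simp, by simp, ?_, fun _ _ => rfl, ?_⟩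
    · intro x hx
      simp [show x ≠ 11 by omega, show x ≠ 12 by omega]
    · intro x hx0 hx
      omega
  · rintro τ _ hτ ⟨f, g, rfl, hf11, hf12, hf, hg, hg6⟩
    refine ⟨by simp only [List.length_cons, List.length_nil]; omega, f, g, rfl, hf, hg, ?_⟩
    intro x hx0 hx
    exact hg6 x hx0 (by omega)

/-- Initialize the blocks, their intervals, and the times. -/
def initProg : Prog :=
  .seq (block [.op .sub 10 10 2, .const 11 0, .op .add 12 0 2, .rconst 8 1])
    (.loop (.wle 11 12)
      (block [.store 5 11 10, .store 7 11 11, .store 8 11 11, .store 9 11 11, .rstore 5 11 8,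
        .rstore 6 11 8, .op .add 11 11 2]))

/-- The program does not know `m`, but `m ≤ n + 2`, so `n + 2` cells always suffice. Times are
preset to `1` because an index below `m` that is the rank of no arrival time is that of the point
`1`. -/
lemma runs_initProg {σ : State} {n B : ℕ} (h0 : σ.reg 0 = n) (h2 : σ.reg 2 = 1)
    (h10 : σ.reg 10 = 2 ^ B) (hB : 1 ≤ B) (hBw : B < w) (hnw : n + 2 < 2 ^ w) :
    Runs w initProg σ (fun τ σ' => τ ≤ 9 * n + 30 ∧
      (∀ x < 10, σ'.reg x = σ.reg x) ∧ (∀ x < 8, σ'.rreg x = σ.rreg x) ∧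
      (∀ A, A ≠ 5 → A < 7 → σ'.arr A = σ.arr A) ∧
      (∀ A < 5, σ'.rarr A = σ.rarr A) ∧
      ∀ j < n + 2, σ'.arr 5 j = 2 ^ B - 1 ∧ σ'.arr 7 j = j ∧ σ'.arr 8 j = j ∧ σ'.arr 9 j = j ∧
        σ'.rarr 5 j = 1 ∧ σ'.rarr 6 j = 1) := by
  have hpow : 2 ^ B < 2 ^ w := Nat.pow_lt_pow_right (by norm_num) hBw
  have hpow1 : 2 ≤ 2 ^ B := Nat.le_self_pow (by omega) 2
  apply runs_block_seq
  simp only [evalBlock, Instr.eval, Function.update_apply, Nat.reduceEqDiff, ↓reduceIte, h0, h2,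
    h10]
  rw [sub_eval (by omega) hpow, add_eval (by omega), Nat.zero_mod]
  refine runs_loop_const (n + 2) 8 (fun i σ' => σ'.reg 10 = 2 ^ B - 1 ∧ σ'.reg 11 = i ∧
      σ'.reg 12 = n + 1 ∧ σ'.rreg 8 = 1 ∧
      (∀ x < 10, σ'.reg x = σ.reg x) ∧ (∀ x < 8, σ'.rreg x = σ.rreg x) ∧
      (∀ A, A ≠ 5 → A < 7 → σ'.arr A = σ.arr A) ∧
      (∀ A < 5, σ'.rarr A = σ.rarr A) ∧
      ∀ j < i, σ'.arr 5 j = 2 ^ B - 1 ∧ σ'.arr 7 j = j ∧ σ'.arr 8 j = j ∧ σ'.arr 9 j = j ∧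
        σ'.rarr 5 j = 1 ∧ σ'.rarr 6 j = 1) ?_ ?_ ?_ ?_
  · rintro i hi σ₁ ⟨h1, h3, h4, h5, h6, h7, h8, h9, h11⟩
    constructor
    · simp only [Test.Holds, h3, h4]
      omega
    apply runs_block
    simp only [evalBlock, Instr.eval, Function.update_apply, Nat.reduceEqDiff, ↓reduceIte, h1, h3,
      h5, h6 2 (by norm_num), h2]
    rw [add_eval (by omega)]
    refine ⟨by norm_num, by trivial, by trivial, ?_, by trivial, ?_, h7, ?_, ?_, ?_⟩
    · exact h4
    · intro x hx
      rw [if_neg (by omega), h6 x hx]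
    · intro A hA5 hA7
      rw [if_neg (by omega), if_neg (by omega), if_neg (by omega), if_neg hA5, h8 A hA5 hA7]
    · intro A hA
      rw [if_neg (by omega), if_neg (by omega), h9 A hA]
    · intro j hj
      rcases eq_or_ne j i with rfl | hji
      · simp
      · simpa [hji] using h11 j (by omega)
  · rintro σ₁ ⟨h1, h3, h4, -⟩
    simp only [Test.Holds, h3, h4]
    omega
  · refine ⟨by simp, by simp, by simp, by simp, ?_, ?_, fun _ _ _ => rfl, fun _ _ => rfl, ?_⟩
    · intro x hx
      simp [show x ≠ 10 by omega, show x ≠ 11 by omega, show x ≠ 12 by omega]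
    · intro x hx
      simp [show x ≠ 8 by omega]
    · intro j hj
      omega
  · rintro τ σ₁ hτ ⟨h1, h3, h4, h5, h6⟩
    exact ⟨by simp only [List.length_cons, List.length_nil]; omega, h6⟩

/-- Store the arrival times by rank, and distribute the jobs to buckets by the ranks of their
deadlines. -/
def distributeProg : Prog :=
  .seq (block [.const 11 0])
    (.loop (.wlt 11 0)
      (block [.load 12 0 11, .rload 9 0 11, .rstore 5 12 9, .rstore 6 12 9, .load 13 1 11,
        .load 14 3 13, .store 4 11 14, .op .add 14 11 2, .store 3 13 14, .op .add 11 11 2]))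

/-- The jobs among the first `i` ones whose rank is `r`, in decreasing order. -/
def bucketUpTo {n : ℕ} (rank : Fin n → ℕ) : ℕ → ℕ → List (Fin n)
  | 0, _ => []
  | i + 1, r =>
    if h : i < n then
      if rank ⟨i, h⟩ = r then ⟨i, h⟩ :: bucketUpTo rank i r else bucketUpTo rank i r
    else bucketUpTo rank i r

lemma mem_bucketUpTo {n : ℕ} {rank : Fin n → ℕ} {i r : ℕ} {k : Fin n} :
    k ∈ bucketUpTo rank i r ↔ (k : ℕ) < i ∧ rank k = r := by
  induction i with
  | zero => simp [bucketUpTo]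
  | succ i ih =>
    unfold bucketUpTo
    have hlt : (k : ℕ) < i + 1 ↔ (k : ℕ) < i ∨ (k : ℕ) = i := by omega
    split_ifs with h1 h2
    · rw [List.mem_cons, ih, hlt]
      constructor
      · rintro (rfl | h)
        · exact ⟨Or.inr rfl, h2⟩
        · exact ⟨Or.inl h.1, h.2⟩
      · rintro ⟨h | h, h3⟩
        · exact Or.inr ⟨h, h3⟩
        · exact Or.inl (Fin.ext h)
    · rw [ih, hlt]
      constructor
      · rintro ⟨h3, h4⟩
        exact ⟨Or.inl h3, h4⟩
      · rintro ⟨h3 | h3, h4⟩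
        · exact ⟨h3, h4⟩
        · exfalso
          apply h2
          rw [← h4]
          congr 1
          exact Fin.ext h3.symm
    · rw [ih]
      have := k.2
      constructor
      · exact fun h => ⟨by omega, h.2⟩
      · exact fun h => ⟨by omega, h.2⟩

lemma nodup_bucketUpTo {n : ℕ} (rank : Fin n → ℕ) (i r : ℕ) : (bucketUpTo rank i r).Nodup := by
  induction i with
  | zero => simp [bucketUpTo]
  | succ i ih =>
    unfold bucketUpTo
    split_ifs with h1 h2
    · refine List.nodup_cons.2 ⟨?_, ih⟩
      rw [mem_bucketUpTo]
      simp
    · exact ih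
    · exact ih

/-- By `hconst` jobs with the same rank have the same arrival time, so overwriting a cell does no
harm. Each job is put at the head of its bucket, whence the decreasing order in `bucketUpTo`. -/
lemma runs_distributeProg {n : ℕ} {σ : State} {arank drank : Fin n → ℕ} {a : Fin n → ℝ}
    (h0 : σ.reg 0 = n) (h2 : σ.reg 2 = 1) (hnw : n + 2 < 2 ^ w)
    (harank : ∀ k : Fin n, σ.arr 0 k = arank k) (hdrank : ∀ k : Fin n, σ.arr 1 k = drank k)
    (ha : ∀ k : Fin n, σ.rarr 0 k = a k) (hconst : ∀ k l, arank k = arank l → a k = a l)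
    (hhead : ∀ r, σ.arr 3 r = 0) :
    Runs w distributeProg σ (fun τ σ' => τ ≤ 12 * n + 3 ∧
      (∀ x < 10, σ'.reg x = σ.reg x) ∧ (∀ x < 8, σ'.rreg x = σ.rreg x) ∧
      (∀ A, A ≠ 3 → A ≠ 4 → σ'.arr A = σ.arr A) ∧
      (∀ A < 5, σ'.rarr A = σ.rarr A) ∧
      (∀ k, σ'.rarr 5 (arank k) = a k) ∧ (∀ k, σ'.rarr 6 (arank k) = a k) ∧
      (∀ q, (∀ k, arank k ≠ q) → σ'.rarr 5 q = σ.rarr 5 q ∧ σ'.rarr 6 q = σ.rarr 6 q) ∧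
      ∀ r, Chain (σ'.arr 4) (σ'.arr 3 r) (bucketUpTo drank n r)) := by
  apply runs_block_seq
  simp only [evalBlock, Instr.eval, Nat.zero_mod]
  refine runs_loop_const n 11 (fun i σ' => σ'.reg 11 = i ∧
      (∀ x < 10, σ'.reg x = σ.reg x) ∧ (∀ x < 8, σ'.rreg x = σ.rreg x) ∧
      (∀ A, A ≠ 3 → A ≠ 4 → σ'.arr A = σ.arr A) ∧
      (∀ A < 5, σ'.rarr A = σ.rarr A) ∧
      (∀ k : Fin n, (k : ℕ) < i → σ'.rarr 5 (arank k) = a k ∧ σ'.rarr 6 (arank k) = a k) ∧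
      (∀ q, (∀ k, arank k ≠ q) → σ'.rarr 5 q = σ.rarr 5 q ∧ σ'.rarr 6 q = σ.rarr 6 q) ∧
      ∀ r, Chain (σ'.arr 4) (σ'.arr 3 r) (bucketUpTo drank i r)) ?_ ?_ ?_ ?_
  · rintro i hi σ₁ ⟨h1, h3, h4, h5, h6, h7, h8, h9⟩
    constructor
    · simp only [Test.Holds, h1, h3 0 (by norm_num), h0]
      exact hi
    have e1 := harank ⟨i, hi⟩
    have e2 := hdrank ⟨i, hi⟩
    have e3 := ha ⟨i, hi⟩
    simp only at e1 e2 e3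
    apply runs_block
    simp only [evalBlock, Instr.eval, Function.update_apply, Nat.reduceEqDiff, ↓reduceIte, h1,
      h3 2 (by norm_num), h2, h5 0 (by norm_num) (by norm_num), h5 1 (by norm_num) (by norm_num),
      h6 0 (by norm_num), e1, e2, e3]
    rw [add_eval (by omega)]
    refine ⟨by norm_num, by trivial, ?_, ?_, ?_, ?_, ?_, ?_, ?_⟩
    · intro x hx
      rw [if_neg (by omega), if_neg (by omega), if_neg (by omega), if_neg (by omega),
        if_neg (by omega), h3 x hx]
    · intro x hx
      rw [if_neg (by omega), h4 x hx]
    · intro A hA3 hA4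
      rw [if_neg hA3, if_neg hA4, h5 A hA3 hA4]
    · intro A hA
      rw [if_neg (by omega), if_neg (by omega), h6 A hA]
    · intro k hk
      split_ifs with hki
      · rw [hconst k ⟨i, hi⟩ hki]
        exact ⟨rfl, rfl⟩
      · refine h7 k ?_
        rcases Nat.lt_succ_iff_lt_or_eq.1 hk with h | h
        · exact h
        · exact absurd (congrArg arank (Fin.ext h)) hki
    · intro q hq
      rw [if_neg (hq _).symm, if_neg (hq _).symm]
      exact h8 q hq
    · intro r
      -- The link of job `i` is written for the first time; the chains so far contain only smaller
      -- job numbers.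
      have hchain : ∀ r, Chain (Function.update (σ₁.arr 4) i (σ₁.arr 3 (drank ⟨i, hi⟩)))
          (σ₁.arr 3 r) (bucketUpTo drank i r) := by
        intro r
        refine (h9 r).congr ?_
        intro k hk
        rw [mem_bucketUpTo] at hk
        rw [Function.update_of_ne hk.1.ne]
      rw [bucketUpTo, dif_pos hi]
      split_ifs with hr1 hr2 hr2
      · refine ⟨rfl, ?_⟩
        simp only [Function.update_self]
        rw [hr1]
        exact hchain _
      · exact absurd hr1.symm hr2
      · exact absurd hr2.symm hr1
      · exact hchain r
  · rintro σ₁ ⟨h1, h3, -⟩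
    simp only [Test.Holds, h1, h3 0 (by norm_num), h0, lt_irrefl, not_false_eq_true]
  · refine ⟨by simp, ?_, fun _ _ => rfl, fun _ _ _ => rfl, fun _ _ => rfl, ?_,
      fun _ _ => ⟨rfl, rfl⟩, ?_⟩
    · intro x hx
      simp [show x ≠ 11 by omega]
    · intro k hk
      omega
    · intro r
      exact hhead r
  · rintro τ σ₁ hτ ⟨h1, h3, h4, h5, h6, h7, h8, h9⟩
    exact ⟨by simp only [List.length_cons, List.length_nil]; omega, h3, h4, h5, h6,
      fun k => (h7 k k.2).1, fun k => (h7 k k.2).2, h8, h9⟩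

/-! ## The linear-time program -/

lemma Outputs.unique {n : ℕ} {σ : State} {L L' : List (Piece n)} (h : Outputs σ L)
    (h' : Outputs σ L') : L = L' := by
  have hlen : L.length = L'.length := h.1.symm.trans h'.1
  apply List.ext_getElem hlen
  intro i h1 h2
  obtain ⟨a1, a2, a3⟩ := h.2 i h1
  obtain ⟨b1, b2, b3⟩ := h'.2 i h2
  rw [a1] at b1
  rw [a2] at b2
  rw [a3] at b3
  generalize L[i] = p at *
  generalize L'[i] = q at *
  cases p
  cases q
  simp only at b1 b2 b3
  rw [Piece.mk.injEq]
  exact ⟨Fin.ext b1, b2, b3⟩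

/-- The jobs sorted by deadline. -/
def deadlineList {n : ℕ} (J : JobSet n) : List (Fin n) :=
  (List.range' 1 n).flatMap
    (bucketUpTo (fun k => rankIn (Finset.univ.image J.b) (J.b k)) n)

lemma deadline_mem_image {n : ℕ} (J : JobSet n) (k : Fin n) :
    J.b k ∈ Finset.univ.image J.b := by simp

lemma mem_deadlineList {n : ℕ} (J : JobSet n) (k : Fin n) : k ∈ deadlineList J := by
  unfold deadlineList
  rw [List.mem_flatMap]
  refine ⟨rankIn (Finset.univ.image J.b) (J.b k), ?_, mem_bucketUpTo.2 ⟨k.2, rfl⟩⟩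
  rw [List.mem_range'_1]
  have h1 := one_le_rankIn (deadline_mem_image J k)
  have h2 := rankIn_le_card (T := Finset.univ.image J.b) (J.b k)
  have h3 := Finset.card_image_le (s := Finset.univ) (f := J.b)
  rw [Finset.card_univ, Fintype.card_fin] at h3
  omega

lemma nodup_deadlineList {n : ℕ} (J : JobSet n) : (deadlineList J).Nodup := by
  unfold deadlineList
  rw [List.nodup_flatMap]
  refine ⟨fun r _ => nodup_bucketUpTo _ _ _, ?_⟩
  refine (List.nodup_range' (s := 1) (n := n)).imp ?_
  intro r r' hne k hk hk'
  rw [mem_bucketUpTo] at hk hk'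
  exact hne (hk.2.symm.trans hk'.2)

/-- Ranks reflect the order of the deadlines: equal inside a bucket, increasing from one bucket to
the next. -/
lemma pairwise_deadlineList {n : ℕ} (J : JobSet n) :
    (deadlineList J).Pairwise (fun k l => J.b k ≤ J.b l) := by
  unfold deadlineList
  rw [List.pairwise_flatMap]
  constructor
  · intro r _
    apply List.pairwise_of_forall_mem_list
    intro k hk l hl
    rw [mem_bucketUpTo] at hk hl
    exact le_of_rankIn_le (deadline_mem_image J k) (hk.2.trans hl.2.symm).le
  · refine (List.pairwise_lt_range' (s := 1) (n := n)).imp ?_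
    intro r r' hlt k hk l hl
    rw [mem_bucketUpTo] at hk hl
    apply le_of_rankIn_le (deadline_mem_image J k)
    rw [hk.2, hl.2]
    exact hlt.le

lemma exists_deadlineOrder {n : ℕ} (J : JobSet n) :
    ∃ π : Equiv.Perm (Fin n), IsDeadlineOrder J π ∧ List.ofFn π = deadlineList J := by
  have e := (nodup_deadlineList J).getEquivOfForallMemList _ (mem_deadlineList J)
  have hlen : (deadlineList J).length = n := by
    simpa using Fintype.card_congr e
  have key : ∃ π : Equiv.Perm (Fin n), List.ofFn π = deadlineList J := by
    refine ⟨(finCongr hlen.symm).trans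
      ((nodup_deadlineList J).getEquivOfForallMemList _ (mem_deadlineList J)), ?_⟩
    apply List.ext_getElem
    · simp [hlen]
    · intro i h1 h2
      simp [List.Nodup.getEquivOfForallMemList]
  obtain ⟨π, hπ⟩ := key
  refine ⟨π, ?_, hπ⟩
  have hpair := pairwise_deadlineList J
  rw [← hπ, List.pairwise_ofFn] at hpair
  intro i j hij
  rcases hij.eq_or_lt with rfl | hlt
  · exact le_rfl
  · exact hpair hlt

/-- Everything that precedes the placement of the jobs. -/
def setupProg : Prog := .seq blockSizeProg (.seq tableProg (.seq initProg distributeProg))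

lemma two_pow_blockSize_le (n : ℕ) : 2 ^ (Nat.log 2 n + 1) ≤ 2 * n + 2 := by
  rcases Nat.eq_zero_or_pos n with rfl | hn
  · simp
  · have := Nat.pow_log_le_self 2 hn.ne'
    rw [pow_succ]
    omega

/-- The constant `8` gives `w ≥ B + 7` with `B = ⌊log₂ n⌋ + 1`, and `n < 2 ^ B`. The factor 128
leaves room for all addresses, counters and intermediate sums, so no arithmetic wraps around. -/
lemma bound_of_wordSize {n : ℕ} (hw : 8 * (Nat.log 2 n + 1) ≤ w) :
    128 * 2 ^ (Nat.log 2 n + 1) ≤ 2 ^ w := by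
  have : 128 * 2 ^ (Nat.log 2 n + 1) = 2 ^ (7 + (Nat.log 2 n + 1)) := by
    rw [pow_add 2 7]; norm_num
  rw [this]
  exact Nat.pow_le_pow_right (by norm_num) (by omega)

lemma ofFn_apply {α : Type} [Zero α] {n : ℕ} (f : Fin n → α) (k : Fin n) : ofFn f k = f k := by
  simp [ofFn]

/-- The quantifier over `ε` stands inside the postcondition: one memory state encodes the initial
states for all `ε`, as `ε` enters only the last time point, which is not stored. -/
lemma runs_setupProg {n : ℕ} (J : JobSet n) (s : ℝ) (hw : 8 * (Nat.log 2 n + 1) ≤ w) :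
    Runs w setupProg (input J s) (fun t σ => t ≤ 100 * (n + 1) ∧ σ.reg 0 = n ∧
      (∀ r, Chain (σ.arr 4) (σ.arr 3 r)
        (bucketUpTo (fun k => rankIn (Finset.univ.image J.b) (J.b k)) n r)) ∧
      ∀ ε : ℝ, 0 < ε → Encodes J s (timePoints J ε) (Nat.log 2 n + 1)
        (AlgState.init n (timePoints J ε)) σ) := by
  have hpow := bound_of_wordSize hw
  have hBn := two_pow_blockSize_le n
  have hnB : n < 2 ^ (Nat.log 2 n + 1) := Nat.lt_pow_succ_log_self (by norm_num) n
  have hlogn := Nat.log_le_self 2 n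
  have hBpow := Nat.lt_two_pow_self (n := Nat.log 2 n + 1)
  set B := Nat.log 2 n + 1 with hB
  apply runs_seq
  refine (runs_blockSizeProg (n := n) (by simp [input]) (by omega) (by omega)).mono ?_
  rintro t₁ _ ⟨ht₁, f, rfl, hf2, hf3, hf10, hf⟩
  apply runs_seq
  refine (runs_tableProg (B := B) hf2 ?_ hf10 (by omega) (by omega)).mono ?_
  · change f 9 = 0
    rw [hf 9 (by norm_num) (by norm_num) (by norm_num)]
    simp [input]
  rintro t₂ _ ⟨ht₂, f₂, g₂, rfl, hf₂, hg₂, htab⟩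
  dsimp only at hf₂ hg₂
  apply runs_seq
  refine (runs_initProg (n := n) (B := B) ?_ ?_ ?_ (by omega) (by omega) (by omega)).mono ?_
  · change f₂ 0 = n
    rw [hf₂ 0 (by norm_num), hf 0 (by norm_num) (by norm_num) (by norm_num)]
    simp [input]
  · change f₂ 2 = 1
    rw [hf₂ 2 (by norm_num), hf2]
  · change f₂ 10 = 2 ^ B
    rw [hf₂ 10 (by norm_num), hf10]
  rintro t₃ σ₃ ⟨ht₃, hreg₃, hrreg₃, harr₃, hrarr₃, hinit⟩
  dsimp only at hreg₃ hrreg₃ harr₃ hrarr₃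
  refine (runs_distributeProg (n := n)
    (arank := fun k => rankIn (Finset.univ.image J.a) (J.a k))
    (drank := fun k => rankIn (Finset.univ.image J.b) (J.b k)) (a := J.a)
    ?_ ?_ (by omega) ?_ ?_ ?_ ?_ ?_).mono ?_
  · rw [hreg₃ 0 (by norm_num)]
    rw [hf₂ 0 (by norm_num), hf 0 (by norm_num) (by norm_num) (by norm_num)]
    simp [input]
  · rw [hreg₃ 2 (by norm_num)]
    rw [hf₂ 2 (by norm_num), hf2]
  · intro k
    rw [harr₃ 0 (by norm_num) (by norm_num)]
    rw [hg₂ 0 (by norm_num)]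
    simp [input, ofFn_apply]
  · intro k
    rw [harr₃ 1 (by norm_num) (by norm_num)]
    rw [hg₂ 1 (by norm_num)]
    simp [input, ofFn_apply]
  · intro k
    rw [hrarr₃ 0 (by norm_num)]
    simp [input, ofFn_apply]
  · intro k l hkl
    have hmem : ∀ k, J.a k ∈ Finset.univ.image J.a := by simp
    exact le_antisymm (le_of_rankIn_le (hmem k) hkl.le) (le_of_rankIn_le (hmem l) hkl.ge)
  · intro r
    rw [harr₃ 3 (by norm_num) (by norm_num)]
    rw [hg₂ 3 (by norm_num)]
    simp [input]
  rintro t₄ σ₄ ⟨ht₄, hreg₄, hrreg₄, harr₄, hrarr₄, htimes, he, hrest, hchain⟩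
  have hreg : ∀ x < 10, x ≠ 2 → x ≠ 3 → σ₄.reg x = (input J s).reg x := by
    intro x hx hx2 hx3
    rw [hreg₄ x hx, hreg₃ x hx]
    rw [hf₂ x (by omega), hf x hx2 hx3 (by omega)]
  refine ⟨?_, ?_, hchain, ?_⟩
  · omega
  · rw [hreg 0 (by norm_num) (by norm_num) (by norm_num)]
    simp [input]
  intro ε hε
  have hm := two_le_card_timePoints J hε
  have hmn := card_timePoints_le J hε
  have hNB : ((timePoints J ε).card - 1) / B ≤ n + 1 :=
    (Nat.div_le_self _ _).trans (by omega)
  have hval := AlgState.Valid.init (n := n) (T := timePoints J ε)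
  have hdead : (AlgState.init n (timePoints J ε)).dead (timePoints J ε) = ∅ :=
    Finset.card_eq_zero.1 hval.unions_eq.symm
  have hone : 2 ≤ 2 ^ B := Nat.le_self_pow (by omega) 2
  have htime : ∀ q, 1 ≤ q → q < (timePoints J ε).card →
      σ₄.rarr 5 q = nthSmallest (timePoints J ε) q ∧
      σ₄.rarr 6 q = nthSmallest (timePoints J ε) q := by
    intro q h1 h2
    by_cases hex : ∃ k, rankIn (Finset.univ.image J.a) (J.a k) = q
    · obtain ⟨k, rfl⟩ := hex
      rw [htimes k, he k, ← rankIn_timePoints_arrival J hε,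
        nthSmallest_rankIn (arrival_mem_timePoints J ε k)]
      exact ⟨rfl, rfl⟩
    · push Not at hex
      have h3 := hinit q (by omega)
      rw [(hrest q hex).1, (hrest q hex).2, h3.2.2.2.2.1, h3.2.2.2.2.2]
      rcases nthSmallest_timePoints_cases J hε h1 h2 with h4 | ⟨k, h4, -⟩
      · rw [h4]
        exact ⟨rfl, rfl⟩
      · rw [rankIn_timePoints_arrival J hε] at h4
        exact absurd h4 (hex k)
  refine ⟨⟨?_, ?_, ?_, ⟨?_, ?_⟩, ?_, ?_⟩, ?_, ?_, ?_, ?_, ?_, ?_, fun q h1 h2 => (htime q h1 h2).1,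
    fun q h1 h2 => (htime q h1 h2).2, ?_⟩
  · rw [hreg₄ 2 (by norm_num), hreg₃ 2 (by norm_num)]
    rw [hf₂ 2 (by norm_num), hf2]
  · rw [hreg₄ 3 (by norm_num), hreg₃ 3 (by norm_num)]
    rw [hf₂ 3 (by norm_num), hf3]
  · rw [hreg 9 (by norm_num) (by norm_num) (by norm_num)]
    simp [input]
  · intro j hj
    rw [harr₄ 5 (by norm_num) (by norm_num), (hinit j (by omega)).1]
    omega
  · intro j hj c hc
    rw [harr₄ 5 (by norm_num) (by norm_num), (hinit j (by omega)).1, hdead,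
      Nat.testBit_two_pow_sub_one]
    simp [hc]
  · rw [harr₄ 6 (by norm_num) (by norm_num), harr₃ 6 (by norm_num) (by norm_num)]
    exact htab
  · rw [harr₄ 5 (by norm_num) (by norm_num), harr₄ 7 (by norm_num) (by norm_num),
      harr₄ 8 (by norm_num) (by norm_num), harr₄ 9 (by norm_num) (by norm_num)]
    apply QuickFind.singletons
    · exact fun x hx => (hinit x (by omega)).2.1
    · exact fun x hx => (hinit x (by omega)).2.2.1
    · exact fun x hx => (hinit x (by omega)).2.2.2.1
    · intro x hx
      rw [(hinit x (by omega)).1]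
      omega
  · rw [hreg 1 (by norm_num) (by norm_num) (by norm_num)]
    simp [input, AlgState.init]
  · rw [hrreg₄ 0 (by norm_num), hrreg₃ 0 (by norm_num)]
    simp [input]
  · rw [hrreg₄ 1 (by norm_num), hrreg₃ 1 (by norm_num)]
    simp [input]
  · intro k
    rw [harr₄ 0 (by norm_num) (by norm_num), harr₃ 0 (by norm_num) (by norm_num)]
    rw [hg₂ 0 (by norm_num), rankIn_timePoints_arrival J hε]
    simp [input, ofFn_apply]
  · intro k
    rw [hrarr₄ 1 (by norm_num), hrarr₃ 1 (by norm_num)]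
    simp [input, ofFn_apply]
  · intro k
    rw [hrarr₄ 2 (by norm_num), hrarr₃ 2 (by norm_num)]
    simp [input, ofFn_apply]
  · intro j hj
    exact absurd hj (Nat.not_lt_zero j)

/-- The whole program. -/
def edfProg : Prog := .seq setupProg scheduleProg

/-- With a word size of at least `8 (⌊log₂ n⌋ + 1)`, the program runs in linear time, and simulates
the algorithm for every `ε`. -/
lemma runs_edfProg {n : ℕ} (J : JobSet n) {s : ℝ} (hs : 0 < s)
    (hw : 8 * (Nat.log 2 n + 1) ≤ w) {π : Equiv.Perm (Fin n)}
    (hord : IsDeadlineOrder J π) (hπ : List.ofFn π = deadlineList J) {ε : ℝ} (hε : 0 < ε) :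
    ∃ τ : AlgState n, AlgRun J s ε π τ ∧
      (∃ S : Schedule n, IsSSchedule J s S ∧ Represents τ.pieces S) ∧
      Runs w edfProg (input J s) (fun t σ => t ≤ 400 * (n + 1) ∧ Outputs σ τ.pieces) := by
  obtain ⟨τ, hrun, hS, hun, hfi, hlen⟩ := exists_algRun J π hs hε hord
  refine ⟨τ, hrun, hS, ?_⟩
  have hpow := bound_of_wordSize hw
  have hnB : n < 2 ^ (Nat.log 2 n + 1) := Nat.lt_pow_succ_log_self (by norm_num) n
  have hlogn := Nat.log_le_self 2 n
  have hm := two_le_card_timePoints J hε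
  have hmn := card_timePoints_le J hε
  have hBpow := Nat.lt_two_pow_self (n := Nat.log 2 n + 1)
  have hnlen : (deadlineList J).length = n := by rw [← hπ, List.length_ofFn]
  apply runs_seq
  refine (runs_setupProg J s hw).mono ?_
  rintro t₁ σ₁ ⟨ht₁, h0, hchain, henc⟩
  unfold AlgRun at hrun
  rw [hπ] at hrun
  refine (runs_scheduleProg (bucket := bucketUpTo
    (fun k => rankIn (Finset.univ.image J.b) (J.b k)) n) hs hε ⟨by omega, by omega, by omega⟩
    (by omega) hrun (henc ε hε) AlgState.Valid.init h0 hchain (by omega)).mono ?_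
  rintro t₂ σ₂ ⟨hout, ht₂⟩
  refine ⟨?_, hout⟩
  change _ ≤ _ + _ + 120 * (deadlineList J).length + _ + _ at ht₂
  rw [hnlen] at ht₂
  -- From `M * B ≤ n + 1`, `B ≤ n + 1` and `log₂ (M + 1) ≤ B` it follows that `(M + 1) log₂ (M + 1)
  -- ≤ M * B + B ≤ 2 (n + 1)`. This is where blocks of logarithmic length make quick-find linear.
  set B := Nat.log 2 n + 1 with hB
  set M := ((timePoints J ε).card - 1) / B with hM
  have hMB : M * B ≤ n + 1 := (Nat.div_mul_le_self _ _).trans (by omega)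
  have hMn : M ≤ n + 1 := (Nat.div_le_self _ _).trans (by omega)
  have hlog : Nat.log 2 (M + 1) ≤ B := by
    refine Nat.lt_succ_iff.1 (Nat.log_lt_of_lt_pow (Nat.succ_ne_zero M) ?_)
    rw [pow_succ]
    omega
  have hprod : (M + 1) * Nat.log 2 (M + 1) ≤ 2 * (n + 1) := by
    refine (Nat.mul_le_mul_left _ hlog).trans ?_
    rw [Nat.add_mul, Nat.one_mul]
    omega
  rw [Nat.mul_assoc 4 (M + 1)] at ht₂
  omega

end RAM

end

theorem theorem1 :
    -- the algorithm terminates, its output is an `s`-schedule, and the operation counts hold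
    (∀ (n : ℕ) (J : JobSet n) (s ε : ℝ) (π : Equiv.Perm (Fin n)),
      0 < s → 0 < ε → IsDeadlineOrder J π →
      ∃ σ : AlgState n, AlgRun J s ε π σ ∧
        (∃ S : Schedule n, IsSSchedule J s S ∧ Represents σ.pieces S) ∧
        σ.unions ≤ (timePoints J ε).card - 2 ∧
        σ.finds ≤ 2 * ((timePoints J ε).card - 2) + n) ∧
    -- linear time on the unit-cost RAM with logarithmic word size
    (∃ (P : RAM.Prog) (c C : ℕ), ∀ (n : ℕ) (J : JobSet n) (s : ℝ) (w : ℕ),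
      0 < s → c * (Nat.log 2 n + 1) ≤ w →
      ∃ (τ : ℕ) (st : RAM.State) (L : List (Piece n)),
        RAM.Exec w P (RAM.input J s) τ st ∧ τ ≤ C * (n + 1) ∧ RAM.Outputs st L ∧
        (∃ S : Schedule n, IsSSchedule J s S ∧ Represents L S) ∧
        ∃ π : Equiv.Perm (Fin n), IsDeadlineOrder J π ∧
          ∀ ε : ℝ, 0 < ε → ∃ σ : AlgState n, AlgRun J s ε π σ ∧ σ.pieces = L) := by
  constructor
  · intro n J s ε π hs hε hπ
    obtain ⟨σ, h1, h2, h3, h4, -⟩ := exists_algRun J π hs hε hπ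
    exact ⟨σ, h1, h2, h3, h4⟩
  · refine ⟨RAM.edfProg, 8, 400, fun n J s w hs hw => ?_⟩
    obtain ⟨π, hord, hπ⟩ := RAM.exists_deadlineOrder J
    -- The list is read off from the simulation with `ε = 1`. For any other `ε` the run is the same
    -- by determinism, and the memory determines the list.
    obtain ⟨σ, -, hS, t, st, hex, ht, hout⟩ := RAM.runs_edfProg J hs hw hord hπ one_pos
    refine ⟨t, st, σ.pieces, hex, ht, hout, hS, π, hord, fun ε hε => ?_⟩
    obtain ⟨σ', hrun, -, t', st', hex', -, hout'⟩ := RAM.runs_edfProg J hs hw hord hπ hε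
    obtain ⟨-, rfl⟩ := hex.deterministic hex'
    exact ⟨σ', hrun, hout'.unique hout⟩
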